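/- Let $X_1,X_2,\dots$ be i.i.d. real random variables whose distribution function $F$ is continuous. Put $$\Delta=\int_{-\infty}^{\infty}\Big(P\Big(\tfrac{X_1X_2-1}{2X_2}\le t\Big)-P(X_3<t)\Big)\,dF(t),$$ $$h(x_1,x_2,x_3)=\tfrac13\Big(\mathrm I\big\{\tfrac{x_1x_2-1}{2x_2}\le x_3\big\}+\mathrm I\big\{\tfrac{x_1x_3-1}{2x_3}\le x_2\big\}+\mathrm I\big\{\tfrac{x_2x_3-1}{2x_3}\le x_1\big\}\Big)-\tfrac12,$$ $$\widehat\Delta^*_n=\binom n3^{-1}\sum_{1\le k<j<i\le n}\mathrm I\Big\{\tfrac{X_iX_j-1}{2X_j}\le X_k\Big\}-\tfrac12 .$$ For $1\le i\le n$ let $\widehat J_i=n\widehat\Delta^*_n-(n-1)\widehat\Delta^{*(-i)}_{n-1}$ be the jackknife pseudo-values, where $\widehat\Delta^{*(-i)}_{n-1}$ is the same statistic computed from the $n-1$ observations $X_1,\dots,X_{i-1},X_{i+1},\dots,X_n$ (in this order). The jackknife empirical likelihood ratio at $\theta\in\mathbb R$ is $$\mathcal R_n(\theta)=\max\Big\{\prod_{i=1}^n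 np_i:\ p_i\ge 0,\ \sum_{i=1}^n p_i=1,\ \sum_{i=1}^n p_i\widehat J_i=\theta\Big\},$$ with $\mathcal R_n(\theta)=0$ and $-2\log\mathcal R_n(\theta)=+\infty$ if no such $p$ exists. Assume that (1) $E[h^2(X_1,X_2,X_3)]<\infty$, and (2) $\sigma_1^2=\operatorname{Var}\big(E[h(X_1,X_2,X_3)\mid X_1]\big)>0$. Then, as $n\to\infty$, $-2\log\mathcal R_n(\Delta)$ converges in distribution (as extended real random variables) to the chi-squared distribution with one degree of freedom. In particular, under the null hypothesis that the $X_i$ have the standard Cauchy distribution $\mathcal C(0,1)$, one has $\Delta=0$ and $-2\log\mathcal R_n(0)$, the likelihood ratio statistic with the constraint $\sum_i p_i\widehat J_i=0$, converges in distribution to the chi-squared distribution with one degree of freedom. -/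

import Mathlib

open MeasureTheory ProbabilityTheory Filter

noncomputable section

namespace CauchyJEL

/-- The indicator of `(a b - 1) / (2 b) ≤ c`. -/
def kern (a b c : ℝ) : ℝ := if (a * b - 1) / (2 * b) ≤ c then 1 else 0

/-- The kernel `h` of the test statistic. -/
def h (x₁ x₂ x₃ : ℝ) : ℝ :=
  (1 / 3) * (kern x₁ x₂ x₃ + kern x₁ x₃ x₂ + kern x₂ x₃ x₁) - 1 / 2

/-- The measure of departure
`Δ = ∫ (P((X₁ X₂ - 1) / (2 X₂) ≤ t) - P(X₃ < t)) dF(t)` of a law `F` on the line. -/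
def departure (F : Measure ℝ) : ℝ :=
  ∫ t, ((F.prod F).real {q : ℝ × ℝ | (q.1 * q.2 - 1) / (2 * q.2) ≤ t} - F.real (Set.Iio t)) ∂F

/-- The estimator of `Δ` computed from the observations `x i`, `i ∈ S`, taken in the order of
their indices; it is the full-sample statistic for `S = {0, …, n - 1}`. -/
def deltaHat (x : ℕ → ℝ) (S : Finset ℕ) : ℝ :=
  ((S.card.choose 3 : ℕ) : ℝ)⁻¹ *
    (∑ i ∈ S, ∑ j ∈ S with j < i, ∑ k ∈ S with k < j, kern (x i) (x j) (x k)) - 1 / 2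

/-- The `i`-th jackknife pseudo-value of the sample `x 0, …, x (n - 1)`. -/
def pseudoValue (x : ℕ → ℝ) (n i : ℕ) : ℝ :=
  n * deltaHat x (Finset.range n) - ((n : ℝ) - 1) * deltaHat x ((Finset.range n).erase i)

/-- The jackknife empirical likelihood ratio at `θ` of the sample `x 0, …, x (n - 1)`. The products
lie in `[0, 1]` and the feasible set is compact, so this is the maximum when there is a feasible
`p`, and it is `0` when there is none. -/
def jelRatio (x : ℕ → ℝ) (n : ℕ) (θ : ℝ) : ℝ :=
  sSup {r : ℝ | ∃ p : ℕ → ℝ, (∀ i ∈ Finset.range n, 0 ≤ p i) ∧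
    ∑ i ∈ Finset.range n, p i = 1 ∧
    ∑ i ∈ Finset.range n, p i * pseudoValue x n i = θ ∧
    r = ∏ i ∈ Finset.range n, (n * p i)}

/-- `-2 log R(θ)`, with the value `+∞` where `R(θ) = 0`. -/
def negTwoLogJEL (x : ℕ → ℝ) (n : ℕ) (θ : ℝ) : EReal :=
  ((-2 : ℝ) : EReal) * ENNReal.log (ENNReal.ofReal (jelRatio x n θ))

/-- The chi-squared distribution with one degree of freedom: the law of the square of a standard
normal variable. -/
def chiSquaredOne : Measure ℝ := (gaussianReal 0 1).map (fun z => z ^ 2)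

instance : IsProbabilityMeasure chiSquaredOne :=
  Measure.isProbabilityMeasure_map (by fun_prop)

end CauchyJEL

end

/-! The theorem is an instance of self-normalisation. The pseudo-values average exactly to the
statistic (`sum_pseudoValue_sub`), and Owen's expansion turns the likelihood ratio statistic into `n
m² / s` up to a small error, where `m` and `s` are the first and second empirical moments of the
pseudo-values about `Δ` (`exists_negTwoLog_elRatio_close`). It then suffices that `√n m / √v` is
asymptotically standard normal and `s - v` tends to zero in probability, for the same deterministic
sequence `v`, bounded away from zero. Convergence of `v` is not needed.

The kernel is not symmetric and only triples `k < j < i` are summed, so the Hoeffding projection of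
the statistic on observation `c` depends on the position of `c`: it is a mixture of `proj₁`,
`proj₂`, `proj₃`, weighted by the numbers of triples in which `c` is the largest, the middle or the
smallest index. This mixture is `projThrough`, and `v` is `varProj`. The linear part obeys a central
limit theorem for bounded triangular arrays. The remainder kernel integrates to zero over any two
arguments, so only triples sharing at least two indices are correlated, and the remainder has mean
square `O(n⁻²)`, against `O(n⁻¹)` for the linear part. Each centred pseudo-value is `3 *
projThrough` plus an error of mean square `O(n⁻¹)`, so the same variance governs `s`.

Positivity of `σ₁²` enters only through the lower bound on `varProj`. The conditional expectation of
`h` is affine in `2 proj₁ + proj₃`, so one of these projections is nonzero. Indices near `n` almost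
always occupy the first place of the kernel and indices near `0` the third, so a fixed fraction of
positions contributes to `varProj`.

Absence of atoms identifies `Δ` with the kernel mean minus `1/2`. For the Cauchy law, symmetry makes
that mean equal to `1/2`. -/

noncomputable section

namespace CauchyJEL

/-! ### Two-sided bounds for the empirical likelihood ratio -/

/-- The empirical likelihood ratio at `θ` of the values `z 0, …, z (n - 1)`. -/
def elRatio (z : ℕ → ℝ) (n : ℕ) (θ : ℝ) : ℝ :=
  sSup {r : ℝ | ∃ p : ℕ → ℝ, (∀ i ∈ Finset.range n, 0 ≤ p i) ∧
    ∑ i ∈ Finset.range n, p i = 1 ∧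
    ∑ i ∈ Finset.range n, p i * z i = θ ∧
    r = ∏ i ∈ Finset.range n, (n * p i)}

lemma jelRatio_eq_elRatio (x : ℕ → ℝ) (n : ℕ) (θ : ℝ) :
    jelRatio x n θ = elRatio (pseudoValue x n) n θ := rfl

/-- The second-order Taylor expansion of `log (1 + u)` has remainder at most `|u|³ / (1 - |u|)`,
which is at most `2|u|³` for `|u| ≤ 1/2`. -/
lemma exp_le_one_add {u : ℝ} (hu : |u| ≤ 1 / 2) :
    Real.exp (u - u ^ 2 / 2 - 2 * |u| ^ 3) ≤ 1 + u := by
  have h1 : |(-u)| < 1 := by rw [abs_neg]; linarith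
  have h2 := Real.abs_log_sub_add_sum_range_le h1 2
  have hpos : 0 < 1 + u := by linarith [neg_abs_le u]
  have h3 : |(-u)| ^ (2 + 1) / (1 - |(-u)|) ≤ 2 * |u| ^ 3 := by
    rw [abs_neg, div_le_iff₀ (by linarith)]
    have := pow_nonneg (abs_nonneg u) 3
    norm_num
    nlinarith
  have h4 := (abs_le.1 (h2.trans h3)).1
  simp only [Finset.sum_range_succ, Finset.sum_range_zero, sub_neg_eq_add] at h4
  norm_num at h4
  rw [← Real.le_log_iff_exp_le hpos]
  linarith

/-- Dual bound on the weighted products, by the arithmetic-geometric mean inequality. -/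
lemma prod_mul_prod_le_one {n : ℕ} {z p : ℕ → ℝ} {θ l : ℝ}
    (hp : ∀ i ∈ Finset.range n, 0 ≤ p i) (hsum : ∑ i ∈ Finset.range n, p i = 1)
    (hmean : ∑ i ∈ Finset.range n, p i * z i = θ)
    (hl : ∀ i ∈ Finset.range n, 0 ≤ 1 + l * (z i - θ)) :
    (∏ i ∈ Finset.range n, (n * p i)) * ∏ i ∈ Finset.range n, (1 + l * (z i - θ)) ≤ 1 := by
  rw [← Finset.prod_mul_distrib]
  calc ∏ i ∈ Finset.range n, (n * p i * (1 + l * (z i - θ)))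
      ≤ ∏ i ∈ Finset.range n, Real.exp (n * p i * (1 + l * (z i - θ)) - 1) := by
        refine Finset.prod_le_prod (fun i hi => ?_) (fun i hi => ?_)
        · have := hp i hi
          have := hl i hi
          positivity
        · have := Real.add_one_le_exp (n * p i * (1 + l * (z i - θ)) - 1)
          linarith
    _ = Real.exp (∑ i ∈ Finset.range n, (n * p i * (1 + l * (z i - θ)) - 1)) :=
        (Real.exp_sum _ _).symm
    _ = 1 := by
        have : ∑ i ∈ Finset.range n, (n * p i * (1 + l * (z i - θ)) - 1)
            = n * (1 - l * θ) * ∑ i ∈ Finset.range n, p i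
              + n * l * ∑ i ∈ Finset.range n, p i * z i - n := by
          rw [Finset.mul_sum, Finset.mul_sum, ← Finset.sum_add_distrib, Finset.sum_sub_distrib]
          simp only [Finset.sum_const, Finset.card_range, nsmul_eq_mul, mul_one]
          congr 1
          exact Finset.sum_congr rfl fun i _ => by ring
        rw [this, hsum, hmean]
        rw [show (n : ℝ) * (1 - l * θ) * 1 + n * l * θ - n = 0 by ring, Real.exp_zero]

lemma exp_sum_le_prod {n : ℕ} {u : ℕ → ℝ} {b : ℝ} (hb : b ≤ 1 / 2)
    (hu : ∀ i ∈ Finset.range n, |u i| ≤ b) :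
    Real.exp (∑ i ∈ Finset.range n, u i - (1 / 2 + 2 * b) * ∑ i ∈ Finset.range n, u i ^ 2)
      ≤ ∏ i ∈ Finset.range n, (1 + u i) := by
  rw [Finset.mul_sum, ← Finset.sum_sub_distrib, Real.exp_sum]
  refine Finset.prod_le_prod (fun i _ => (Real.exp_pos _).le) (fun i hi => ?_)
  refine le_trans (Real.exp_le_exp.2 ?_) (exp_le_one_add ((hu i hi).trans hb))
  have h3 : |u i| ^ 3 ≤ b * u i ^ 2 := by
    rw [← sq_abs (u i), pow_succ']
    exact mul_le_mul_of_nonneg_right (hu i hi) (by positivity)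
  nlinarith

/-- Weak duality: any admissible multiplier bounds every feasible product, so the exact Lagrange
multiplier is not needed. Its first-order approximation `m / s` makes both `∑ u` and `∑ u²` equal to
`n m² / s`, whence the leading exponent `-n m² / (2 s)`. -/
lemma elRatio_le {n : ℕ} {z : ℕ → ℝ} {θ m s B : ℝ} (hs : 0 < s)
    (hm : ∑ i ∈ Finset.range n, (z i - θ) = n * m)
    (hs' : ∑ i ∈ Finset.range n, (z i - θ) ^ 2 = n * s)
    (hB : ∀ i ∈ Finset.range n, |z i - θ| ≤ B) (hsmall : |m| * B / s ≤ 1 / 2) :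
    elRatio z n θ ≤ Real.exp (-(n * m ^ 2 / (2 * s)) + 2 * B * n * |m| ^ 3 / s ^ 2) := by
  -- The bound is nonnegative, so the infeasible case, where the supremum of the empty set is `0`,
  -- is covered as well.
  refine Real.sSup_le ?_ (Real.exp_pos _).le
  rintro r ⟨p, hp, hsum, hmean, rfl⟩
  have hu : ∀ i ∈ Finset.range n, |m / s * (z i - θ)| ≤ |m| * B / s := by
    intro i hi
    rw [abs_mul, abs_div, abs_of_pos hs, div_mul_eq_mul_div]
    gcongr
    exact hB i hi
  have h1 := exp_sum_le_prod hsmall hu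
  have h2 := prod_mul_prod_le_one (l := m / s) hp hsum hmean (fun i hi => by
    have := neg_abs_le (m / s * (z i - θ))
    linarith [hu i hi])
  have h3 : 0 ≤ ∏ i ∈ Finset.range n, (n * p i) :=
    Finset.prod_nonneg fun i hi => mul_nonneg (Nat.cast_nonneg _) (hp i hi)
  have h4 := (mul_le_mul_of_nonneg_left h1 h3).trans h2
  rw [← Finset.mul_sum, hm] at h4
  simp_rw [mul_pow] at h4
  rw [← Finset.mul_sum, hs'] at h4
  rw [← le_div_iff₀ (Real.exp_pos _), one_div, ← Real.exp_neg] at h4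
  refine h4.trans (Real.exp_le_exp.2 (le_of_eq ?_))
  rw [show |m| ^ 3 = |m| * m ^ 2 by rw [← sq_abs m]; ring]
  field_simp
  ring

lemma prod_nat_mul_le_one {n : ℕ} {p : ℕ → ℝ} (hp : ∀ i ∈ Finset.range n, 0 ≤ p i)
    (hsum : ∑ i ∈ Finset.range n, p i = 1) : ∏ i ∈ Finset.range n, (n * p i) ≤ 1 := by
  simpa using prod_mul_prod_le_one (z := 0) (θ := 0) (l := 0) hp hsum (by simp) (by simp)

lemma le_elRatio {n : ℕ} {z p : ℕ → ℝ} {θ : ℝ} (hp : ∀ i ∈ Finset.range n, 0 ≤ p i)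
    (hsum : ∑ i ∈ Finset.range n, p i = 1) (hmean : ∑ i ∈ Finset.range n, p i * z i = θ) :
    ∏ i ∈ Finset.range n, (n * p i) ≤ elRatio z n θ := by
  refine le_csSup ⟨1, ?_⟩ ⟨p, hp, hsum, hmean, rfl⟩
  rintro r ⟨q, hq, hqsum, -, rfl⟩
  exact prod_nat_mul_le_one hq hqsum

/-- An explicit feasible point: uniform weights tilted linearly in the centred values. Here `s - m ^
2` is the empirical variance, and the slope `a = -m / (s - m ^ 2)` moves the weighted mean by
exactly `-m`, that is, onto `θ`. Centring keeps the total weight equal to one, and feasibility of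
`θ` comes as a by-product. -/
lemma exp_le_elRatio {n : ℕ} (hn : 0 < n) {z : ℕ → ℝ} {θ m s B : ℝ} (hs : 0 < s - m ^ 2)
    (hm : ∑ i ∈ Finset.range n, (z i - θ) = n * m)
    (hs' : ∑ i ∈ Finset.range n, (z i - θ) ^ 2 = n * s)
    (hB : ∀ i ∈ Finset.range n, |z i - θ - m| ≤ B) (hsmall : |m| * B / (s - m ^ 2) ≤ 1 / 2) :
    Real.exp (-(n * m ^ 2 / (2 * (s - m ^ 2))) - 2 * B * n * |m| ^ 3 / (s - m ^ 2) ^ 2)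
      ≤ elRatio z n θ := by
  have hn' : (0 : ℝ) < n := by exact_mod_cast hn
  set a := -(m / (s - m ^ 2)) with ha
  have hu : ∀ i ∈ Finset.range n, |a * (z i - θ - m)| ≤ |m| * B / (s - m ^ 2) := by
    intro i hi
    rw [abs_mul, ha, abs_neg, abs_div, abs_of_pos hs, div_mul_eq_mul_div]
    gcongr
    exact hB i hi
  have h1 := exp_sum_le_prod hsmall hu
  have hsum0 : ∑ i ∈ Finset.range n, (z i - θ - m) = 0 := by
    rw [Finset.sum_sub_distrib, hm]; simp
  have hsum2 : ∑ i ∈ Finset.range n, (z i - θ - m) ^ 2 = n * (s - m ^ 2) := by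
    have : ∀ i, (z i - θ - m) ^ 2 = (z i - θ) ^ 2 - 2 * m * (z i - θ) + m ^ 2 := fun i => by ring
    simp_rw [this]
    rw [Finset.sum_add_distrib, Finset.sum_sub_distrib, hs', ← Finset.mul_sum, hm]
    simp; ring
  have h2 : ∏ i ∈ Finset.range n, (n * ((1 + a * (z i - θ - m)) / n)) ≤ elRatio z n θ := by
    refine le_elRatio (fun i hi => ?_) ?_ ?_
    · have := neg_abs_le (a * (z i - θ - m))
      have := hu i hi
      apply div_nonneg _ hn'.le
      linarith
    · rw [← Finset.sum_div, Finset.sum_add_distrib, ← Finset.mul_sum, hsum0]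
      simp [hn'.ne']
    · have : ∀ i, (1 + a * (z i - θ - m)) / n * z i
          = ((z i - θ) + (1 + a * (z i - θ - m)) * θ + a * (z i - θ - m) ^ 2
            + a * m * (z i - θ - m)) / n := fun i => by ring
      simp_rw [this]
      rw [← Finset.sum_div, Finset.sum_add_distrib, Finset.sum_add_distrib, Finset.sum_add_distrib,
        hm, ← Finset.sum_mul, Finset.sum_add_distrib, ← Finset.mul_sum, ← Finset.mul_sum,
        ← Finset.mul_sum, hsum0, hsum2]
      simp only [Finset.sum_const, Finset.card_range, nsmul_eq_mul, ha]
      field_simp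
      ring
  have h3 : ∏ i ∈ Finset.range n, (n * ((1 + a * (z i - θ - m)) / n))
      = ∏ i ∈ Finset.range n, (1 + a * (z i - θ - m)) :=
    Finset.prod_congr rfl fun i _ => by field_simp
  rw [h3] at h2
  refine le_trans (Real.exp_le_exp.2 (le_of_eq ?_)) (h1.trans h2)
  simp_rw [mul_pow]
  rw [← Finset.mul_sum, ← Finset.mul_sum, hsum0, hsum2, ha,
    show |m| ^ 3 = |m| * m ^ 2 by rw [← sq_abs m]; ring]
  field_simp
  ring

/-- The Wilks expansion for bounded values: the likelihood ratio statistic is close to the squared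
standardized mean. -/
lemma exists_negTwoLog_elRatio_close {v₀ B M ε : ℝ} (hv₀ : 0 < v₀) (hB : 0 < B) (hM : 0 < M)
    (hε : 0 < ε) :
    ∃ η > 0, ∀ (n : ℕ) (z : ℕ → ℝ) (θ m s v : ℝ), 0 < n →
      ∑ i ∈ Finset.range n, (z i - θ) = n * m →
      ∑ i ∈ Finset.range n, (z i - θ) ^ 2 = n * s →
      (∀ i ∈ Finset.range n, |z i - θ| ≤ B) → v₀ ≤ v → n * m ^ 2 ≤ M → |m| ≤ η → |s - v| ≤ η →
      0 < elRatio z n θ ∧ |-2 * Real.log (elRatio z n θ) - n * m ^ 2 / v| ≤ ε := by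
  set C := 8 * M / v₀ ^ 2 + 128 * B * M / v₀ ^ 2 with hC
  have hCpos : 0 < C := by positivity
  -- The bounds `1` and `v₀ / 4` keep `s` and `s - m ^ 2` above `v₀ / 4`. The bound `v₀ / (16 * B)`
  -- makes the tilts at most `1/2`, even with `2 * B` in place of `B`, and `B` gives `|z i - θ - m|
  -- ≤ 2 * B`. The bound `ε / C` absorbs the errors: the two terms of `C` account for replacing `s`
  -- or `s - m ^ 2` by `v`, and for the cubic remainder.
  refine ⟨min (min 1 (v₀ / 4)) (min (v₀ / (16 * B)) (min B (ε / C))), by positivity, ?_⟩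
  intro n z θ m s v hn hm hs hzB hv hM' hmη hsη
  simp only [le_min_iff] at hmη hsη
  obtain ⟨⟨hm1, hm2⟩, hm3, hm4, hm5⟩ := hmη
  obtain ⟨⟨hs1, hs2⟩, hs3, hs4, hs5⟩ := hsη
  have hmsq : m ^ 2 ≤ |m| := by
    rw [← sq_abs]; nlinarith [abs_nonneg m]
  have hsv := abs_le.1 hs2
  have hs_low : v₀ / 4 ≤ s - m ^ 2 := by
    nlinarith
  have hs_pos : 0 < s - m ^ 2 := by linarith
  have hs_low' : v₀ / 4 ≤ s := by nlinarith [sq_nonneg m]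
  have hs_pos' : 0 < s := by linarith
  have hn' : (0 : ℝ) < n := by exact_mod_cast hn
  have hBm : |m| * B ≤ v₀ / 16 := by
    rw [le_div_iff₀ (by positivity)] at hm3
    linarith
  have hup := elRatio_le hs_pos' hm hs hzB (by
    rw [div_le_iff₀ hs_pos']; linarith)
  have hlow := exp_le_elRatio (B := 2 * B) hn hs_pos hm hs (fun i hi => by
      calc |z i - θ - m| ≤ |z i - θ| + |m| := abs_sub _ _
        _ ≤ 2 * B := by linarith [hzB i hi]) (by
      rw [div_le_iff₀ hs_pos]; linarith)
  have hR : 0 < elRatio z n θ := (Real.exp_pos _).trans_le hlow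
  refine ⟨hR, ?_⟩
  rw [← Real.log_le_iff_le_exp hR] at hup
  rw [← Real.le_log_iff_exp_le hR] at hlow
  have key : ∀ A : ℝ, v₀ / 4 ≤ A → |A - v| ≤ 2 * (ε / C) →
      |n * m ^ 2 / A - n * m ^ 2 / v| ≤ 8 * M / v₀ ^ 2 * (ε / C) := by
    intro A hA hAv
    have hApos : 0 < A := by linarith
    have hvpos : 0 < v := by linarith
    rw [show n * m ^ 2 / A - n * m ^ 2 / v = n * m ^ 2 * (v - A) / (A * v) by field_simp,
      abs_div, abs_mul, abs_of_nonneg (by positivity : 0 ≤ n * m ^ 2), abs_sub_comm,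
      abs_of_pos (by positivity : 0 < A * v)]
    calc n * m ^ 2 * |A - v| / (A * v) ≤ M * (2 * (ε / C)) / (v₀ / 4 * v₀) := by gcongr
      _ = 8 * M / v₀ ^ 2 * (ε / C) := by field_simp; ring
  have rem : ∀ A : ℝ, v₀ / 4 ≤ A →
      8 * B * n * |m| ^ 3 / A ^ 2 ≤ 128 * B * M / v₀ ^ 2 * (ε / C) := by
    intro A hA
    have hApos : 0 < A := by linarith
    calc 8 * B * n * |m| ^ 3 / A ^ 2 = 8 * B * (n * m ^ 2) * |m| / A ^ 2 := by
          rw [← sq_abs m]; ring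
      _ ≤ 8 * B * M * (ε / C) / (v₀ / 4) ^ 2 := by gcongr
      _ = 128 * B * M / v₀ ^ 2 * (ε / C) := by field_simp; ring
  have hεC : 8 * M / v₀ ^ 2 * (ε / C) + 128 * B * M / v₀ ^ 2 * (ε / C) = ε := by
    rw [← add_mul, ← hC]; field_simp
  have hεCpos : 0 < ε / C := by positivity
  have k1 := abs_le.1 (key s hs_low' (by linarith))
  have k2 := abs_le.1 (key (s - m ^ 2) hs_low (by
    calc |s - m ^ 2 - v| = |(s - v) - m ^ 2| := by ring_nf
      _ ≤ |s - v| + |m ^ 2| := abs_sub _ _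
      _ ≤ 2 * (ε / C) := by rw [abs_of_nonneg (sq_nonneg m)]; linarith))
  have r1 := rem s hs_low'
  have r2 := rem (s - m ^ 2) hs_low
  have e1 : n * m ^ 2 / (2 * s) = n * m ^ 2 / s / 2 := by field_simp
  have e2 : n * m ^ 2 / (2 * (s - m ^ 2)) = n * m ^ 2 / (s - m ^ 2) / 2 := by field_simp
  have e3 : 2 * B * n * |m| ^ 3 / s ^ 2 = 8 * B * n * |m| ^ 3 / s ^ 2 / 4 := by ring
  have e4 : 2 * (2 * B) * n * |m| ^ 3 / (s - m ^ 2) ^ 2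
      = 8 * B * n * |m| ^ 3 / (s - m ^ 2) ^ 2 / 2 := by ring
  have p1 : 0 ≤ 8 * B * n * |m| ^ 3 / s ^ 2 := by positivity
  rw [e1, e3] at hup
  rw [e2, e4] at hlow
  rw [abs_le]
  constructor <;> linarith

/-! ### Central limit theorem for bounded triangular arrays -/

/-- Factors are exchanged one at a time; all the others have norm at most one. -/
lemma norm_prod_sub_prod_le {ι : Type*} (s : Finset ι) (a b : ι → ℂ) (ha : ∀ i ∈ s, ‖a i‖ ≤ 1)
    (hb : ∀ i ∈ s, ‖b i‖ ≤ 1) : ‖∏ i ∈ s, a i - ∏ i ∈ s, b i‖ ≤ ∑ i ∈ s, ‖a i - b i‖ := by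
  classical
  induction s using Finset.induction_on with
  | empty => simp
  | insert i s hi ih =>
    rw [Finset.prod_insert hi, Finset.prod_insert hi, Finset.sum_insert hi]
    have ha' : ‖∏ j ∈ s, a j‖ ≤ 1 := by
      rw [norm_prod]
      exact Finset.prod_le_one (fun _ _ => norm_nonneg _)
        fun j hj => ha j (Finset.mem_insert_of_mem hj)
    have h1 := ih (fun j hj => ha j (Finset.mem_insert_of_mem hj))
      (fun j hj => hb j (Finset.mem_insert_of_mem hj))
    calc ‖a i * ∏ j ∈ s, a j - b i * ∏ j ∈ s, b j‖
        = ‖(a i - b i) * ∏ j ∈ s, a j + b i * (∏ j ∈ s, a j - ∏ j ∈ s, b j)‖ := by ring_nf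
      _ ≤ ‖a i - b i‖ * ‖∏ j ∈ s, a j‖ + ‖b i‖ * ‖∏ j ∈ s, a j - ∏ j ∈ s, b j‖ := by
          rw [← norm_mul, ← norm_mul]; exact norm_add_le _ _
      _ ≤ ‖a i - b i‖ * 1 + 1 * ∑ j ∈ s, ‖a j - b j‖ := by
          gcongr
          exact hb i (Finset.mem_insert_self _ _)
      _ = _ := by ring

lemma norm_exp_mul_I_sub_le {u : ℝ} (hu : |u| ≤ 1) :
    ‖Complex.exp (u * Complex.I) - (1 + u * Complex.I - (u : ℂ) ^ 2 / 2)‖ ≤ |u| ^ 3 := by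
  have h1 : ‖(u : ℂ) * Complex.I‖ ≤ 1 := by simpa using hu
  have h2 := Complex.exp_bound h1 (n := 3) (by norm_num)
  have h3 : ∑ m ∈ Finset.range 3, ((u : ℂ) * Complex.I) ^ m / (m.factorial : ℂ)
      = 1 + u * Complex.I - (u : ℂ) ^ 2 / 2 := by
    simp [Finset.sum_range_succ, mul_pow, Nat.factorial]
    ring
  rw [h3] at h2
  refine h2.trans ?_
  have : ‖(u : ℂ) * Complex.I‖ = |u| := by simp
  rw [this]
  norm_num [Nat.factorial]
  nlinarith [pow_nonneg (abs_nonneg u) 3]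

section CLT

variable {Ω : Type*} [MeasurableSpace Ω] {P : Measure Ω} [IsProbabilityMeasure P]

/-- Comparison of the characteristic function of a centred bounded variable with the Gaussian one
of the same variance. -/
lemma norm_charFun_sub_exp_le {Y : Ω → ℝ} (hY : Measurable Y) {c t : ℝ}
    (hc : ∀ ω, |Y ω| ≤ c) (htc : |t| * c ≤ 1) (h0 : ∫ ω, Y ω ∂P = 0) :
    ‖charFun (P.map Y) t - Complex.exp (-((t ^ 2 * ∫ ω, Y ω ^ 2 ∂P) / 2 : ℝ))‖
      ≤ (|t| ^ 3 * c + t ^ 4 * c ^ 2) * ∫ ω, Y ω ^ 2 ∂P := by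
  have hΩ : Nonempty Ω := nonempty_of_isProbabilityMeasure P
  have hc0 : 0 ≤ c := (abs_nonneg _).trans (hc (Classical.arbitrary Ω))
  set v := ∫ ω, Y ω ^ 2 ∂P with hv
  have hYi : Integrable Y P := Integrable.of_bound hY.aestronglyMeasurable c
    (ae_of_all _ fun ω => by simpa using hc ω)
  have hsq : ∀ ω, Y ω ^ 2 ≤ c ^ 2 := fun ω => by
    rw [← sq_abs]; exact pow_le_pow_left₀ (abs_nonneg _) (hc ω) 2
  have hY2 : Integrable (fun ω => Y ω ^ 2) P :=
    Integrable.of_bound (hY.pow_const 2).aestronglyMeasurable (c ^ 2)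
      (ae_of_all _ fun ω => by simpa using hsq ω)
  have hv0 : 0 ≤ v := integral_nonneg fun ω => sq_nonneg _
  have hvc : v ≤ c ^ 2 := by
    calc v ≤ ∫ _, c ^ 2 ∂P := integral_mono hY2 (integrable_const _) hsq
      _ = c ^ 2 := by simp
  have hint : Integrable (fun ω => Complex.exp (t * Y ω * Complex.I)) P := by
    refine Integrable.of_bound (by fun_prop) 1 (ae_of_all _ fun ω => ?_)
    rw [← Complex.ofReal_mul, Complex.norm_exp_ofReal_mul_I]
  have hpoly : Integrable
      (fun ω => 1 + (t * Y ω : ℝ) * Complex.I - ((t * Y ω : ℝ) : ℂ) ^ 2 / 2) P := by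
    refine Integrable.of_bound (by fun_prop) (1 + 1 + 1 / 2) (ae_of_all _ fun ω => ?_)
    have : |t * Y ω| ≤ 1 := by
      rw [abs_mul]; exact (mul_le_mul_of_nonneg_left (hc ω) (abs_nonneg t)).trans htc
    refine (norm_sub_le _ _).trans (add_le_add ((norm_add_le _ _).trans (add_le_add ?_ ?_)) ?_)
    · simp
    · simpa using this
    · rw [norm_div, norm_pow, Complex.norm_real, Real.norm_eq_abs]
      simp only [Complex.norm_ofNat]
      have := pow_le_one₀ (n := 2) (abs_nonneg (t * Y ω)) this
      linarith
  have hpolyint : ∫ ω, (1 + (t * Y ω : ℝ) * Complex.I - ((t * Y ω : ℝ) : ℂ) ^ 2 / 2) ∂P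
      = 1 - ((t ^ 2 * v / 2 : ℝ) : ℂ) := by
    have e : ∀ ω, (1 + (t * Y ω : ℝ) * Complex.I - ((t * Y ω : ℝ) : ℂ) ^ 2 / 2)
        = ((1 - t ^ 2 / 2 * Y ω ^ 2 : ℝ) : ℂ) + ((t * Y ω : ℝ) : ℂ) * Complex.I := fun ω => by
      push_cast; ring
    simp_rw [e]
    rw [integral_add, integral_mul_const, integral_complex_ofReal, integral_complex_ofReal,
      integral_sub (integrable_const _) (hY2.const_mul _), integral_const_mul, integral_const_mul,
      h0]
    · simp [← hv]; ring
    · exact ((integrable_const _).sub (hY2.const_mul _)).ofReal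
    · exact ((hYi.const_mul t).ofReal).mul_const _
  -- Both functions are compared with `1 - t² v / 2`. On this side the cubic Taylor remainder is
  -- integrated, using `|Y|³ ≤ c Y²`.
  have h1 : ‖charFun (P.map Y) t - (1 - ((t ^ 2 * v / 2 : ℝ) : ℂ))‖ ≤ |t| ^ 3 * c * v := by
    rw [charFun_apply_real, integral_map hY.aemeasurable (by fun_prop), ← hpolyint,
      ← integral_sub hint hpoly]
    refine (norm_integral_le_integral_norm _).trans ?_
    rw [hv, ← integral_const_mul]
    refine integral_mono (hint.sub hpoly).norm (hY2.const_mul _) fun ω => ?_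
    have : |t * Y ω| ≤ 1 := by
      rw [abs_mul]; exact (mul_le_mul_of_nonneg_left (hc ω) (abs_nonneg t)).trans htc
    have h2 := norm_exp_mul_I_sub_le this
    beta_reduce
    rw [← Complex.ofReal_mul]
    refine h2.trans ?_
    rw [abs_mul, mul_pow, pow_succ |Y ω| 2, sq_abs, mul_comm (Y ω ^ 2), ← mul_assoc]
    gcongr
    exact hc ω
  have htc2 : t ^ 2 * c ^ 2 ≤ 1 := by
    rw [← sq_abs t, ← mul_pow]; exact pow_le_one₀ (by positivity) htc
  have h2 : ‖Complex.exp (-((t ^ 2 * v) / 2 : ℝ)) - (1 - ((t ^ 2 * v / 2 : ℝ) : ℂ))‖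
      ≤ t ^ 4 * c ^ 2 * v := by
    have h3 : t ^ 2 * v ≤ 1 := (mul_le_mul_of_nonneg_left hvc (sq_nonneg t)).trans htc2
    have h3' : 0 ≤ t ^ 2 * v := by positivity
    have h4 := Real.abs_exp_sub_one_sub_id_le (x := -(t ^ 2 * v / 2)) (by
      rw [abs_neg, abs_of_nonneg (by positivity)]; linarith)
    rw [← Complex.ofReal_neg, ← Complex.ofReal_exp, ← Complex.ofReal_one, ← Complex.ofReal_sub,
      ← Complex.ofReal_sub, Complex.norm_real, Real.norm_eq_abs]
    rw [show Real.exp (-(t ^ 2 * v / 2)) - (1 - t ^ 2 * v / 2)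
      = Real.exp (-(t ^ 2 * v / 2)) - 1 - -(t ^ 2 * v / 2) by ring]
    refine h4.trans ?_
    have : t ^ 4 * v * v ≤ t ^ 4 * v * c ^ 2 := mul_le_mul_of_nonneg_left hvc (by positivity)
    have h6 : 0 ≤ t ^ 4 * v * v := by positivity
    nlinarith
  calc _ = ‖(charFun (P.map Y) t - (1 - ((t ^ 2 * v / 2 : ℝ) : ℂ)))
        - (Complex.exp (-((t ^ 2 * v) / 2 : ℝ)) - (1 - ((t ^ 2 * v / 2 : ℝ) : ℂ)))‖ := by
        congr 1; ring
    _ ≤ |t| ^ 3 * c * v + t ^ 4 * c ^ 2 * v := (norm_sub_le _ _).trans (add_le_add h1 h2)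
    _ = _ := by ring

/-- Central limit theorem for triangular arrays of uniformly vanishing bounded variables. -/
theorem tendstoInDistribution_sum_of_bounded {Y : ℕ → ℕ → Ω → ℝ} {c : ℕ → ℝ}
    (hY : ∀ n i, Measurable (Y n i)) (hindep : ∀ n, iIndepFun (Y n) P)
    (h0 : ∀ n i, ∫ ω, Y n i ω ∂P = 0)
    (hbound : ∀ᶠ n in atTop, ∀ i < n, ∀ ω, |Y n i ω| ≤ c n) (hc : Tendsto c atTop (nhds 0))
    (hvar : ∀ᶠ n in atTop, ∑ i ∈ Finset.range n, ∫ ω, Y n i ω ^ 2 ∂P = 1) :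
    TendstoInDistribution (fun n ω => ∑ i ∈ Finset.range n, Y n i ω) atTop (id : ℝ → ℝ)
      (fun _ => P) (gaussianReal 0 1) where
  forall_aemeasurable n := (Finset.measurable_fun_sum _ fun i _ => hY n i).aemeasurable
  tendsto := by
    refine ProbabilityMeasure.tendsto_iff_tendsto_charFun.2 fun t => ?_
    simp only [ProbabilityMeasure.coe_mk, Measure.map_id, charFun_gaussianReal]
    rw [tendsto_iff_norm_sub_tendsto_zero]
    have hlim : Tendsto (fun n => |t| ^ 3 * c n + t ^ 4 * c n ^ 2) atTop (nhds 0) := by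
      simpa using (hc.const_mul (|t| ^ 3)).add ((hc.pow 2).const_mul (t ^ 4))
    have htc : ∀ᶠ n in atTop, |t| * c n ≤ 1 := by
      have : Tendsto (fun n => |t| * c n) atTop (nhds 0) := by simpa using hc.const_mul |t|
      exact this.eventually (eventually_le_nhds one_pos)
    refine squeeze_zero' (Eventually.of_forall fun n => norm_nonneg _) ?_ hlim
    filter_upwards [hbound, hvar, htc] with n hb hv ht
    rw [((hindep n).restrict _).charFun_map_fun_finsetSum_eq_prod (fun i _ => (hY n _).aemeasurable)]
    -- As the variances add up to one, the Gaussian characteristic function splits into factors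
    -- matched with the summands.
    have hexp : Complex.exp (t * (0 : ℝ) * Complex.I - (1 : NNReal) * t ^ 2 / 2)
        = ∏ i ∈ Finset.range n, Complex.exp (-((t ^ 2 * ∫ ω, Y n i ω ^ 2 ∂P) / 2 : ℝ)) := by
      rw [← Complex.exp_sum]
      congr 1
      rw [Finset.sum_neg_distrib, ← Complex.ofReal_sum, ← Finset.sum_div, ← Finset.mul_sum, hv]
      simp
    rw [hexp, Finset.prod_apply]
    have hexp_norm : ∀ i, ‖Complex.exp (-((t ^ 2 * ∫ ω, Y n i ω ^ 2 ∂P) / 2 : ℝ))‖ ≤ 1 := fun i => by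
      rw [← Complex.ofReal_neg, ← Complex.ofReal_exp, Complex.norm_real, Real.norm_eq_abs,
        abs_of_pos (Real.exp_pos _), Real.exp_le_one_iff]
      have : 0 ≤ ∫ ω, Y n i ω ^ 2 ∂P := integral_nonneg fun ω => sq_nonneg _
      have : 0 ≤ t ^ 2 * ∫ ω, Y n i ω ^ 2 ∂P := by positivity
      linarith
    have hprob : ∀ i, IsProbabilityMeasure (P.map (Y n i)) := fun i =>
      Measure.isProbabilityMeasure_map (hY n i).aemeasurable
    refine (norm_prod_sub_prod_le _ _ _ (fun i _ => norm_charFun_le_one _)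
      fun i _ => hexp_norm i).trans ?_
    refine (Finset.sum_le_sum fun i hi =>
      norm_charFun_sub_exp_le (hY n i) (hb i (Finset.mem_range.1 hi)) ht (h0 n i)).trans ?_
    rw [← Finset.mul_sum, hv, mul_one]

end CLT

/-! ### Second moments of sums with few correlated pairs -/

lemma integrable_of_abs_le {α : Type*} [MeasurableSpace α] {μ : Measure α} [IsFiniteMeasure μ]
    {f : α → ℝ} (hf : Measurable f) {C : ℝ} (hC : ∀ a, |f a| ≤ C) : Integrable f μ :=
  Integrable.of_bound hf.aestronglyMeasurable C (ae_of_all _ hC)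

/-- Second moment bound for a sum in which most pairs of summands are orthogonal. -/
lemma integral_sum_sq_le {Ω : Type*} [MeasurableSpace Ω] {P : Measure Ω} [IsProbabilityMeasure P]
    {ι : Type*} (A : Finset ι) {U : ι → Ω → ℝ} {C : ℝ}
    (hU : ∀ a ∈ A, Measurable (U a)) (hC : ∀ a ∈ A, ∀ ω, |U a ω| ≤ C)
    (rel : ι → ι → Prop) [∀ a, DecidablePred (rel a)]
    (horth : ∀ a ∈ A, ∀ b ∈ A, ¬ rel a b → ∫ ω, U a ω * U b ω ∂P = 0) (N : ℕ)
    (hN : ∀ a ∈ A, (A.filter (rel a)).card ≤ N) :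
    ∫ ω, (∑ a ∈ A, U a ω) ^ 2 ∂P ≤ C ^ 2 * (A.card * N) := by
  have hprod : ∀ a ∈ A, ∀ b ∈ A, ∀ ω, |U a ω * U b ω| ≤ C ^ 2 := by
    intro a ha b hb ω
    rw [abs_mul, sq]
    exact mul_le_mul (hC a ha ω) (hC b hb ω) (abs_nonneg _) ((abs_nonneg _).trans (hC a ha ω))
  have hint : ∀ a ∈ A, ∀ b ∈ A, Integrable (fun ω => U a ω * U b ω) P := fun a ha b hb =>
    integrable_of_abs_le ((hU a ha).mul (hU b hb)) (hprod a ha b hb)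
  have h1 : ∫ ω, (∑ a ∈ A, U a ω) ^ 2 ∂P
      = ∑ a ∈ A, ∑ b ∈ A, ∫ ω, U a ω * U b ω ∂P := by
    simp_rw [sq, Finset.sum_mul_sum]
    rw [integral_finsetSum _ fun a ha => integrable_finsetSum _ fun b hb => hint a ha b hb]
    exact Finset.sum_congr rfl fun a ha => integral_finsetSum _ fun b hb => hint a ha b hb
  have h2 : ∀ a ∈ A, ∑ b ∈ A, ∫ ω, U a ω * U b ω ∂P ≤ C ^ 2 * N := by
    intro a ha
    calc ∑ b ∈ A, ∫ ω, U a ω * U b ω ∂P ≤ ∑ b ∈ A, if rel a b then C ^ 2 else 0 := by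
          refine Finset.sum_le_sum fun b hb => ?_
          split_ifs with h
          · calc ∫ ω, U a ω * U b ω ∂P ≤ ∫ _, C ^ 2 ∂P :=
                  integral_mono (hint a ha b hb) (integrable_const _)
                    fun ω => (le_abs_self _).trans (hprod a ha b hb ω)
              _ = C ^ 2 := by simp
          · exact (horth a ha b hb h).le
      _ = (A.filter (rel a)).card * C ^ 2 := by
          rw [← Finset.sum_filter, Finset.sum_const, nsmul_eq_mul]
      _ ≤ C ^ 2 * N := by
          rw [mul_comm]
          have : ((A.filter (rel a)).card : ℝ) ≤ N := by exact_mod_cast hN a ha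
          gcongr
  rw [h1]
  calc _ ≤ ∑ a ∈ A, C ^ 2 * N := Finset.sum_le_sum h2
    _ = _ := by rw [Finset.sum_const, nsmul_eq_mul]; ring

section Independent

variable {Ω : Type*} [MeasurableSpace Ω] {P : Measure Ω} [IsProbabilityMeasure P]

lemma integral_eq_integral_integral_of_indepFun {α β : Type*} [MeasurableSpace α]
    [MeasurableSpace β] {Z : Ω → α} {W : Ω → β} (hZ : Measurable Z) (hW : Measurable W)
    (hZW : IndepFun Z W P) {f : α × β → ℝ} (hf : Measurable f) {C : ℝ} (hC : ∀ p, |f p| ≤ C) :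
    ∫ ω, f (Z ω, W ω) ∂P = ∫ z, ∫ w, f (z, w) ∂(P.map W) ∂(P.map Z) := by
  have h1 := (indepFun_iff_map_prod_eq_prod_map_map hZ.aemeasurable hW.aemeasurable).1 hZW
  have : IsProbabilityMeasure (P.map Z) := Measure.isProbabilityMeasure_map hZ.aemeasurable
  have : IsProbabilityMeasure (P.map W) := Measure.isProbabilityMeasure_map hW.aemeasurable
  rw [← integral_map (φ := fun ω => (Z ω, W ω)) (hZ.prodMk hW).aemeasurable
    hf.aestronglyMeasurable, h1]
  exact integral_prod _ (integrable_of_abs_le hf hC)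

variable {F : Measure ℝ} {X : ℕ → Ω → ℝ}

lemma map_pair_eq (hX : ∀ i, Measurable (X i)) (hindep : iIndepFun X P)
    (hlaw : ∀ i, P.map (X i) = F) {b c : ℕ} (hbc : b ≠ c) :
    P.map (fun ω => (X b ω, X c ω)) = F.prod F := by
  rw [(indepFun_iff_map_prod_eq_prod_map_map (hX b).aemeasurable (hX c).aemeasurable).1
    (hindep.indepFun hbc), hlaw, hlaw]

/-- A function of three of the variables which integrates to zero in two of them is orthogonal to
functions of variables that avoid those two. -/
lemma integral_mul_eq_zero (hX : ∀ i, Measurable (X i)) (hindep : iIndepFun X P)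
    (hlaw : ∀ i, P.map (X i) = F) {f g : ℝ × ℝ × ℝ → ℝ} (hf : Measurable f) (hg : Measurable g)
    {C D : ℝ} (hC : ∀ p, |f p| ≤ C) (hD : ∀ p, |g p| ≤ D)
    (h0 : ∀ x, ∫ q, f (x, q) ∂(F.prod F) = 0) {a b c i j k : ℕ} (hbc : b ≠ c)
    (hb : b ∉ ({a, i, j, k} : Finset ℕ)) (hc : c ∉ ({a, i, j, k} : Finset ℕ)) :
    ∫ ω, f (X a ω, X b ω, X c ω) * g (X i ω, X j ω, X k ω) ∂P = 0 := by
  classical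
  set S : Finset ℕ := {a, i, j, k} with hS
  set T : Finset ℕ := {b, c} with hT
  have hST : Disjoint S T := by
    rw [Finset.disjoint_right]
    intro x hx
    rcases Finset.mem_insert.1 hx with rfl | hx
    · exact hb
    · rw [Finset.mem_singleton.1 hx]; exact hc
  have hbT : b ∈ T := by simp [hT]
  have hcT : c ∈ T := by simp [hT]
  have haS : a ∈ S := by simp [hS]
  have hiS : i ∈ S := by simp [hS]
  have hjS : j ∈ S := by simp [hS]
  have hkS : k ∈ S := by simp [hS]
  have hind := (hindep.indepFun_finset S T hST hX).comp (φ := id)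
    (ψ := fun z : T → ℝ => (z ⟨b, hbT⟩, z ⟨c, hcT⟩)) measurable_id (by fun_prop)
  have hZ : Measurable (fun ω (l : S) => X l ω) := measurable_pi_lambda _ fun l => hX l
  have hW : Measurable (fun ω => (X b ω, X c ω)) := (hX b).prodMk (hX c)
  -- Given the variables indexed by `S`, the factor `g` is constant and `f` integrates to zero over
  -- the law of the independent pair `(X b, X c)`. The index `a` may coincide with `i`, `j` or `k`.
  have key := integral_eq_integral_integral_of_indepFun (P := P) hZ hW hind
    (f := fun p : (S → ℝ) × ℝ × ℝ => f (p.1 ⟨a, haS⟩, p.2)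
      * g (p.1 ⟨i, hiS⟩, p.1 ⟨j, hjS⟩, p.1 ⟨k, hkS⟩)) (C := C * D) (by fun_prop) (by
      intro p
      rw [abs_mul]
      exact mul_le_mul (hC _) (hD _) (abs_nonneg _) ((abs_nonneg _).trans (hC 0)))
  refine key.trans ?_
  rw [map_pair_eq hX hindep hlaw hbc]
  simp_rw [integral_mul_const, h0]
  simp

/-- Second moment of a sum over pairs of a kernel which is degenerate given its first argument. -/
lemma integral_sum_pairs_sq_le (hX : ∀ i, Measurable (X i)) (hindep : iIndepFun X P)
    (hlaw : ∀ i, P.map (X i) = F) {f : ℝ × ℝ × ℝ → ℝ} (hf : Measurable f) {C : ℝ}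
    (hC : ∀ p, |f p| ≤ C) (h0 : ∀ x, ∫ q, f (x, q) ∂(F.prod F) = 0) {n c : ℕ}
    {A : Finset (ℕ × ℕ)} (hA : A ⊆ Finset.range n ×ˢ Finset.range n)
    (hne : ∀ q ∈ A, q.1 ≠ q.2 ∧ q.1 ≠ c ∧ q.2 ≠ c) :
    ∫ ω, (∑ q ∈ A, f (X c ω, X q.1 ω, X q.2 ω)) ^ 2 ∂P ≤ C ^ 2 * (4 * (n : ℝ) ^ 3) := by
  classical
  have h1 := integral_sum_sq_le (P := P) A (U := fun q ω => f (X c ω, X q.1 ω, X q.2 ω)) (C := C)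
    (fun q _ => by fun_prop) (fun q _ ω => hC _)
    (fun q q' => q'.1 ∈ ({q.1, q.2} : Finset ℕ) ∨ q'.2 ∈ ({q.1, q.2} : Finset ℕ))
    (by
      intro q hq q' hq' hrel
      have := hne q hq
      simp only [Finset.mem_insert, Finset.mem_singleton, not_or] at hrel
      refine integral_mul_eq_zero hX hindep hlaw hf hf hC hC h0 this.1 ?_ ?_
      · simp only [Finset.mem_insert, Finset.mem_singleton, not_or]
        exact ⟨this.2.1, this.2.1, fun h => hrel.1.1 h.symm, fun h => hrel.2.1 h.symm⟩
      · simp only [Finset.mem_insert, Finset.mem_singleton, not_or]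
        exact ⟨this.2.2, this.2.2, fun h => hrel.1.2 h.symm, fun h => hrel.2.2 h.symm⟩)
    -- Disjoint pairs are orthogonal. A pair meeting `q` has one of its two places filled from `q`,
    -- in at most two ways, and the other place free.
    (4 * n) (by
      intro q _
      have hsub : A.filter (fun q' => q'.1 ∈ ({q.1, q.2} : Finset ℕ)
            ∨ q'.2 ∈ ({q.1, q.2} : Finset ℕ))
          ⊆ (({q.1, q.2} : Finset ℕ) ×ˢ Finset.range n)
            ∪ (Finset.range n ×ˢ ({q.1, q.2} : Finset ℕ)) := by
        intro p hp
        rw [Finset.mem_filter] at hp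
        have := Finset.mem_product.1 (hA hp.1)
        rw [Finset.mem_union, Finset.mem_product, Finset.mem_product]
        tauto
      have h2 : ({q.1, q.2} : Finset ℕ).card ≤ 2 := Finset.card_le_two
      refine (Finset.card_le_card hsub).trans ((Finset.card_union_le _ _).trans ?_)
      rw [Finset.card_product, Finset.card_product, Finset.card_range]
      nlinarith)
  refine h1.trans ?_
  have hcard : (A.card : ℝ) ≤ (n : ℝ) * n := by
    have := Finset.card_le_card hA
    rw [Finset.card_product, Finset.card_range] at this
    exact_mod_cast this
  push_cast
  calc C ^ 2 * (A.card * (4 * n)) ≤ C ^ 2 * (n * n * (4 * n)) := by gcongr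
    _ = _ := by ring

/-- Second moment of a sum over triples of a completely degenerate kernel. -/
lemma integral_sum_triples_sq_le (hX : ∀ i, Measurable (X i)) (hindep : iIndepFun X P)
    (hlaw : ∀ i, P.map (X i) = F) {f : ℝ × ℝ × ℝ → ℝ} (hf : Measurable f) {C : ℝ}
    (hC : ∀ p, |f p| ≤ C) (h1 : ∀ x, ∫ q, f (x, q) ∂(F.prod F) = 0)
    (h2 : ∀ y, ∫ q, f (q.1, y, q.2) ∂(F.prod F) = 0)
    (h3 : ∀ z, ∫ q, f (q.1, q.2, z) ∂(F.prod F) = 0) {n : ℕ}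
    {A : Finset (ℕ × ℕ × ℕ)} (hA : A ⊆ Finset.range n ×ˢ Finset.range n ×ˢ Finset.range n)
    (hne : ∀ q ∈ A, q.1 ≠ q.2.1 ∧ q.1 ≠ q.2.2 ∧ q.2.1 ≠ q.2.2) :
    ∫ ω, (∑ q ∈ A, f (X q.1 ω, X q.2.1 ω, X q.2.2 ω)) ^ 2 ∂P ≤ C ^ 2 * (27 * (n : ℝ) ^ 4) := by
  classical
  let t : ℕ × ℕ × ℕ → Finset ℕ := fun q => {q.1, q.2.1, q.2.2}
  have ht : ∀ q, (t q).card ≤ 3 := fun q => Finset.card_le_three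
  have key := integral_sum_sq_le (P := P) A
    (U := fun q ω => f (X q.1 ω, X q.2.1 ω, X q.2.2 ω)) (C := C)
    (fun q _ => by fun_prop) (fun q _ ω => hC _)
    (fun q q' => (q'.1 ∈ t q ∧ q'.2.1 ∈ t q) ∨ (q'.1 ∈ t q ∧ q'.2.2 ∈ t q)
      ∨ (q'.2.1 ∈ t q ∧ q'.2.2 ∈ t q))
    (by
      rintro ⟨i, j, k⟩ hq ⟨i', j', k'⟩ hq' hrel
      obtain ⟨hij, hik, hjk⟩ := hne _ hq
      obtain ⟨hij', hik', hjk'⟩ := hne _ hq'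
      simp only [t, Finset.mem_insert, Finset.mem_singleton] at hij hik hjk hij' hik' hjk' hrel ⊢
      -- Triples sharing at most one index: some two indices of the first avoid the second, and
      -- degeneracy in those two arguments applies. Only integrals over two arguments are assumed to
      -- vanish, hence the order `n ^ 4` of the bound.
      have hcases : (j ∉ ({i, i', j', k'} : Finset ℕ) ∧ k ∉ ({i, i', j', k'} : Finset ℕ))
          ∨ (i ∉ ({j, i', j', k'} : Finset ℕ) ∧ k ∉ ({j, i', j', k'} : Finset ℕ))
          ∨ (i ∉ ({k, i', j', k'} : Finset ℕ) ∧ j ∉ ({k, i', j', k'} : Finset ℕ)) := by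
        simp only [Finset.mem_insert, Finset.mem_singleton]
        grind
      rcases hcases with ⟨ha, hb⟩ | ⟨ha, hb⟩ | ⟨ha, hb⟩
      · exact integral_mul_eq_zero hX hindep hlaw hf hf hC hC h1 hjk ha hb
      · exact integral_mul_eq_zero hX hindep hlaw (f := fun p => f (p.2.1, p.1, p.2.2))
          (by fun_prop) hf (fun p => hC _) hC h2 hik ha hb
      · exact integral_mul_eq_zero hX hindep hlaw (f := fun p => f (p.2.1, p.2.2, p.1))
          (by fun_prop) hf (fun p => hC _) hC h3 hij ha hb)
    (27 * n) (by
      intro q _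
      have hsub : A.filter (fun q' => (q'.1 ∈ t q ∧ q'.2.1 ∈ t q) ∨ (q'.1 ∈ t q ∧ q'.2.2 ∈ t q)
            ∨ (q'.2.1 ∈ t q ∧ q'.2.2 ∈ t q))
          ⊆ (t q ×ˢ t q ×ˢ Finset.range n)
            ∪ (t q ×ˢ Finset.range n ×ˢ t q) ∪ (Finset.range n ×ˢ t q ×ˢ t q) := by
        intro p hp
        rw [Finset.mem_filter] at hp
        have := hA hp.1
        simp only [Finset.mem_product, Finset.mem_union] at this ⊢
        tauto
      refine (Finset.card_le_card hsub).trans ((Finset.card_union_le _ _).trans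
        ((Nat.add_le_add_right (Finset.card_union_le _ _) _).trans ?_))
      simp only [Finset.card_product, Finset.card_range]
      have h9 : (t q).card * (t q).card ≤ 9 := Nat.mul_le_mul (ht q) (ht q)
      nlinarith)
  refine key.trans ?_
  have hcard : (A.card : ℝ) ≤ (n : ℝ) * (n * n) := by
    have := Finset.card_le_card hA
    rw [Finset.card_product, Finset.card_product, Finset.card_range] at this
    exact_mod_cast this
  push_cast
  calc C ^ 2 * (A.card * (27 * n)) ≤ C ^ 2 * (n * (n * n) * (27 * n)) := by gcongr
    _ = _ := by ring

/-- Second moment of a sum of centred functions of distinct variables. -/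
lemma integral_sum_centred_sq_le (hX : ∀ i, Measurable (X i)) (hindep : iIndepFun X P)
    {f : ℕ → ℝ → ℝ} (hf : ∀ i, Measurable (f i)) {C : ℝ} {n : ℕ}
    (hC : ∀ i < n, ∀ x, |f i x| ≤ C) (h0 : ∀ i, ∫ ω, f i (X i ω) ∂P = 0) :
    ∫ ω, (∑ i ∈ Finset.range n, f i (X i ω)) ^ 2 ∂P ≤ C ^ 2 * n := by
  have key := integral_sum_sq_le (P := P) (Finset.range n) (U := fun i ω => f i (X i ω)) (C := C)
    (fun i _ => (hf i).comp (hX i)) (fun i hi ω => hC i (Finset.mem_range.1 hi) _)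
    (fun i j => i = j) (by
      intro i _ j _ hij
      have h1 : IndepFun (fun ω => f i (X i ω)) (fun ω => f j (X j ω)) P :=
        (hindep.indepFun hij).comp (hf i) (hf j)
      rw [h1.integral_fun_mul_eq_mul_integral ((hf i).comp (hX i)).aestronglyMeasurable
        ((hf j).comp (hX j)).aestronglyMeasurable, h0, zero_mul]) 1 (by
      intro i _
      rw [Finset.card_le_one]
      intro a ha b hb
      rw [← (Finset.mem_filter.1 ha).2, ← (Finset.mem_filter.1 hb).2])
  simpa using key

end Independent

/-! ### Sums over ordered triples and the position of an index -/

/-- The sum of `κ i j k` over the triples `k < j < i` of elements of `S`. -/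
def tripleSum (κ : ℕ → ℕ → ℕ → ℝ) (S : Finset ℕ) : ℝ :=
  ∑ i ∈ S, ∑ j ∈ S, ∑ k ∈ S, if k < j ∧ j < i then κ i j k else 0

/-- The pairs `(j, k)` with `k < j < c`. -/
def pairsBelow (n c : ℕ) : Finset (ℕ × ℕ) :=
  (Finset.range n ×ˢ Finset.range n).filter fun q => q.2 < q.1 ∧ q.1 < c

/-- The pairs `(i, k)` with `k < c < i < n`. -/
def pairsAround (n c : ℕ) : Finset (ℕ × ℕ) :=
  (Finset.range n ×ˢ Finset.range n).filter fun q => q.2 < c ∧ c < q.1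

/-- The pairs `(i, j)` with `c < j < i < n`. -/
def pairsAbove (n c : ℕ) : Finset (ℕ × ℕ) :=
  (Finset.range n ×ˢ Finset.range n).filter fun q => c < q.2 ∧ q.2 < q.1

/-- The sum of `κ` over the triples through `c`. -/
def sumThrough (κ : ℕ → ℕ → ℕ → ℝ) (n c : ℕ) : ℝ :=
  ∑ q ∈ pairsBelow n c, κ c q.1 q.2 + ∑ q ∈ pairsAround n c, κ q.1 c q.2
    + ∑ q ∈ pairsAbove n c, κ q.1 q.2 c

lemma sum_pairsBelow (f : ℕ × ℕ → ℝ) (n c : ℕ) : ∑ q ∈ pairsBelow n c, f q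
    = ∑ j ∈ Finset.range n, ∑ k ∈ Finset.range n, if k < j ∧ j < c then f (j, k) else 0 := by
  rw [pairsBelow, Finset.sum_filter, Finset.sum_product]

lemma sum_pairsAround (f : ℕ × ℕ → ℝ) (n c : ℕ) : ∑ q ∈ pairsAround n c, f q
    = ∑ i ∈ Finset.range n, ∑ k ∈ Finset.range n, if k < c ∧ c < i then f (i, k) else 0 := by
  rw [pairsAround, Finset.sum_filter, Finset.sum_product]

lemma sum_pairsAbove (f : ℕ × ℕ → ℝ) (n c : ℕ) : ∑ q ∈ pairsAbove n c, f q
    = ∑ i ∈ Finset.range n, ∑ j ∈ Finset.range n, if c < j ∧ j < i then f (i, j) else 0 := by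
  rw [pairsAbove, Finset.sum_filter, Finset.sum_product]

lemma tripleSum_range_eq_below (κ : ℕ → ℕ → ℕ → ℝ) (n : ℕ) :
    tripleSum κ (Finset.range n) = ∑ c ∈ Finset.range n, ∑ q ∈ pairsBelow n c, κ c q.1 q.2 := by
  simp_rw [sum_pairsBelow]; rfl

lemma tripleSum_range_eq_around (κ : ℕ → ℕ → ℕ → ℝ) (n : ℕ) :
    tripleSum κ (Finset.range n) = ∑ c ∈ Finset.range n, ∑ q ∈ pairsAround n c, κ q.1 c q.2 := by
  simp_rw [sum_pairsAround]
  exact Finset.sum_comm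

lemma tripleSum_range_eq_above (κ : ℕ → ℕ → ℕ → ℝ) (n : ℕ) :
    tripleSum κ (Finset.range n) = ∑ c ∈ Finset.range n, ∑ q ∈ pairsAbove n c, κ q.1 q.2 c := by
  simp_rw [sum_pairsAbove]
  rw [Finset.sum_comm]
  refine Finset.sum_congr rfl fun i _ => ?_
  exact Finset.sum_comm

/-- Each triple passes through exactly three indices, one for each place. -/
lemma sum_sumThrough (κ : ℕ → ℕ → ℕ → ℝ) (n : ℕ) :
    ∑ c ∈ Finset.range n, sumThrough κ n c = 3 * tripleSum κ (Finset.range n) := by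
  simp only [sumThrough, Finset.sum_add_distrib]
  rw [← tripleSum_range_eq_below, ← tripleSum_range_eq_around, ← tripleSum_range_eq_above]
  ring

lemma tripleSum_eq_erase_add (κ : ℕ → ℕ → ℕ → ℝ) {n c : ℕ} (hc : c < n) :
    tripleSum κ (Finset.range n)
      = tripleSum κ ((Finset.range n).erase c) + sumThrough κ n c := by
  have hmem := Finset.mem_range.2 hc
  simp only [tripleSum, sumThrough, sum_pairsBelow, sum_pairsAround, sum_pairsAbove]
  simp_rw [Finset.sum_erase_eq_sub hmem, Finset.sum_sub_distrib]
  -- Removing `c` from the three ranges leaves inclusion-exclusion terms in which `c` fills two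
  -- places; these vanish as the inequalities are strict.
  have e1 : ∀ x : ℕ, (if c < x ∧ x < c then κ c x c else 0) = 0 := fun x => if_neg (by omega)
  have e2 : ∀ x : ℕ, (if x < c ∧ c < c then κ c c x else 0) = 0 := fun x => if_neg (by omega)
  have e3 : ∀ x : ℕ, (if c < c ∧ c < x then κ x c c else 0) = 0 := fun x => if_neg (by omega)
  simp only [e1, e2, e3, Finset.sum_const_zero]
  ring

lemma tripleSum_add (κ κ' : ℕ → ℕ → ℕ → ℝ) (S : Finset ℕ) :
    tripleSum (fun i j k => κ i j k + κ' i j k) S = tripleSum κ S + tripleSum κ' S := by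
  simp only [tripleSum, ← Finset.sum_add_distrib]
  refine Finset.sum_congr rfl fun i _ => Finset.sum_congr rfl fun j _ =>
    Finset.sum_congr rfl fun k _ => ?_
  split_ifs <;> simp

/-- Induction on the maximum: a new largest element can only be the first index, and it adds one
triple for each ordered pair below it, as in Pascal's rule. -/
lemma tripleSum_const (a : ℝ) (S : Finset ℕ) :
    tripleSum (fun _ _ _ => a) S = a * S.card.choose 3 := by
  have h2 : ∀ S : Finset ℕ, ∑ j ∈ S, ∑ k ∈ S, (if k < j then a else 0) = a * S.card.choose 2 := by
    intro S
    induction S using Finset.induction_on_max with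
    | empty => simp
    | insert m S hm ih =>
      have hmS : m ∉ S := fun h => (hm m h).false
      rw [Finset.sum_insert hmS, Finset.sum_insert hmS, Finset.card_insert_of_notMem hmS,
        Nat.choose_succ_succ' S.card 1]
      have e1 : ∑ k ∈ S, (if k < m then a else 0) = a * S.card := by
        rw [Finset.sum_congr rfl fun k hk => if_pos (hm k hk)]; simp [mul_comm]
      have e2 : ∑ j ∈ S, ∑ k ∈ insert m S, (if k < j then a else 0) = a * S.card.choose 2 := by
        rw [← ih]
        refine Finset.sum_congr rfl fun j hj => ?_
        rw [Finset.sum_insert hmS, if_neg (hm j hj).not_gt, zero_add]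
      rw [e1, e2]
      simp
      ring
  induction S using Finset.induction_on_max with
  | empty => simp [tripleSum]
  | insert m S hm ih =>
    have hmS : m ∉ S := fun h => (hm m h).false
    rw [tripleSum, Finset.sum_insert hmS, Finset.card_insert_of_notMem hmS,
      Nat.choose_succ_succ' S.card 2]
    have e0 : ∀ i j, i ∈ insert m S → j ∈ insert m S →
        ∑ k ∈ insert m S, (if k < j ∧ j < i then a else 0)
          = ∑ k ∈ S, (if k < j ∧ j < i then a else 0) := by
      intro i j hi hj
      rw [Finset.sum_insert hmS, if_neg, zero_add]
      rintro ⟨h1, h2⟩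
      rcases Finset.mem_insert.1 hi with rfl | hi
      · exact (h1.trans h2).false
      · exact ((h1.trans h2).trans (hm i hi)).false
    have e1 : ∑ j ∈ insert m S, ∑ k ∈ insert m S, (if k < j ∧ j < m then a else 0)
        = a * S.card.choose 2 := by
      rw [← h2 S, Finset.sum_congr rfl fun j hj => e0 m j (Finset.mem_insert_self _ _) hj,
        Finset.sum_insert hmS]
      simp only [lt_irrefl, and_false, if_false, Finset.sum_const_zero, zero_add]
      exact Finset.sum_congr rfl fun j hj => Finset.sum_congr rfl fun k _ => by simp [hm j hj]
    have e2 : ∑ i ∈ S, ∑ j ∈ insert m S, ∑ k ∈ insert m S, (if k < j ∧ j < i then a else 0)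
        = a * S.card.choose 3 := by
      rw [← ih, tripleSum]
      refine Finset.sum_congr rfl fun i hi => ?_
      rw [Finset.sum_congr rfl fun j hj => e0 i j (Finset.mem_insert_of_mem hi) hj,
        Finset.sum_insert hmS]
      simp [(hm i hi).not_gt]
    rw [e1, e2]
    push_cast
    ring

lemma cast_choose_three (n : ℕ) : ((n.choose 3 : ℕ) : ℝ) = n * (n - 1) * (n - 2) / 6 := by
  induction n with
  | zero => simp
  | succ n ih =>
    rw [Nat.choose_succ_succ' n 2]
    push_cast
    rw [ih, Nat.cast_choose_two]
    ring

/-! ### Pseudo-values as sums through an index -/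

/-- The array of values of the kernel, centred at `θ`. -/
def kernArray (θ : ℝ) (x : ℕ → ℝ) (i j k : ℕ) : ℝ := kern (x i) (x j) (x k) - θ

lemma deltaHat_eq (θ : ℝ) (x : ℕ → ℝ) {S : Finset ℕ} (hS : 3 ≤ S.card) :
    deltaHat x S = tripleSum (kernArray θ x) S / S.card.choose 3 + (θ - 1 / 2) := by
  have h1 : ∑ i ∈ S, ∑ j ∈ S with j < i, ∑ k ∈ S with k < j, kern (x i) (x j) (x k)
      = tripleSum (fun i j k => kern (x i) (x j) (x k)) S := by
    unfold tripleSum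
    refine Finset.sum_congr rfl fun i _ => ?_
    rw [Finset.sum_filter]
    refine Finset.sum_congr rfl fun j _ => ?_
    rw [Finset.sum_filter]
    split_ifs with h
    · simp [h]
    · simp [h]
  have h2 : tripleSum (fun i j k => kern (x i) (x j) (x k)) S
      = tripleSum (kernArray θ x) S + θ * S.card.choose 3 := by
    rw [← tripleSum_const θ S, ← tripleSum_add]
    simp [kernArray]
  have h3 : (S.card.choose 3 : ℝ) ≠ 0 := by
    exact_mod_cast (Nat.choose_pos hS).ne'
  rw [deltaHat, h1, h2]
  field_simp
  ring

/-- Deleting observation `c` removes exactly the triples through `c`. The coefficients are `(n-1) /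
C(n-1,3) = 6 / ((n-2)(n-3))` and the difference of this and `n / C(n,3)`. The condition `4 ≤ n`
keeps the reduced sample at three or more observations, so its binomial coefficient is nonzero. -/
lemma pseudoValue_sub_eq (θ : ℝ) (x : ℕ → ℝ) {n c : ℕ} (hn : 4 ≤ n) (hc : c < n) :
    pseudoValue x n c - (θ - 1 / 2)
      = 6 / ((n - 2) * (n - 3)) * sumThrough (kernArray θ x) n c
        - 2 * n / (n - 3) * (tripleSum (kernArray θ x) (Finset.range n) / n.choose 3) := by
  have hcard : ((Finset.range n).erase c).card = n - 1 := by
    rw [Finset.card_erase_of_mem (Finset.mem_range.2 hc), Finset.card_range]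
  have hn' : (4 : ℝ) ≤ n := by exact_mod_cast hn
  have h1 : ((n - 1 : ℕ) : ℝ) = n - 1 := by
    rw [Nat.cast_sub (by omega)]; simp
  rw [pseudoValue, deltaHat_eq θ x (by simp; omega), deltaHat_eq θ x (by rw [hcard]; omega), hcard,
    Finset.card_range, cast_choose_three, cast_choose_three, h1,
    show tripleSum (kernArray θ x) ((Finset.range n).erase c)
      = tripleSum (kernArray θ x) (Finset.range n) - sumThrough (kernArray θ x) n c by
      rw [tripleSum_eq_erase_add _ hc]; ring]
  have a1 : (n : ℝ) ≠ 0 := by linarith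
  have a2 : (n : ℝ) - 1 ≠ 0 := by linarith
  have a3 : (n : ℝ) - 2 ≠ 0 := by linarith
  have a4 : (n : ℝ) - 3 ≠ 0 := by linarith
  have a5 : (n : ℝ) - 1 - 1 ≠ 0 := by linarith
  have a6 : (n : ℝ) - 1 - 2 ≠ 0 := by linarith
  rw [show (n : ℝ) - 1 - 1 = n - 2 by ring, show (n : ℝ) - 1 - 2 = n - 3 by ring]
  field_simp
  ring

/-- Exact, without a bias term: summing over `c` counts each triple three times, and the
coefficients combine to `n / C(n,3)`. -/
lemma sum_pseudoValue_sub (θ : ℝ) (x : ℕ → ℝ) {n : ℕ} (hn : 4 ≤ n) :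
    ∑ c ∈ Finset.range n, (pseudoValue x n c - (θ - 1 / 2))
      = n * (tripleSum (kernArray θ x) (Finset.range n) / n.choose 3) := by
  rw [Finset.sum_congr rfl fun c hc => pseudoValue_sub_eq θ x hn (Finset.mem_range.1 hc),
    Finset.sum_sub_distrib, ← Finset.mul_sum, sum_sumThrough]
  have hn' : (4 : ℝ) ≤ n := by exact_mod_cast hn
  rw [cast_choose_three]
  simp only [Finset.sum_const, Finset.card_range, nsmul_eq_mul]
  have a1 : (n : ℝ) ≠ 0 := by linarith
  have a2 : (n : ℝ) - 1 ≠ 0 := by linarith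
  have a3 : (n : ℝ) - 2 ≠ 0 := by linarith
  have a4 : (n : ℝ) - 3 ≠ 0 := by linarith
  field_simp
  ring

lemma pairsBelow_subset (n c : ℕ) : pairsBelow n c ⊆ Finset.range n ×ˢ Finset.range n :=
  Finset.filter_subset _ _

lemma pairsAround_subset (n c : ℕ) : pairsAround n c ⊆ Finset.range n ×ˢ Finset.range n :=
  Finset.filter_subset _ _

lemma pairsAbove_subset (n c : ℕ) : pairsAbove n c ⊆ Finset.range n ×ˢ Finset.range n :=
  Finset.filter_subset _ _

lemma card_pairsBelow_le (n c : ℕ) : (pairsBelow n c).card ≤ c * c := by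
  have : pairsBelow n c ⊆ Finset.range c ×ˢ Finset.range c := by
    intro q hq
    simp only [pairsBelow, Finset.mem_filter, Finset.mem_product, Finset.mem_range] at hq ⊢
    omega
  simpa using Finset.card_le_card this

lemma card_pairsAround_le (n c : ℕ) : (pairsAround n c).card ≤ (n - c) * c := by
  have : pairsAround n c ⊆ Finset.Ico c n ×ˢ Finset.range c := by
    intro q hq
    simp only [pairsAround, Finset.mem_filter, Finset.mem_product, Finset.mem_range,
      Finset.mem_Ico] at hq ⊢
    omega
  simpa using Finset.card_le_card this

lemma card_pairsAbove_le (n c : ℕ) : (pairsAbove n c).card ≤ (n - c) * (n - c) := by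
  have : pairsAbove n c ⊆ Finset.Ico c n ×ˢ Finset.Ico c n := by
    intro q hq
    simp only [pairsAbove, Finset.mem_filter, Finset.mem_product, Finset.mem_range,
      Finset.mem_Ico] at hq ⊢
    omega
  simpa using Finset.card_le_card this

/-- The deletion identity for the constant kernel `1`, read through Pascal's rule. It makes the
three weights in `projThrough` a convex combination. -/
lemma card_pairs_add {n c : ℕ} (hc : c < n) :
    ((pairsBelow n c).card : ℝ) + (pairsAround n c).card + (pairsAbove n c).card
      = ((n - 1).choose 2 : ℕ) := by
  have h1 := tripleSum_eq_erase_add (fun _ _ _ => 1) hc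
  rw [tripleSum_const, tripleSum_const, Finset.card_range,
    Finset.card_erase_of_mem (Finset.mem_range.2 hc), Finset.card_range] at h1
  obtain ⟨m, rfl⟩ : ∃ m, n = m + 1 := ⟨n - 1, by omega⟩
  rw [Nat.choose_succ_succ' m 2] at h1
  simp only [sumThrough, Finset.sum_const, nsmul_eq_mul, mul_one, one_mul, Nat.cast_add,
    Nat.add_sub_cancel] at h1 ⊢
  linarith

lemma sumThrough_decomp (κ : ℕ → ℕ → ℕ → ℝ) (g₁ g₂ g₃ : ℕ → ℝ) (n c : ℕ) :
    sumThrough κ n c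
      = ((pairsBelow n c).card * g₁ c + (pairsAround n c).card * g₂ c
          + (pairsAbove n c).card * g₃ c)
        + (∑ q ∈ pairsBelow n c, (κ c q.1 q.2 - g₁ c)
          + ∑ q ∈ pairsAround n c, (κ q.1 c q.2 - g₂ c)
          + ∑ q ∈ pairsAbove n c, (κ q.1 q.2 c - g₃ c)) := by
  simp only [sumThrough, Finset.sum_sub_distrib, Finset.sum_const, nsmul_eq_mul]
  ring

lemma tripleSum_decomp (κ : ℕ → ℕ → ℕ → ℝ) (g₁ g₂ g₃ : ℕ → ℝ) (n : ℕ) :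
    tripleSum κ (Finset.range n)
      = ∑ c ∈ Finset.range n, ((pairsBelow n c).card * g₁ c + (pairsAround n c).card * g₂ c
          + (pairsAbove n c).card * g₃ c)
        + tripleSum (fun i j k => κ i j k - g₁ i - g₂ j - g₃ k) (Finset.range n) := by
  have h : tripleSum κ (Finset.range n) = tripleSum (fun i _ _ => g₁ i) (Finset.range n)
      + tripleSum (fun _ j _ => g₂ j) (Finset.range n)
      + tripleSum (fun _ _ k => g₃ k) (Finset.range n)
      + tripleSum (fun i j k => κ i j k - g₁ i - g₂ j - g₃ k) (Finset.range n) := by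
    rw [← tripleSum_add, ← tripleSum_add, ← tripleSum_add]
    congr 1
    funext i j k
    ring
  rw [h, tripleSum_range_eq_below (fun i _ _ => g₁ i), tripleSum_range_eq_around (fun _ j _ => g₂ j),
    tripleSum_range_eq_above (fun _ _ k => g₃ k)]
  simp only [Finset.sum_const, nsmul_eq_mul, Finset.sum_add_distrib]

/-- The triples `k < j < i < n`. -/
def triples (n : ℕ) : Finset (ℕ × ℕ × ℕ) :=
  (Finset.range n ×ˢ Finset.range n ×ˢ Finset.range n).filter
    fun q => q.2.2 < q.2.1 ∧ q.2.1 < q.1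

lemma tripleSum_eq_sum_triples (κ : ℕ → ℕ → ℕ → ℝ) (n : ℕ) :
    tripleSum κ (Finset.range n) = ∑ q ∈ triples n, κ q.1 q.2.1 q.2.2 := by
  rw [triples, Finset.sum_filter, Finset.sum_product, tripleSum]
  refine Finset.sum_congr rfl fun i _ => ?_
  rw [Finset.sum_product]

lemma abs_sum_le_card {ι : Type*} {A : Finset ι} {f : ι → ℝ} (hf : ∀ a ∈ A, |f a| ≤ 1) :
    |∑ a ∈ A, f a| ≤ A.card :=
  (Finset.abs_sum_le_sum_abs _ _).trans ((Finset.sum_le_sum hf).trans (by simp))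

lemma abs_kernArray_le {θ : ℝ} (hθ : 0 ≤ θ) (hθ' : θ ≤ 1) (x : ℕ → ℝ) (i j k : ℕ) :
    |kernArray θ x i j k| ≤ 1 := by
  rw [kernArray, kern, abs_le]
  split_ifs <;> constructor <;> linarith

/-- With kernel values in `[-1, 1]`, the two terms are at most `3(n-1)/(n-3)` and `2n/(n-3)`, and
their sum is at most `10` from `n = 6` on. This uniform bound supplies the `B` of the Wilks
expansion. -/
lemma abs_pseudoValue_sub_le {θ : ℝ} (hθ : 0 ≤ θ) (hθ' : θ ≤ 1) (x : ℕ → ℝ) {n c : ℕ}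
    (hn : 6 ≤ n) (hc : c < n) : |pseudoValue x n c - (θ - 1 / 2)| ≤ 10 := by
  have hn' : (6 : ℝ) ≤ n := by exact_mod_cast hn
  have h1 : |sumThrough (kernArray θ x) n c| ≤ (n - 1) * (n - 2) / 2 := by
    have : |sumThrough (kernArray θ x) n c| ≤ (pairsBelow n c).card + (pairsAround n c).card
        + (pairsAbove n c).card :=
      (abs_add_three _ _ _).trans (add_le_add (add_le_add
        (abs_sum_le_card fun q _ => abs_kernArray_le hθ hθ' x _ _ _)
        (abs_sum_le_card fun q _ => abs_kernArray_le hθ hθ' x _ _ _))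
        (abs_sum_le_card fun q _ => abs_kernArray_le hθ hθ' x _ _ _))
    rw [card_pairs_add hc, Nat.cast_choose_two, Nat.cast_sub (by omega)] at this
    refine this.trans (le_of_eq ?_)
    push_cast
    ring
  have h2 : |tripleSum (kernArray θ x) (Finset.range n) / n.choose 3| ≤ 1 := by
    have hpos : (0 : ℝ) < n.choose 3 := by exact_mod_cast Nat.choose_pos (by omega)
    rw [abs_div, abs_of_pos hpos, div_le_one hpos, tripleSum_eq_sum_triples]
    refine (abs_sum_le_card fun q _ => abs_kernArray_le hθ hθ' x _ _ _).trans (le_of_eq ?_)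
    have := tripleSum_const 1 (Finset.range n)
    rw [tripleSum_eq_sum_triples] at this
    simpa using this
  rw [pseudoValue_sub_eq θ x (by omega) hc]
  have p1 : (0 : ℝ) < (n - 2) * (n - 3) := by nlinarith
  have p2 : (0 : ℝ) < n - 3 := by linarith
  calc _ ≤ |6 / ((n - 2) * (n - 3)) * sumThrough (kernArray θ x) n c|
        + |2 * n / (n - 3) * (tripleSum (kernArray θ x) (Finset.range n) / n.choose 3)| :=
        abs_sub _ _
    _ ≤ 6 / ((n - 2) * (n - 3)) * ((n - 1) * (n - 2) / 2) + 2 * n / (n - 3) * 1 := by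
        rw [abs_mul, abs_mul, abs_of_nonneg (by positivity : (0 : ℝ) ≤ 6 / ((n - 2) * (n - 3))),
          abs_of_nonneg (by positivity : (0 : ℝ) ≤ 2 * n / (n - 3))]
        gcongr
    _ = (5 * n - 3) / (n - 3) := by
        have a3 : (n : ℝ) - 2 ≠ 0 := by linarith
        field_simp
        ring
    _ ≤ 10 := by
        rw [div_le_iff₀ p2]
        linarith

/-! ### Projections of the kernel -/

lemma measurable_kern : Measurable fun p : ℝ × ℝ × ℝ => kern p.1 p.2.1 p.2.2 := by
  unfold kern
  exact Measurable.ite (measurableSet_le (by fun_prop) (by fun_prop)) measurable_const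
    measurable_const

lemma measurable_kern_comp {α : Type*} [MeasurableSpace α] {a b c : α → ℝ} (ha : Measurable a)
    (hb : Measurable b) (hc : Measurable c) : Measurable fun t => kern (a t) (b t) (c t) :=
  measurable_kern.comp (ha.prodMk (hb.prodMk hc))

lemma kern_nonneg (a b c : ℝ) : 0 ≤ kern a b c := by
  unfold kern; split_ifs <;> norm_num

lemma kern_le_one (a b c : ℝ) : kern a b c ≤ 1 := by
  unfold kern; split_ifs <;> norm_num

lemma abs_kern_le_one (a b c : ℝ) : |kern a b c| ≤ 1 := by
  rw [abs_of_nonneg (kern_nonneg _ _ _)]; exact kern_le_one _ _ _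

lemma measurable_integral_snd {α β : Type*} [MeasurableSpace α] [MeasurableSpace β]
    {ν : Measure β} [SFinite ν] {f : α × β → ℝ} (hf : Measurable f) :
    Measurable fun a => ∫ b, f (a, b) ∂ν :=
  (hf.stronglyMeasurable.integral_prod_right').measurable

lemma abs_integral_le {α : Type*} [MeasurableSpace α] {μ : Measure α} [IsProbabilityMeasure μ]
    {f : α → ℝ} {C : ℝ} (hf : ∀ a, |f a| ≤ C) : |∫ a, f a ∂μ| ≤ C := by
  simpa using norm_integral_le_of_norm_le_const (μ := μ) (f := f) (ae_of_all _ hf)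

section Fubini

variable {F : Measure ℝ} [IsProbabilityMeasure F]

lemma integral_second {k : ℝ × ℝ × ℝ → ℝ} (hk : Measurable k) {C : ℝ} (hC : ∀ p, |k p| ≤ C) :
    ∫ y, ∫ q, k (q.1, y, q.2) ∂(F.prod F) ∂F = ∫ x, ∫ q, k (x, q) ∂(F.prod F) ∂F := by
  have h1 : ∀ y, ∫ q, k (q.1, y, q.2) ∂(F.prod F) = ∫ x, ∫ z, k (x, y, z) ∂F ∂F := fun y =>
    integral_prod _ (integrable_of_abs_le (by fun_prop) fun q => hC _)
  have h2 : ∀ x, ∫ q, k (x, q) ∂(F.prod F) = ∫ y, ∫ z, k (x, y, z) ∂F ∂F := fun x =>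
    integral_prod _ (integrable_of_abs_le (by fun_prop) fun q => hC _)
  simp_rw [h1, h2]
  refine integral_integral_swap (f := fun y x => ∫ z, k (x, y, z) ∂F) ?_
  refine integrable_of_abs_le (C := C) ?_ fun p => abs_integral_le fun z => hC _
  exact measurable_integral_snd (f := fun p : (ℝ × ℝ) × ℝ => k (p.1.2, p.1.1, p.2)) (by fun_prop)

lemma integral_third {k : ℝ × ℝ × ℝ → ℝ} (hk : Measurable k) {C : ℝ} (hC : ∀ p, |k p| ≤ C) :
    ∫ z, ∫ q, k (q.1, q.2, z) ∂(F.prod F) ∂F = ∫ x, ∫ q, k (x, q) ∂(F.prod F) ∂F := by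
  have h2 : ∀ x, ∫ q, k (x, q) ∂(F.prod F) = ∫ y, ∫ z, k (x, y, z) ∂F ∂F := fun x =>
    integral_prod _ (integrable_of_abs_le (by fun_prop) fun q => hC _)
  simp_rw [h2]
  rw [integral_integral_swap (f := fun z (q : ℝ × ℝ) => k (q.1, q.2, z))
    (integrable_of_abs_le (C := C) (by fun_prop) fun p => hC _)]
  refine integral_prod _ (integrable_of_abs_le (C := C) ?_ fun q => abs_integral_le fun z => hC _)
  exact measurable_integral_snd (f := fun p : (ℝ × ℝ) × ℝ => k (p.1.1, p.1.2, p.2)) (by fun_prop)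

end Fubini

/-- The mean of the kernel under independent arguments with law `F`. -/
def kernMean (F : Measure ℝ) : ℝ := ∫ x, ∫ q, kern x q.1 q.2 ∂(F.prod F) ∂F

/-- The centred projection of the kernel on its first argument. -/
def proj₁ (F : Measure ℝ) (x : ℝ) : ℝ := ∫ q, kern x q.1 q.2 ∂(F.prod F) - kernMean F

/-- The centred projection of the kernel on its second argument. -/
def proj₂ (F : Measure ℝ) (y : ℝ) : ℝ := ∫ q, kern q.1 y q.2 ∂(F.prod F) - kernMean F

/-- The centred projection of the kernel on its third argument. -/
def proj₃ (F : Measure ℝ) (z : ℝ) : ℝ := ∫ q, kern q.1 q.2 z ∂(F.prod F) - kernMean F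

/-- The completely degenerate part of the kernel. -/
def kernRem (F : Measure ℝ) (p : ℝ × ℝ × ℝ) : ℝ :=
  kern p.1 p.2.1 p.2.2 - kernMean F - proj₁ F p.1 - proj₂ F p.2.1 - proj₃ F p.2.2

section Projections

variable (F : Measure ℝ) [IsProbabilityMeasure F]

lemma integral_mem_Icc {α : Type*} [MeasurableSpace α] {μ : Measure α} [IsProbabilityMeasure μ]
    {f : α → ℝ} (h0 : ∀ a, 0 ≤ f a) (h1 : ∀ a, f a ≤ 1) :
    0 ≤ ∫ a, f a ∂μ ∧ ∫ a, f a ∂μ ≤ 1 := by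
  refine ⟨integral_nonneg h0, ?_⟩
  have := abs_integral_le (μ := μ) (f := f) (C := 1) fun a => by
    rw [abs_of_nonneg (h0 a)]; exact h1 a
  exact (le_abs_self _).trans this

lemma measurable_integral_kern₁ : Measurable fun x => ∫ q, kern x q.1 q.2 ∂(F.prod F) :=
  measurable_integral_snd (f := fun p : ℝ × ℝ × ℝ => kern p.1 p.2.1 p.2.2) measurable_kern

lemma measurable_integral_kern₂ : Measurable fun y => ∫ q, kern q.1 y q.2 ∂(F.prod F) :=
  measurable_integral_snd (f := fun p : ℝ × ℝ × ℝ => kern p.2.1 p.1 p.2.2)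
    (measurable_kern_comp (by fun_prop) (by fun_prop) (by fun_prop))

lemma measurable_integral_kern₃ : Measurable fun z => ∫ q, kern q.1 q.2 z ∂(F.prod F) :=
  measurable_integral_snd (f := fun p : ℝ × ℝ × ℝ => kern p.2.1 p.2.2 p.1)
    (measurable_kern_comp (by fun_prop) (by fun_prop) (by fun_prop))

lemma integral_kern₁_mem (x : ℝ) : 0 ≤ ∫ q, kern x q.1 q.2 ∂(F.prod F)
    ∧ ∫ q, kern x q.1 q.2 ∂(F.prod F) ≤ 1 :=
  integral_mem_Icc (fun _ => kern_nonneg _ _ _) (fun _ => kern_le_one _ _ _)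

lemma integral_kern₂_mem (y : ℝ) : 0 ≤ ∫ q, kern q.1 y q.2 ∂(F.prod F)
    ∧ ∫ q, kern q.1 y q.2 ∂(F.prod F) ≤ 1 :=
  integral_mem_Icc (fun _ => kern_nonneg _ _ _) (fun _ => kern_le_one _ _ _)

lemma integral_kern₃_mem (z : ℝ) : 0 ≤ ∫ q, kern q.1 q.2 z ∂(F.prod F)
    ∧ ∫ q, kern q.1 q.2 z ∂(F.prod F) ≤ 1 :=
  integral_mem_Icc (fun _ => kern_nonneg _ _ _) (fun _ => kern_le_one _ _ _)

lemma kernMean_mem : 0 ≤ kernMean F ∧ kernMean F ≤ 1 :=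
  integral_mem_Icc (fun x => (integral_kern₁_mem F x).1)
    (fun x => (integral_kern₁_mem F x).2)

lemma measurable_proj₁ : Measurable (proj₁ F) := (measurable_integral_kern₁ F).sub_const _

lemma measurable_proj₂ : Measurable (proj₂ F) := (measurable_integral_kern₂ F).sub_const _

lemma measurable_proj₃ : Measurable (proj₃ F) := (measurable_integral_kern₃ F).sub_const _

lemma abs_proj₁_le (x : ℝ) : |proj₁ F x| ≤ 1 := by
  have h1 := integral_kern₁_mem F x
  have h2 := kernMean_mem F
  rw [proj₁, abs_le]
  constructor <;> linarith

lemma abs_proj₂_le (x : ℝ) : |proj₂ F x| ≤ 1 := by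
  have h1 := integral_kern₂_mem F x
  have h2 := kernMean_mem F
  rw [proj₂, abs_le]
  constructor <;> linarith

lemma abs_proj₃_le (x : ℝ) : |proj₃ F x| ≤ 1 := by
  have h1 := integral_kern₃_mem F x
  have h2 := kernMean_mem F
  rw [proj₃, abs_le]
  constructor <;> linarith

lemma integral_proj₁ : ∫ x, proj₁ F x ∂F = 0 := by
  unfold proj₁
  rw [integral_sub (integrable_of_abs_le (C := 1) (measurable_integral_kern₁ F)
    fun x => abs_integral_le fun q => abs_kern_le_one _ _ _) (integrable_const _)]
  simp [kernMean]

lemma integral_proj₂ : ∫ x, proj₂ F x ∂F = 0 := by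
  unfold proj₂
  rw [integral_sub (integrable_of_abs_le (C := 1) (measurable_integral_kern₂ F)
    fun x => abs_integral_le fun q => abs_kern_le_one _ _ _) (integrable_const _),
    integral_second (k := fun p => kern p.1 p.2.1 p.2.2) measurable_kern
      fun p => abs_kern_le_one _ _ _]
  simp [kernMean]

lemma integral_proj₃ : ∫ x, proj₃ F x ∂F = 0 := by
  unfold proj₃
  rw [integral_sub (integrable_of_abs_le (C := 1) (measurable_integral_kern₃ F)
    fun x => abs_integral_le fun q => abs_kern_le_one _ _ _) (integrable_const _),
    integral_third (k := fun p => kern p.1 p.2.1 p.2.2) measurable_kern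
      fun p => abs_kern_le_one _ _ _]
  simp [kernMean]

lemma integral_comp_fst_eq_zero {f : ℝ → ℝ} (h : ∫ x, f x ∂F = 0) :
    ∫ q : ℝ × ℝ, f q.1 ∂(F.prod F) = 0 := by
  rw [integral_fun_fst (f := f)]; simp [h]

lemma integral_comp_snd_eq_zero {f : ℝ → ℝ} (h : ∫ x, f x ∂F = 0) :
    ∫ q : ℝ × ℝ, f q.2 ∂(F.prod F) = 0 := by
  rw [integral_fun_snd (f := f)]; simp [h]

/-- The computation common to the three degeneracy statements for `kernRem`: `a` is the overall
mean, `b` the projection on the frozen argument, and `f`, `g` the centred projections on the two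
integrated ones. -/
lemma integral_rem {u : ℝ × ℝ → ℝ} {f g : ℝ → ℝ} {a b : ℝ} (hu : Integrable u (F.prod F))
    (hf : Measurable f) (hg : Measurable g) (hf1 : ∀ x, |f x| ≤ 1) (hg1 : ∀ x, |g x| ≤ 1)
    (hf0 : ∫ x, f x ∂F = 0) (hg0 : ∫ x, g x ∂F = 0) (hb : b = ∫ q, u q ∂(F.prod F) - a) :
    ∫ q, (u q - a - b - f q.1 - g q.2) ∂(F.prod F) = 0 := by
  have hfi : Integrable (fun q : ℝ × ℝ => f q.1) (F.prod F) :=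
    integrable_of_abs_le (by fun_prop) fun q => hf1 _
  have hgi : Integrable (fun q : ℝ × ℝ => g q.2) (F.prod F) :=
    integrable_of_abs_le (by fun_prop) fun q => hg1 _
  have i1 : Integrable (fun q => u q - a) (F.prod F) := hu.sub (integrable_const _)
  have i2 : Integrable (fun q => u q - a - b) (F.prod F) := i1.sub (integrable_const _)
  have i3 : Integrable (fun q => u q - a - b - f q.1) (F.prod F) := i2.sub hfi
  rw [integral_sub i3 hgi, integral_sub i2 hfi, integral_sub i1 (integrable_const _),
    integral_sub hu (integrable_const _), integral_comp_fst_eq_zero F hf0,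
    integral_comp_snd_eq_zero F hg0, hb]
  simp

lemma integrable_kern {a b c : ℝ × ℝ → ℝ} (ha : Measurable a) (hb : Measurable b)
    (hc : Measurable c) : Integrable (fun q => kern (a q) (b q) (c q)) (F.prod F) :=
  integrable_of_abs_le (measurable_kern_comp ha hb hc) fun _ => abs_kern_le_one _ _ _

lemma integral_kernRem₁ (x : ℝ) : ∫ q, kernRem F (x, q) ∂(F.prod F) = 0 :=
  integral_rem F (integrable_kern F measurable_const measurable_fst measurable_snd)
    (measurable_proj₂ F) (measurable_proj₃ F) (abs_proj₂_le F) (abs_proj₃_le F)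
    (integral_proj₂ F) (integral_proj₃ F) rfl

lemma integral_kernRem₂ (y : ℝ) : ∫ q, kernRem F (q.1, y, q.2) ∂(F.prod F) = 0 := by
  rw [← integral_rem F (a := kernMean F)
    (integrable_kern F measurable_fst (measurable_const (a := y)) measurable_snd)
    (measurable_proj₁ F) (measurable_proj₃ F) (abs_proj₁_le F) (abs_proj₃_le F)
    (integral_proj₁ F) (integral_proj₃ F) rfl]
  refine integral_congr_ae (ae_of_all _ fun q => ?_)
  simp only [kernRem, proj₂]
  ring

lemma integral_kernRem₃ (z : ℝ) : ∫ q, kernRem F (q.1, q.2, z) ∂(F.prod F) = 0 := by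
  rw [← integral_rem F (a := kernMean F)
    (integrable_kern F measurable_fst measurable_snd (measurable_const (a := z)))
    (measurable_proj₁ F) (measurable_proj₂ F) (abs_proj₁_le F) (abs_proj₂_le F)
    (integral_proj₁ F) (integral_proj₂ F) rfl]
  refine integral_congr_ae (ae_of_all _ fun q => ?_)
  simp only [kernRem, proj₃]
  ring

lemma measurable_kernRem : Measurable (kernRem F) := by
  have h1 := measurable_proj₁ F
  have h2 := measurable_proj₂ F
  have h3 := measurable_proj₃ F
  have := measurable_kern
  unfold kernRem
  fun_prop

lemma abs_kernRem_le (p : ℝ × ℝ × ℝ) : |kernRem F p| ≤ 4 := by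
  have h1 := abs_le.1 (abs_proj₁_le F p.1)
  have h2 := abs_le.1 (abs_proj₂_le F p.2.1)
  have h3 := abs_le.1 (abs_proj₃_le F p.2.2)
  have h4 := kernMean_mem F
  have h5 := kern_nonneg p.1 p.2.1 p.2.2
  have h6 := kern_le_one p.1 p.2.1 p.2.2
  rw [kernRem, abs_le]
  constructor <;> linarith

end Projections

/-! ### The departure and the null hypothesis -/

section Departure

/-- For independent `X`, `Y` with law `F`, exchangeability gives `P(X < Y) = P(Y < X)`, and ties
have probability zero. -/
lemma integral_measureReal_Iio (F : Measure ℝ) [IsProbabilityMeasure F] [NullSingletonClass F] :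
    ∫ t, F.real (Set.Iio t) ∂F = 1 / 2 := by
  have hm : MeasurableSet {q : ℝ × ℝ | q.2 < q.1} := measurableSet_lt measurable_snd measurable_fst
  have hm' : MeasurableSet {q : ℝ × ℝ | q.1 < q.2} := measurableSet_lt measurable_fst measurable_snd
  have h1 : ∫ t, F.real (Set.Iio t) ∂F = (F.prod F).real {q : ℝ × ℝ | q.2 < q.1} := by
    rw [measureReal_def, Measure.prod_apply hm, integral_eq_lintegral_of_nonneg_ae
      (ae_of_all _ fun t => measureReal_nonneg)]
    · congr 1
      refine lintegral_congr fun t => ?_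
      rw [ofReal_measureReal]
      rfl
    · have := measurable_measure_prodMk_left (ν := F) hm
      exact (ENNReal.measurable_toReal.comp this).aestronglyMeasurable
  have h2 : (F.prod F).real {q : ℝ × ℝ | q.1 < q.2} = (F.prod F).real {q : ℝ × ℝ | q.2 < q.1} := by
    conv_rhs => rw [← Measure.prod_swap, measureReal_def, Measure.map_apply measurable_swap hm]
    rfl
  have h3 : (F.prod F).real {q : ℝ × ℝ | q.1 = q.2} = 0 := by
    rw [measureReal_def, Measure.prod_apply (measurableSet_eq_fun measurable_fst measurable_snd)]
    simp
  have h4 : (F.prod F).real {q : ℝ × ℝ | q.2 < q.1}ᶜ = 1 - (F.prod F).real {q : ℝ × ℝ | q.2 < q.1} :=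
    probReal_compl_eq_one_sub hm
  have h5 : {q : ℝ × ℝ | q.2 < q.1}ᶜ = {q : ℝ × ℝ | q.1 < q.2} ∪ {q : ℝ × ℝ | q.1 = q.2} := by
    ext q; simp [le_iff_lt_or_eq]
  have h6 : (F.prod F).real {q : ℝ × ℝ | q.2 < q.1}ᶜ = (F.prod F).real {q : ℝ × ℝ | q.1 < q.2} := by
    rw [h5, measureReal_union, h3, add_zero]
    · rw [Set.disjoint_left]; intro q hq hq'; exact (ne_of_lt hq) hq'
    · exact measurableSet_eq_fun measurable_fst measurable_snd
  rw [h1]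
  linarith

lemma measureReal_eq_integral_kern (F : Measure ℝ) [IsProbabilityMeasure F] (t : ℝ) :
    (F.prod F).real {q : ℝ × ℝ | (q.1 * q.2 - 1) / (2 * q.2) ≤ t}
      = ∫ q, kern q.1 q.2 t ∂(F.prod F) := by
  have hm : MeasurableSet {q : ℝ × ℝ | (q.1 * q.2 - 1) / (2 * q.2) ≤ t} :=
    measurableSet_le (by fun_prop) measurable_const
  rw [← integral_indicator_one hm]
  rfl

theorem departure_eq (F : Measure ℝ) [IsProbabilityMeasure F] [NullSingletonClass F] :
    departure F = kernMean F - 1 / 2 := by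
  unfold departure
  rw [integral_sub, integral_measureReal_Iio]
  · simp_rw [measureReal_eq_integral_kern]
    rw [integral_third (k := fun p => kern p.1 p.2.1 p.2.2) measurable_kern
      fun p => abs_kern_le_one _ _ _]
    rfl
  · simp_rw [measureReal_eq_integral_kern]
    exact integrable_of_abs_le (C := 1) (measurable_integral_kern₃ F)
      fun x => abs_integral_le fun q => abs_kern_le_one _ _ _
  · have hm : MeasurableSet {q : ℝ × ℝ | q.2 < q.1} :=
      measurableSet_lt measurable_snd measurable_fst
    refine integrable_of_abs_le (C := 1) (ENNReal.measurable_toReal.comp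
      (measurable_measure_prodMk_left (ν := F) hm)) fun t => ?_
    rw [abs_of_nonneg measureReal_nonneg]
    exact measureReal_le_one

/-- The mean of the kernel is `1 / 2` for a symmetric law without atoms. -/
theorem kernMean_eq_half (F : Measure ℝ) [IsProbabilityMeasure F] [NullSingletonClass F]
    (hF : F.map (fun x => -x) = F) : kernMean F = 1 / 2 := by
  have hneg : MeasurePreserving (fun x : ℝ => -x) F F := ⟨measurable_neg, hF⟩
  have hneg2 : MeasurePreserving (fun q : ℝ × ℝ => (-q.1, -q.2)) (F.prod F) (F.prod F) :=
    hneg.prod hneg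
  have h1 : kernMean F = ∫ q, ∫ z, kern q.1 q.2 z ∂F ∂(F.prod F) := by
    rw [kernMean, ← integral_third (k := fun p => kern p.1 p.2.1 p.2.2) measurable_kern
      fun p => abs_kern_le_one _ _ _]
    exact integral_integral_swap (f := fun z (q : ℝ × ℝ) => kern q.1 q.2 z)
      (integrable_of_abs_le (C := 1) (measurable_kern_comp (by fun_prop) (by fun_prop)
        (by fun_prop)) fun p => abs_kern_le_one _ _ _)
  -- Changing the signs of both arguments changes the sign of the quotient, also when `q.2 = 0` and
  -- the quotient is `0` by convention. Reflecting `z` too reverses the inequality, so the two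
  -- indicators add up to one except for the single value where equality holds, a null event.
  have hk : ∀ q : ℝ × ℝ, ∫ z, kern q.1 q.2 z ∂F + ∫ z, kern (-q.1) (-q.2) z ∂F = 1 := by
    intro q
    have e1 : ∫ z, kern (-q.1) (-q.2) z ∂F = ∫ z, kern (-q.1) (-q.2) (-z) ∂F :=
      (hneg.integral_comp' (f := MeasurableEquiv.neg ℝ) _).symm
    have i1 : Integrable (fun z => kern q.1 q.2 z) F := integrable_of_abs_le
      (measurable_kern_comp measurable_const measurable_const measurable_id)
      fun _ => abs_kern_le_one _ _ _
    have i2 : Integrable (fun z => kern (-q.1) (-q.2) (-z)) F := integrable_of_abs_le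
      (measurable_kern_comp measurable_const measurable_const measurable_neg)
      fun _ => abs_kern_le_one _ _ _
    rw [e1, ← integral_add i1 i2]
    have hne : ∀ᵐ z ∂F, z ≠ (q.1 * q.2 - 1) / (2 * q.2) := by
      rw [ae_iff]; simp
    rw [integral_congr_ae (g := fun _ => (1 : ℝ))]
    · simp
    · filter_upwards [hne] with z hz
      have e2 : (-q.1 * -q.2 - 1) / (2 * -q.2) = -((q.1 * q.2 - 1) / (2 * q.2)) := by
        rw [neg_mul_neg, mul_neg, div_neg]
      simp only [kern, e2, neg_le_neg_iff]
      rcases lt_or_gt_of_ne hz with h | h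
      · rw [if_neg h.not_ge, if_pos h.le, zero_add]
      · rw [if_pos h.le, if_neg h.not_ge, add_zero]
  have hmeas : Measurable fun q : ℝ × ℝ => ∫ z, kern q.1 q.2 z ∂F :=
    measurable_integral_snd (f := fun p : (ℝ × ℝ) × ℝ => kern p.1.1 p.1.2 p.2)
      (measurable_kern_comp (by fun_prop) (by fun_prop) (by fun_prop))
  have h2 : ∫ q : ℝ × ℝ, ∫ z, kern (-q.1) (-q.2) z ∂F ∂(F.prod F) = kernMean F := by
    rw [h1]
    conv_rhs => rw [← hneg2.map_eq, integral_map hneg2.measurable.aemeasurable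
      hmeas.aestronglyMeasurable]
  have h3 : kernMean F + kernMean F = 1 := by
    nth_rw 1 [h1]
    rw [← h2, ← integral_add]
    · simp [hk]
    · exact integrable_of_abs_le (C := 1) hmeas fun q => abs_integral_le fun z => abs_kern_le_one _ _ _
    · exact integrable_of_abs_le (C := 1) (hmeas.comp hneg2.measurable)
        fun q => abs_integral_le fun z => abs_kern_le_one _ _ _
  linarith

lemma cauchyMeasure_map_neg : (cauchyMeasure 0 1).map (fun x => -x) = cauchyMeasure 0 1 := by
  rw [cauchyMeasure_of_scale_ne_zero 0 one_ne_zero]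
  ext s hs
  rw [Measure.map_apply measurable_neg hs, withDensity_apply _ (measurable_neg hs),
    withDensity_apply _ hs]
  have h := (Measure.measurePreserving_neg (volume : Measure ℝ)).setLIntegral_comp_preimage hs
    (measurable_cauchyPDF 0 1)
  rw [← h]
  refine lintegral_congr fun x => ?_
  simp [cauchyPDF, cauchyPDFReal]

end Departure

/-! ### Non-degeneracy of the linear part -/

/-- The projection on the `c`-th observation of the normalized sum over triples through `c`. -/
def projThrough (F : Measure ℝ) (n c : ℕ) (x : ℝ) : ℝ :=
  ((pairsBelow n c).card * proj₁ F x + (pairsAround n c).card * proj₂ F x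
    + (pairsAbove n c).card * proj₃ F x) / (n - 1).choose 2

/-- The asymptotic variance of the normalized statistic at sample size `n`. -/
def varProj (F : Measure ℝ) (n : ℕ) : ℝ :=
  9 / n * ∑ c ∈ Finset.range n, ∫ x, projThrough F n c x ^ 2 ∂F

section

variable (F : Measure ℝ) [IsProbabilityMeasure F]

lemma measurable_projThrough (n c : ℕ) : Measurable (projThrough F n c) := by
  have h1 := measurable_proj₁ F
  have h2 := measurable_proj₂ F
  have h3 := measurable_proj₃ F
  unfold projThrough
  fun_prop

lemma choose_two_pos {n : ℕ} (hn : 3 ≤ n) : (0 : ℝ) < (n - 1).choose 2 := by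
  exact_mod_cast Nat.choose_pos (by omega)

lemma cast_pred_choose_two {n : ℕ} (hn : 1 ≤ n) :
    (((n - 1).choose 2 : ℕ) : ℝ) = (n - 1) * (n - 2) / 2 := by
  rw [Nat.cast_choose_two, Nat.cast_sub hn]
  push_cast
  ring

lemma abs_projThrough_le {n c : ℕ} (hn : 3 ≤ n) (hc : c < n) (x : ℝ) :
    |projThrough F n c x| ≤ 1 := by
  have hpos := choose_two_pos hn
  rw [projThrough, abs_div, abs_of_pos hpos, div_le_one hpos, ← card_pairs_add hc]
  refine (abs_add_three _ _ _).trans (add_le_add (add_le_add ?_ ?_) ?_)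
  · rw [abs_mul, Nat.abs_cast]
    exact mul_le_of_le_one_right (Nat.cast_nonneg _) (abs_proj₁_le F x)
  · rw [abs_mul, Nat.abs_cast]
    exact mul_le_of_le_one_right (Nat.cast_nonneg _) (abs_proj₂_le F x)
  · rw [abs_mul, Nat.abs_cast]
    exact mul_le_of_le_one_right (Nat.cast_nonneg _) (abs_proj₃_le F x)

lemma integral_projThrough (n c : ℕ) : ∫ x, projThrough F n c x ∂F = 0 := by
  have i1 : Integrable (fun x => ((pairsBelow n c).card : ℝ) * proj₁ F x) F :=
    (integrable_of_abs_le (measurable_proj₁ F) (abs_proj₁_le F)).const_mul _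
  have i2 : Integrable (fun x => ((pairsAround n c).card : ℝ) * proj₂ F x) F :=
    (integrable_of_abs_le (measurable_proj₂ F) (abs_proj₂_le F)).const_mul _
  have i3 : Integrable (fun x => ((pairsAbove n c).card : ℝ) * proj₃ F x) F :=
    (integrable_of_abs_le (measurable_proj₃ F) (abs_proj₃_le F)).const_mul _
  have i12 : Integrable (fun x => ((pairsBelow n c).card : ℝ) * proj₁ F x
    + ((pairsAround n c).card : ℝ) * proj₂ F x) F := i1.add i2
  unfold projThrough
  rw [integral_div, integral_add i12 i3, integral_add i1 i2, integral_const_mul,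
    integral_const_mul, integral_const_mul, integral_proj₁, integral_proj₂, integral_proj₃]
  simp

variable {F}

/-- For positions where one projection carries weight `1 - ρ` close to one: the other two, of total
weight `ρ`, cannot cancel its second moment. -/
lemma le_integral_sq_add {g r : ℝ → ℝ} (hg : Measurable g) (hr : Measurable r)
    (hg1 : ∀ x, |g x| ≤ 1) {ρ a : ℝ} (hρ : 0 ≤ ρ) (hrρ : ∀ x, |r x| ≤ ρ)
    (ha : ∫ x, g x ^ 2 ∂F = a) (hρa : ρ ≤ a / 4) :
    a / 8 ≤ ∫ x, ((1 - ρ) * g x + r x) ^ 2 ∂F := by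
  have hsq : ∀ x, g x ^ 2 ≤ 1 := fun x => by
    rw [← sq_abs]; exact pow_le_one₀ (abs_nonneg _) (hg1 x)
  have hi : Integrable (fun x => g x ^ 2) F := integrable_of_abs_le (C := 1) (by fun_prop)
    fun x => by rw [abs_of_nonneg (sq_nonneg _)]; exact hsq x
  have ha1 : a ≤ 1 := by
    rw [← ha]
    calc ∫ x, g x ^ 2 ∂F ≤ ∫ _, 1 ∂F := integral_mono hi (integrable_const _) hsq
      _ = 1 := by simp
  have ha0 : 0 ≤ a := by rw [← ha]; exact integral_nonneg fun x => sq_nonneg _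
  have hbd : ∀ x, |(1 - ρ) * g x + r x| ≤ 1 := fun x => by
    calc _ ≤ |(1 - ρ) * g x| + |r x| := abs_add_le _ _
      _ ≤ (1 - ρ) * 1 + ρ := by
        rw [abs_mul, abs_of_nonneg (by linarith : 0 ≤ 1 - ρ)]
        exact add_le_add (mul_le_mul_of_nonneg_left (hg1 x) (by linarith)) (hrρ x)
      _ = 1 := by ring
  have hi2 : Integrable (fun x => ((1 - ρ) * g x + r x) ^ 2) F :=
    integrable_of_abs_le (C := 1) (by fun_prop) fun x => by
      rw [abs_pow]; exact pow_le_one₀ (abs_nonneg _) (hbd x)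
  -- The inequality `(x + y)² ≥ x² / 2 - y²`.
  have hlow : ∀ x, (1 - ρ) ^ 2 / 2 * g x ^ 2 - ρ ^ 2 ≤ ((1 - ρ) * g x + r x) ^ 2 := fun x => by
    have h1 : r x ^ 2 ≤ ρ ^ 2 := by
      rw [← sq_abs]; exact pow_le_pow_left₀ (abs_nonneg _) (hrρ x) 2
    nlinarith [sq_nonneg ((1 - ρ) * g x + 2 * r x)]
  calc a / 8 ≤ (1 - ρ) ^ 2 / 2 * a - ρ ^ 2 := by
        have h2 : ρ ^ 2 ≤ (a / 4) ^ 2 := pow_le_pow_left₀ hρ hρa 2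
        have h3 : (3 / 4 : ℝ) ^ 2 ≤ (1 - ρ) ^ 2 := pow_le_pow_left₀ (by norm_num) (by linarith) 2
        nlinarith
    _ = ∫ x, ((1 - ρ) ^ 2 / 2 * g x ^ 2 - ρ ^ 2) ∂F := by
        rw [integral_sub (hi.const_mul _) (integrable_const _), integral_const_mul, ha]
        simp
    _ ≤ _ := integral_mono ((hi.const_mul _).sub (integrable_const _)) hi2 hlow

lemma le_mean_of_subset {u : ℕ → ℝ} {a ε : ℝ} {n : ℕ} {G : Finset ℕ} (ha : 0 ≤ a) (hε : 0 < ε)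
    (hn : 2 / ε ≤ n) (hu : ∀ c, 0 ≤ u c) (hG : G ⊆ Finset.range n)
    (hcard : G.card = ⌊ε * n⌋₊) (hGu : ∀ c ∈ G, a / 8 ≤ u c) :
    a * ε / 2 ≤ 9 / n * ∑ c ∈ Finset.range n, u c := by
  have hn0 : (0 : ℝ) < n := lt_of_lt_of_le (by positivity) hn
  rw [div_le_iff₀ hε] at hn
  have h1 : ε * n / 2 ≤ G.card := by
    rw [hcard]
    have := Nat.lt_floor_add_one (ε * n)
    linarith
  have h2 : ε * n / 2 * (a / 8) ≤ ∑ c ∈ Finset.range n, u c := by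
    calc ε * n / 2 * (a / 8) ≤ G.card * (a / 8) := by gcongr
      _ = ∑ c ∈ G, a / 8 := by rw [Finset.sum_const, nsmul_eq_mul]
      _ ≤ ∑ c ∈ G, u c := Finset.sum_le_sum hGu
      _ ≤ _ := Finset.sum_le_sum_of_subset_of_nonneg hG fun c _ _ => hu c
  calc a * ε / 2 ≤ 9 / n * (ε * n / 2 * (a / 8)) := by
        rw [show 9 / (n : ℝ) * (ε * n / 2 * (a / 8)) = a * ε * (9 / 16) by field_simp; ring]
        have : 0 ≤ a * ε := by positivity
        linarith
    _ ≤ _ := by gcongr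

lemma sq_le_choose_two {n : ℕ} (hn : 6 ≤ n) : (n : ℝ) ^ 2 / 4 ≤ (n - 1).choose 2 := by
  have hn' : (6 : ℝ) ≤ n := by exact_mod_cast hn
  rw [cast_pred_choose_two (by omega)]
  nlinarith

/-- For the last `a / 16` fraction of indices, `c` is almost always the largest index of a triple.
At most `(n - c) n ≤ (a / 16) n²` pairs put it elsewhere, out of `C(n-1,2) ≥ n² / 4`, so the weight
of the other projections is at most `a / 4`. -/
lemma exists_le_varProj_of_proj₁ (ha : 0 < ∫ x, proj₁ F x ^ 2 ∂F) :
    ∃ v₀ > 0, ∀ᶠ n : ℕ in atTop, v₀ ≤ varProj F n := by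
  set a := ∫ x, proj₁ F x ^ 2 ∂F with ha_def
  refine ⟨a * (a / 16) / 2, by positivity, ?_⟩
  filter_upwards [eventually_ge_atTop 6,
    tendsto_natCast_atTop_atTop.eventually_ge_atTop (2 / (a / 16))] with n hn hn2
  have hn' : (6 : ℝ) ≤ n := by exact_mod_cast hn
  refine le_mean_of_subset (G := Finset.Ico (n - ⌊a / 16 * n⌋₊) n) ha.le (by positivity) hn2
    (fun c => integral_nonneg fun x => sq_nonneg _) (fun c hc => ?_) ?_ (fun c hc => ?_)
  · exact Finset.mem_range.2 (Finset.mem_Ico.1 hc).2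
  · have ha1 : a ≤ 1 := by
      have := abs_integral_le (μ := F) (f := fun x => proj₁ F x ^ 2) (C := 1) fun x => by
        rw [abs_pow]; exact pow_le_one₀ (abs_nonneg _) (abs_proj₁_le F x)
      exact (le_abs_self _).trans this
    have : ⌊a / 16 * n⌋₊ ≤ n := Nat.floor_le_of_le (by nlinarith)
    rw [Nat.card_Ico]
    omega
  · rw [Finset.mem_Ico] at hc
    have hpos := choose_two_pos (n := n) (by omega)
    have hQ := sq_le_choose_two hn
    set Q : ℝ := (((n - 1).choose 2 : ℕ) : ℝ)
    set ρ : ℝ := ((pairsAround n c).card + (pairsAbove n c).card) / Q with hρ_def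
    have hw : ((pairsBelow n c).card : ℝ) / Q = 1 - ρ := by
      rw [hρ_def, eq_sub_iff_add_eq, ← add_div, ← add_assoc, card_pairs_add hc.2, div_self hpos.ne']
    have hnc : (n : ℝ) - c ≤ a / 16 * n := by
      have h1 : ((n - c : ℕ) : ℝ) ≤ ⌊a / 16 * n⌋₊ := by exact_mod_cast (by omega)
      rw [Nat.cast_sub hc.2.le] at h1
      exact h1.trans (Nat.floor_le (by positivity))
    have hρ : ρ ≤ a / 4 := by
      rw [hρ_def, div_le_iff₀ hpos]
      have h1 : ((pairsAround n c).card : ℝ) ≤ (n - c) * c := by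
        rw [← Nat.cast_sub hc.2.le]; exact_mod_cast card_pairsAround_le n c
      have h2 : ((pairsAbove n c).card : ℝ) ≤ (n - c) * (n - c) := by
        rw [← Nat.cast_sub hc.2.le]; exact_mod_cast card_pairsAbove_le n c
      calc _ ≤ (n - c) * (n : ℝ) := by linarith
        _ ≤ a / 16 * n * n := by gcongr
        _ = a / 4 * (n ^ 2 / 4) := by ring
        _ ≤ a / 4 * Q := by gcongr
    have e : ∀ x, projThrough F n c x = (1 - ρ) * proj₁ F x
        + ((pairsAround n c).card * proj₂ F x + (pairsAbove n c).card * proj₃ F x) / Q := fun x => by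
      rw [← hw, projThrough]; ring
    simp_rw [e]
    refine le_integral_sq_add (measurable_proj₁ F) ?_ (abs_proj₁_le F) (by positivity)
      (fun x => ?_) rfl hρ
    · have h2 := measurable_proj₂ F
      have h3 := measurable_proj₃ F
      fun_prop
    · rw [abs_div, abs_of_pos hpos, hρ_def]
      gcongr
      refine (abs_add_le _ _).trans (add_le_add ?_ ?_)
      · rw [abs_mul, Nat.abs_cast]
        exact mul_le_of_le_one_right (Nat.cast_nonneg _) (abs_proj₂_le F x)
      · rw [abs_mul, Nat.abs_cast]
        exact mul_le_of_le_one_right (Nat.cast_nonneg _) (abs_proj₃_le F x)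

/-- The mirror argument at the beginning of the sample, where `c` is almost always the smallest
index and fills the third place of the kernel. -/
lemma exists_le_varProj_of_proj₃ (ha : 0 < ∫ x, proj₃ F x ^ 2 ∂F) :
    ∃ v₀ > 0, ∀ᶠ n : ℕ in atTop, v₀ ≤ varProj F n := by
  set a := ∫ x, proj₃ F x ^ 2 ∂F with ha_def
  refine ⟨a * (a / 16) / 2, by positivity, ?_⟩
  filter_upwards [eventually_ge_atTop 6,
    tendsto_natCast_atTop_atTop.eventually_ge_atTop (2 / (a / 16))] with n hn hn2
  have hn' : (6 : ℝ) ≤ n := by exact_mod_cast hn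
  have hfloor : ⌊a / 16 * n⌋₊ ≤ n := by
    have ha1 : a ≤ 1 := by
      have := abs_integral_le (μ := F) (f := fun x => proj₃ F x ^ 2) (C := 1) fun x => by
        rw [abs_pow]; exact pow_le_one₀ (abs_nonneg _) (abs_proj₃_le F x)
      exact (le_abs_self _).trans this
    exact Nat.floor_le_of_le (by nlinarith)
  refine le_mean_of_subset (G := Finset.range ⌊a / 16 * n⌋₊) ha.le (by positivity) hn2
    (fun c => integral_nonneg fun x => sq_nonneg _) (Finset.range_mono hfloor)
    (Finset.card_range _) (fun c hc => ?_)
  rw [Finset.mem_range] at hc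
  have hcn : c < n := hc.trans_le hfloor
  have hpos := choose_two_pos (n := n) (by omega)
  have hQ := sq_le_choose_two hn
  set Q : ℝ := (((n - 1).choose 2 : ℕ) : ℝ)
  set ρ : ℝ := ((pairsBelow n c).card + (pairsAround n c).card) / Q with hρ_def
  have hw : ((pairsAbove n c).card : ℝ) / Q = 1 - ρ := by
    rw [hρ_def, eq_sub_iff_add_eq, ← add_div, add_comm, card_pairs_add hcn, div_self hpos.ne']
  have hca : (c : ℝ) ≤ a / 16 * n := by
    have h1 : (c : ℝ) ≤ ⌊a / 16 * n⌋₊ := by exact_mod_cast hc.le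
    exact h1.trans (Nat.floor_le (by positivity))
  have hρ : ρ ≤ a / 4 := by
    rw [hρ_def, div_le_iff₀ hpos]
    have h1 : ((pairsAround n c).card : ℝ) ≤ (n - c) * c := by
      rw [← Nat.cast_sub hcn.le]; exact_mod_cast card_pairsAround_le n c
    have h2 : ((pairsBelow n c).card : ℝ) ≤ c * c := by
      exact_mod_cast card_pairsBelow_le n c
    calc _ ≤ (c : ℝ) * n := by linarith
      _ ≤ a / 16 * n * n := by gcongr
      _ = a / 4 * (n ^ 2 / 4) := by ring
      _ ≤ a / 4 * Q := by gcongr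
  have e : ∀ x, projThrough F n c x = (1 - ρ) * proj₃ F x
      + ((pairsBelow n c).card * proj₁ F x + (pairsAround n c).card * proj₂ F x) / Q := fun x => by
    rw [← hw, projThrough]; ring
  simp_rw [e]
  refine le_integral_sq_add (measurable_proj₃ F) ?_ (abs_proj₃_le F) (by positivity)
    (fun x => ?_) rfl hρ
  · have h1 := measurable_proj₁ F
    have h2 := measurable_proj₂ F
    fun_prop
  · rw [abs_div, abs_of_pos hpos, hρ_def]
    gcongr
    refine (abs_add_le _ _).trans (add_le_add ?_ ?_)
    · rw [abs_mul, Nat.abs_cast]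
      exact mul_le_of_le_one_right (Nat.cast_nonneg _) (abs_proj₁_le F x)
    · rw [abs_mul, Nat.abs_cast]
      exact mul_le_of_le_one_right (Nat.cast_nonneg _) (abs_proj₂_le F x)

end

/-! ### The conditional expectation of the symmetrized kernel -/

section CondExp

variable {Ω : Type*} [mΩ : MeasurableSpace Ω] {P : Measure Ω} [IsProbabilityMeasure P]
  {F : Measure ℝ} [IsProbabilityMeasure F] {X : ℕ → Ω → ℝ}

lemma measurable_h_comp {α : Type*} [MeasurableSpace α] {a b c : α → ℝ} (ha : Measurable a)
    (hb : Measurable b) (hc : Measurable c) : Measurable fun t => h (a t) (b t) (c t) := by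
  have h1 := measurable_kern_comp ha hb hc
  have h2 := measurable_kern_comp ha hc hb
  have h3 := measurable_kern_comp hb hc ha
  unfold h
  fun_prop

lemma abs_h_le (x y z : ℝ) : |h x y z| ≤ 1 := by
  have a1 := kern_nonneg x y z
  have a2 := kern_nonneg x z y
  have a3 := kern_nonneg y z x
  have b1 := kern_le_one x y z
  have b2 := kern_le_one x z y
  have b3 := kern_le_one y z x
  rw [h, abs_le]
  constructor <;> linarith

/-- The projection of the symmetrized kernel on its first argument. -/
def projH (F : Measure ℝ) (x : ℝ) : ℝ :=
  (1 / 3) * (2 * proj₁ F x + proj₃ F x) + (kernMean F - 1 / 2)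

lemma measurable_projH : Measurable (projH F) := by
  have h1 := measurable_proj₁ F
  have h3 := measurable_proj₃ F
  unfold projH
  fun_prop

lemma abs_projH_le (x : ℝ) : |projH F x| ≤ 2 := by
  have h1 := abs_le.1 (abs_proj₁_le F x)
  have h2 := abs_le.1 (abs_proj₃_le F x)
  have h3 := kernMean_mem F
  rw [projH, abs_le]
  constructor <;> linarith

/-- In the three terms of `h`, the first variable stands twice in the first place of `kern` and once
in the third, never in the second; this is why `proj₂` is absent from `projH`. -/
lemma integral_h_sub_projH (x : ℝ) : ∫ q : ℝ × ℝ, (h x q.1 q.2 - projH F x) ∂(F.prod F) = 0 := by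
  have i1 := integrable_kern F (measurable_const (a := x)) measurable_fst measurable_snd
  have i2 := integrable_kern F (measurable_const (a := x)) measurable_snd measurable_fst
  have i3 := integrable_kern F measurable_fst measurable_snd (measurable_const (a := x))
  have i12 : Integrable (fun q : ℝ × ℝ => kern x q.1 q.2 + kern x q.2 q.1) (F.prod F) := i1.add i2
  have i123 : Integrable (fun q : ℝ × ℝ => kern x q.1 q.2 + kern x q.2 q.1 + kern q.1 q.2 x)
    (F.prod F) := i12.add i3
  have hsw : ∫ q : ℝ × ℝ, kern x q.2 q.1 ∂(F.prod F) = ∫ q : ℝ × ℝ, kern x q.1 q.2 ∂(F.prod F) :=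
    integral_prod_swap (μ := F) (ν := F) (fun q : ℝ × ℝ => kern x q.1 q.2)
  have ih : Integrable (fun q : ℝ × ℝ => h x q.1 q.2) (F.prod F) :=
    (i123.const_mul _).sub (integrable_const _)
  rw [integral_sub ih (integrable_const _)]
  unfold h
  rw [integral_sub (i123.const_mul _) (integrable_const _), integral_const_mul,
    integral_add i12 i3, integral_add i1 i2, hsw]
  simp only [integral_const, probReal_univ, smul_eq_mul, projH, proj₁, proj₃]
  ring

lemma setIntegral_projH (hX : ∀ i, Measurable (X i)) (hindep : iIndepFun X P)
    (hlaw : ∀ i, P.map (X i) = F) {B : Set ℝ} (hB : MeasurableSet B) :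
    ∫ ω in X 0 ⁻¹' B, projH F (X 0 ω) ∂P = ∫ ω in X 0 ⁻¹' B, h (X 0 ω) (X 1 ω) (X 2 ω) ∂P := by
  have hf : Measurable fun p : ℝ × ℝ × ℝ => h p.1 p.2.1 p.2.2 - projH F p.1 :=
    (measurable_h_comp (by fun_prop) (by fun_prop) (by fun_prop)).sub
      (measurable_projH.comp measurable_fst)
  have hg : Measurable fun p : ℝ × ℝ × ℝ => B.indicator (fun _ => (1 : ℝ)) p.1 :=
    (measurable_const.indicator hB).comp measurable_fst
  have hf3 : ∀ p : ℝ × ℝ × ℝ, |h p.1 p.2.1 p.2.2 - projH F p.1| ≤ 3 := fun p =>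
    (abs_sub _ _).trans (by
      linarith [abs_h_le p.1 p.2.1 p.2.2, abs_projH_le (F := F) p.1])
  have hg1 : ∀ p : ℝ × ℝ × ℝ, |B.indicator (fun _ => (1 : ℝ)) p.1| ≤ 1 := fun p => by
    by_cases hp : p.1 ∈ B <;> simp [hp]
  -- Orthogonality to the indicator of an event determined by `X 0`: the index `0` fills every place
  -- of the test function, while `1` and `2` are integrated out.
  have key := integral_mul_eq_zero hX hindep hlaw hf hg hf3 hg1 integral_h_sub_projH
    (a := 0) (b := 1) (c := 2) (i := 0) (j := 0) (k := 0) (by norm_num) (by simp) (by simp)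
  have ih : Integrable (fun ω => h (X 0 ω) (X 1 ω) (X 2 ω)) P :=
    integrable_of_abs_le (measurable_h_comp (hX 0) (hX 1) (hX 2))
      fun ω => abs_h_le _ _ _
  have ip : Integrable (fun ω => projH F (X 0 ω)) P :=
    integrable_of_abs_le (measurable_projH.comp (hX 0)) fun ω => abs_projH_le _
  rw [eq_comm, ← sub_eq_zero, ← integral_sub ih.integrableOn ip.integrableOn,
    ← integral_indicator (hX 0 hB), ← key]
  refine integral_congr_ae (ae_of_all _ fun ω => ?_)
  by_cases hω : X 0 ω ∈ B <;> simp [Set.indicator, hω]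

lemma condExp_h_ae_eq (hX : ∀ i, Measurable (X i)) (hindep : iIndepFun X P)
    (hlaw : ∀ i, P.map (X i) = F) :
    (fun ω => projH F (X 0 ω)) =ᵐ[P]
      P[fun ω => h (X 0 ω) (X 1 ω) (X 2 ω) | MeasurableSpace.comap (X 0) inferInstance] := by
  have ih : Integrable (fun ω => h (X 0 ω) (X 1 ω) (X 2 ω)) P :=
    integrable_of_abs_le (measurable_h_comp (hX 0) (hX 1) (hX 2))
      fun ω => abs_h_le _ _ _
  have ip : Integrable (fun ω => projH F (X 0 ω)) P :=
    integrable_of_abs_le (measurable_projH.comp (hX 0)) fun ω => abs_projH_le _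
  have hsm : StronglyMeasurable[MeasurableSpace.comap (X 0) inferInstance]
      (fun ω => projH F (X 0 ω)) :=
    (measurable_projH.comp (comap_measurable (X 0))).stronglyMeasurable
  refine ae_eq_condExp_of_forall_setIntegral_eq (hX 0).comap_le ih (fun s _ _ => ip.integrableOn)
    ?_ hsm.aestronglyMeasurable
  rintro s ⟨B, hB, rfl⟩ -
  exact setIntegral_projH hX hindep hlaw hB

/-- If both second moments vanished, `projH F (X 0)` would be almost surely constant and the
conditional expectation would have variance zero. -/
lemma integral_proj_sq_pos (hX : ∀ i, Measurable (X i)) (hindep : iIndepFun X P)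
    (hlaw : ∀ i, P.map (X i) = F)
    (hσ : 0 < variance
      (P[fun ω => h (X 0 ω) (X 1 ω) (X 2 ω) | MeasurableSpace.comap (X 0) inferInstance]) P) :
    0 < ∫ x, proj₁ F x ^ 2 ∂F ∨ 0 < ∫ x, proj₃ F x ^ 2 ∂F := by
  by_contra! hcon
  have hzero : ∀ g : ℝ → ℝ, Measurable g → (∀ x, |g x| ≤ 1) → ∫ x, g x ^ 2 ∂F ≤ 0 →
      ∀ᵐ ω ∂P, g (X 0 ω) = 0 := by
    intro g hg hg1 hle
    have h0 : ∫ x, g x ^ 2 ∂F = 0 := le_antisymm hle (integral_nonneg fun x => sq_nonneg _)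
    rw [integral_eq_zero_iff_of_nonneg (fun x => sq_nonneg _)
      (integrable_of_abs_le (C := 1) (hg.pow_const 2) fun x => by
        rw [abs_pow]; exact pow_le_one₀ (abs_nonneg _) (hg1 x)), ← hlaw 0] at h0
    filter_upwards [ae_of_ae_map (hX 0).aemeasurable h0] with ω hω
    simpa using hω
  have h1 := hzero _ (measurable_proj₁ F) (abs_proj₁_le F) hcon.1
  have h3 := hzero _ (measurable_proj₃ F) (abs_proj₃_le F) hcon.2
  have hc : (fun _ : Ω => kernMean F - 1 / 2) =ᵐ[P]
      P[fun ω => h (X 0 ω) (X 1 ω) (X 2 ω) | MeasurableSpace.comap (X 0) inferInstance] := by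
    refine EventuallyEq.trans ?_ (condExp_h_ae_eq hX hindep hlaw)
    filter_upwards [h1, h3] with ω hω1 hω3
    simp [projH, hω1, hω3]
  rw [← variance_congr hc] at hσ
  simp [variance, evariance] at hσ

end CondExp

/-! ### Linearization of the statistic and of the pseudo-values -/

/-- The centred statistic. -/
def centredStat (F : Measure ℝ) (n : ℕ) (x : ℕ → ℝ) : ℝ :=
  tripleSum (kernArray (kernMean F) x) (Finset.range n) / n.choose 3

/-- The degenerate part of the centred statistic. -/
def remStat (F : Measure ℝ) (n : ℕ) (x : ℕ → ℝ) : ℝ :=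
  tripleSum (fun i j k => kernRem F (x i, x j, x k)) (Finset.range n) / n.choose 3

/-- The error of the linear approximation of the centred pseudo-value. -/
def pseudoErr (F : Measure ℝ) (n c : ℕ) (x : ℕ → ℝ) : ℝ :=
  pseudoValue x n c - (kernMean F - 1 / 2) - 3 * projThrough F n c (x c)

/-- The second moment of the centred pseudo-values. -/
def pseudoSecond (F : Measure ℝ) (n : ℕ) (x : ℕ → ℝ) : ℝ :=
  (∑ c ∈ Finset.range n, (pseudoValue x n c - (kernMean F - 1 / 2)) ^ 2) / n

/-- The part of the sum through `c` which is degenerate given the `c`-th observation. -/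
def throughRem (F : Measure ℝ) (n c : ℕ) (x : ℕ → ℝ) : ℝ :=
  ∑ q ∈ pairsBelow n c, (kernArray (kernMean F) x c q.1 q.2 - proj₁ F (x c))
    + ∑ q ∈ pairsAround n c, (kernArray (kernMean F) x q.1 c q.2 - proj₂ F (x c))
    + ∑ q ∈ pairsAbove n c, (kernArray (kernMean F) x q.1 q.2 c - proj₃ F (x c))

lemma cube_le_choose_three {n : ℕ} (hn : 6 ≤ n) : (n : ℝ) ^ 3 / 12 ≤ n.choose 3 := by
  have hn' : (6 : ℝ) ≤ n := by exact_mod_cast hn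
  have h1 := sq_le_choose_two hn
  rw [cast_pred_choose_two (by omega)] at h1
  rw [cast_choose_three]
  nlinarith

/-- Grouping the projections of all triples by index gives the position weights; the factor is
`C(n-1,2) / C(n,3) = 3 / n`. -/
lemma centredStat_eq (F : Measure ℝ) {n : ℕ} (hn : 3 ≤ n) (x : ℕ → ℝ) :
    centredStat F n x
      = 3 / n * ∑ c ∈ Finset.range n, projThrough F n c (x c) + remStat F n x := by
  have hn' : (3 : ℝ) ≤ n := by exact_mod_cast hn
  rw [centredStat, tripleSum_decomp _ (fun c => proj₁ F (x c)) (fun c => proj₂ F (x c))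
    (fun c => proj₃ F (x c)), add_div]
  congr 1
  unfold projThrough
  rw [← Finset.sum_div, cast_choose_three, cast_pred_choose_two (by omega)]
  have a1 : (n : ℝ) ≠ 0 := by linarith
  have a2 : (n : ℝ) - 1 ≠ 0 := by linarith
  have a3 : (n : ℝ) - 2 ≠ 0 := by linarith
  field_simp
  ring

/-- The projection enters the pseudo-value with coefficient `3(n-1)/(n-3) = 3 + 6/(n-3)`, which
leaves the middle term here. -/
lemma pseudoErr_eq (F : Measure ℝ) {n c : ℕ} (hn : 4 ≤ n) (hc : c < n) (x : ℕ → ℝ) :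
    pseudoErr F n c x = 6 / ((n - 2) * (n - 3)) * throughRem F n c x
      + 6 / (n - 3) * projThrough F n c (x c) - 2 * n / (n - 3) * centredStat F n x := by
  have hn' : (4 : ℝ) ≤ n := by exact_mod_cast hn
  have hQ : (((n - 1).choose 2 : ℕ) : ℝ) * projThrough F n c (x c)
      = (pairsBelow n c).card * proj₁ F (x c) + (pairsAround n c).card * proj₂ F (x c)
          + (pairsAbove n c).card * proj₃ F (x c) :=
    mul_div_cancel₀ _ (choose_two_pos (by omega)).ne'
  rw [pseudoErr, pseudoValue_sub_eq _ x hn hc, sumThrough_decomp _ (fun c => proj₁ F (x c))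
    (fun c => proj₂ F (x c)) (fun c => proj₃ F (x c)), ← hQ, cast_pred_choose_two (by omega)]
  change 6 / (((n : ℝ) - 2) * (n - 3)) * ((n - 1) * (n - 2) / 2 * projThrough F n c (x c)
    + throughRem F n c x) - 2 * n / (n - 3) * centredStat F n x - 3 * projThrough F n c (x c) = _
  have a3 : (n : ℝ) - 2 ≠ 0 := by linarith
  have a4 : (n : ℝ) - 3 ≠ 0 := by linarith
  field_simp
  ring

/-- The mean squared error of the linear approximation of the pseudo-values. -/
def meanSqErr (F : Measure ℝ) (n : ℕ) (x : ℕ → ℝ) : ℝ :=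
  (∑ c ∈ Finset.range n, pseudoErr F n c x ^ 2) / n

lemma meanSqErr_nonneg (F : Measure ℝ) (n : ℕ) (x : ℕ → ℝ) : 0 ≤ meanSqErr F n x :=
  div_nonneg (Finset.sum_nonneg fun _ _ => sq_nonneg _) (Nat.cast_nonneg _)

section Moments

variable {Ω : Type*} [MeasurableSpace Ω] {P : Measure Ω} {F : Measure ℝ} {X : ℕ → Ω → ℝ}

lemma measurable_deltaHat (hX : ∀ i, Measurable (X i)) (S : Finset ℕ) :
    Measurable fun ω => deltaHat (fun i => X i ω) S := by
  unfold deltaHat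
  refine Measurable.sub_const (Measurable.const_mul ?_ _) _
  exact Finset.measurable_fun_sum _ fun i _ => Finset.measurable_fun_sum _ fun j _ =>
    Finset.measurable_fun_sum _ fun k _ => measurable_kern_comp (hX i) (hX j) (hX k)

lemma measurable_pseudoValue (hX : ∀ i, Measurable (X i)) (n c : ℕ) :
    Measurable fun ω => pseudoValue (fun i => X i ω) n c :=
  ((measurable_deltaHat hX _).const_mul _).sub ((measurable_deltaHat hX _).const_mul _)

lemma measurable_tripleSum {κ : Ω → ℕ → ℕ → ℕ → ℝ}
    (hκ : ∀ i j k, Measurable fun ω => κ ω i j k) (S : Finset ℕ) :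
    Measurable fun ω => tripleSum (κ ω) S := by
  unfold tripleSum
  refine Finset.measurable_fun_sum _ fun i _ => Finset.measurable_fun_sum _ fun j _ =>
    Finset.measurable_fun_sum _ fun k _ => ?_
  split_ifs
  · exact hκ i j k
  · exact measurable_const

lemma measurable_kernArray (hX : ∀ i, Measurable (X i)) (θ : ℝ) (i j k : ℕ) :
    Measurable fun ω => kernArray θ (fun i => X i ω) i j k :=
  (measurable_kern_comp (hX i) (hX j) (hX k)).sub_const _

lemma measurable_centredStat (hX : ∀ i, Measurable (X i)) (n : ℕ) :
    Measurable fun ω => centredStat F n (fun i => X i ω) :=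
  (measurable_tripleSum (measurable_kernArray hX _) _).div_const _

lemma integral_comp_eq (hX : ∀ i, Measurable (X i)) (hlaw : ∀ i, P.map (X i) = F) {f : ℝ → ℝ}
    (hf : Measurable f) (i : ℕ) : ∫ ω, f (X i ω) ∂P = ∫ x, f x ∂F := by
  rw [← hlaw i, integral_map (hX i).aemeasurable hf.aestronglyMeasurable]

lemma integral_lin_comb {a b d : Ω → ℝ} (ha : Integrable a P) (hb : Integrable b P)
    (hd : Integrable d P) (p q r : ℝ) :
    Integrable (fun ω => p * a ω + q * b ω + r * d ω) P ∧
    ∫ ω, (p * a ω + q * b ω + r * d ω) ∂P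
      = p * ∫ ω, a ω ∂P + q * ∫ ω, b ω ∂P + r * ∫ ω, d ω ∂P := by
  have h1 : Integrable (fun ω => p * a ω + q * b ω) P := (ha.const_mul p).add (hb.const_mul q)
  refine ⟨h1.add (hd.const_mul r), ?_⟩
  rw [integral_add h1 (hd.const_mul r), integral_add (ha.const_mul p) (hb.const_mul q),
    integral_const_mul, integral_const_mul, integral_const_mul]

variable [IsProbabilityMeasure P] [IsProbabilityMeasure F]

lemma measurable_remStat (hX : ∀ i, Measurable (X i)) (n : ℕ) :
    Measurable fun ω => remStat F n (fun i => X i ω) :=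
  (measurable_tripleSum (fun i j k => (measurable_kernRem F).comp
    ((hX i).prodMk ((hX j).prodMk (hX k)))) _).div_const _

lemma measurable_pseudoErr (hX : ∀ i, Measurable (X i)) (n c : ℕ) :
    Measurable fun ω => pseudoErr F n c (fun i => X i ω) :=
  ((measurable_pseudoValue hX n c).sub_const _).sub
    (((measurable_projThrough F n c).comp (hX c)).const_mul _)

lemma integral_remStat_sq_le (hX : ∀ i, Measurable (X i)) (hindep : iIndepFun X P)
    (hlaw : ∀ i, P.map (X i) = F) {n : ℕ} (hn : 6 ≤ n) :
    ∫ ω, remStat F n (fun i => X i ω) ^ 2 ∂P ≤ 62208 / n ^ 2 := by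
  have hn' : (6 : ℝ) ≤ n := by exact_mod_cast hn
  have h1 := integral_sum_triples_sq_le hX hindep hlaw (measurable_kernRem F) (abs_kernRem_le F)
    (integral_kernRem₁ F) (integral_kernRem₂ F) (integral_kernRem₃ F) (n := n) (A := triples n)
    (Finset.filter_subset _ _) (by
      intro q hq
      have := (Finset.mem_filter.1 hq).2
      omega)
  have h2 := cube_le_choose_three hn
  unfold remStat
  simp_rw [tripleSum_eq_sum_triples, div_pow]
  rw [integral_div]
  calc _ ≤ 4 ^ 2 * (27 * (n : ℝ) ^ 4) / ((n : ℝ) ^ 3 / 12) ^ 2 := by gcongr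
    _ = 62208 / n ^ 2 := by field_simp; ring

lemma integral_sum_projThrough_sq_le (hX : ∀ i, Measurable (X i)) (hindep : iIndepFun X P)
    (hlaw : ∀ i, P.map (X i) = F) {n : ℕ} (hn : 3 ≤ n) :
    ∫ ω, (∑ c ∈ Finset.range n, projThrough F n c (X c ω)) ^ 2 ∂P ≤ n := by
  have := integral_sum_centred_sq_le hX hindep (measurable_projThrough F n) (C := 1) (n := n)
    (fun c hc x => abs_projThrough_le F hn hc x) (fun c => by
      rw [integral_comp_eq hX hlaw (measurable_projThrough F n c), integral_projThrough])
  simpa using this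

lemma abs_centredStat_le {n : ℕ} (hn : 3 ≤ n) (x : ℕ → ℝ) : |centredStat F n x| ≤ 1 := by
  have hpos : (0 : ℝ) < n.choose 3 := by exact_mod_cast Nat.choose_pos hn
  rw [centredStat, abs_div, abs_of_pos hpos, div_le_one hpos, tripleSum_eq_sum_triples]
  refine (abs_sum_le_card fun q _ =>
    abs_kernArray_le (kernMean_mem F).1 (kernMean_mem F).2 x _ _ _).trans (le_of_eq ?_)
  have := tripleSum_const 1 (Finset.range n)
  rw [tripleSum_eq_sum_triples] at this
  simpa using this

lemma abs_sum_projThrough_le {n : ℕ} (hn : 3 ≤ n) (x : ℕ → ℝ) :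
    |∑ c ∈ Finset.range n, projThrough F n c (x c)| ≤ n := by
  simpa using abs_sum_le_card (A := Finset.range n) (f := fun c => projThrough F n c (x c))
    fun c hc => abs_projThrough_le F hn (Finset.mem_range.1 hc) (x c)

lemma integrable_sq_of_abs_le {f : Ω → ℝ} (hf : Measurable f) {C : ℝ} (hC : ∀ ω, |f ω| ≤ C) :
    Integrable (fun ω => f ω ^ 2) P :=
  integrable_of_abs_le (hf.pow_const 2) (C := C ^ 2) fun ω => by
    rw [abs_pow]; exact pow_le_pow_left₀ (abs_nonneg _) (hC ω) 2

lemma abs_remStat_le {n : ℕ} (hn : 3 ≤ n) (x : ℕ → ℝ) : |remStat F n x| ≤ 4 := by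
  have hn' : (0 : ℝ) < n := by exact_mod_cast (by omega : 0 < n)
  have h1 := centredStat_eq F hn x
  have h2 : remStat F n x
      = centredStat F n x - 3 / n * ∑ c ∈ Finset.range n, projThrough F n c (x c) := by linarith
  rw [h2]
  refine (abs_sub _ _).trans ?_
  rw [abs_mul, abs_of_pos (by positivity : 0 < 3 / (n : ℝ))]
  have h3 : 3 / (n : ℝ) * |∑ c ∈ Finset.range n, projThrough F n c (x c)| ≤ 3 / n * n := by
    gcongr
    exact abs_sum_projThrough_le hn x
  rw [div_mul_cancel₀ _ hn'.ne'] at h3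
  linarith [abs_centredStat_le (F := F) hn x]

lemma integral_centredStat_sq_le (hX : ∀ i, Measurable (X i)) (hindep : iIndepFun X P)
    (hlaw : ∀ i, P.map (X i) = F) {n : ℕ} (hn : 6 ≤ n) :
    ∫ ω, centredStat F n (fun i => X i ω) ^ 2 ∂P ≤ 30000 / n := by
  have hn' : (6 : ℝ) ≤ n := by exact_mod_cast hn
  have hs : Measurable fun ω => ∑ c ∈ Finset.range n, projThrough F n c (X c ω) :=
    Finset.measurable_fun_sum _ fun c _ => (measurable_projThrough F n c).comp (hX c)
  have i1 := integrable_sq_of_abs_le (P := P) (measurable_centredStat (F := F) hX n)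
    fun ω => abs_centredStat_le (F := F) (by omega) _
  have i2 := integrable_sq_of_abs_le (P := P) hs
    fun ω => abs_sum_projThrough_le (F := F) (n := n) (by omega) fun i => X i ω
  have i3 := integrable_sq_of_abs_le (P := P) (measurable_remStat (F := F) hX n)
    fun ω => abs_remStat_le (F := F) (by omega) _
  have h1 := integral_sum_projThrough_sq_le hX hindep hlaw (n := n) (by omega)
  have h2 := integral_remStat_sq_le hX hindep hlaw hn
  calc _ ≤ ∫ ω, (18 / (n : ℝ) ^ 2 * (∑ c ∈ Finset.range n, projThrough F n c (X c ω)) ^ 2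
        + 2 * remStat F n (fun i => X i ω) ^ 2) ∂P := by
        refine integral_mono i1 ((i2.const_mul _).add (i3.const_mul _)) fun ω => ?_
        beta_reduce
        rw [centredStat_eq F (by omega)]
        set a := ∑ c ∈ Finset.range n, projThrough F n c (X c ω)
        set b := remStat F n (fun i => X i ω)
        have : 18 / (n : ℝ) ^ 2 * a ^ 2 = 2 * (3 / n * a) ^ 2 := by field_simp; ring
        rw [this]
        nlinarith [sq_nonneg (3 / n * a - b)]
    _ = 18 / (n : ℝ) ^ 2 * ∫ ω, (∑ c ∈ Finset.range n, projThrough F n c (X c ω)) ^ 2 ∂P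
        + 2 * ∫ ω, remStat F n (fun i => X i ω) ^ 2 ∂P := by
        rw [integral_add (i2.const_mul _) (i3.const_mul _), integral_const_mul,
          integral_const_mul]
    _ ≤ 18 / (n : ℝ) ^ 2 * n + 2 * (62208 / n ^ 2) := by gcongr
    _ = (18 + 124416 / n) / n := by field_simp; norm_num
    _ ≤ 30000 / n := by
        gcongr
        have : 124416 / (n : ℝ) ≤ 124416 / 6 := by gcongr
        linarith

/-- Given observation `c`, each of the three sums is degenerate over pairs, with kernel bounded by
`2`, so its mean square is at most `16 n³`. The square of a sum of three is at most three times the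
sum of the squares. -/
lemma integral_throughRem_sq_le (hX : ∀ i, Measurable (X i)) (hindep : iIndepFun X P)
    (hlaw : ∀ i, P.map (X i) = F) (n c : ℕ) :
    Integrable (fun ω => throughRem F n c (fun i => X i ω) ^ 2) P ∧
    ∫ ω, throughRem F n c (fun i => X i ω) ^ 2 ∂P ≤ 144 * (n : ℝ) ^ 3 := by
  have hθ := kernMean_mem F
  have m1 := measurable_proj₁ F
  have m2 := measurable_proj₂ F
  have m3 := measurable_proj₃ F
  have bound : ∀ (a b d : ℝ) (g : ℝ), |g| ≤ 1 → |kern a b d - kernMean F - g| ≤ 2 := by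
    intro a b d g hg
    have h1 := abs_le.1 hg
    have h2 := kern_nonneg a b d
    have h3 := kern_le_one a b d
    rw [abs_le]
    constructor <;> linarith
  have deg : ∀ (u : ℝ × ℝ → ℝ) (g : ℝ), Integrable u (F.prod F) →
      g = ∫ q, u q ∂(F.prod F) - kernMean F → ∫ q, (u q - kernMean F - g) ∂(F.prod F) = 0 := by
    intro u g hu hg
    have i1 : Integrable (fun q => u q - kernMean F) (F.prod F) := hu.sub (integrable_const _)
    rw [integral_sub i1 (integrable_const _), integral_sub hu (integrable_const _), hg]
    simp
  have f1m : Measurable fun p : ℝ × ℝ × ℝ => kern p.1 p.2.1 p.2.2 - kernMean F - proj₁ F p.1 :=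
    (measurable_kern.sub_const _).sub (m1.comp measurable_fst)
  have f2m : Measurable fun p : ℝ × ℝ × ℝ => kern p.2.1 p.1 p.2.2 - kernMean F - proj₂ F p.1 :=
    ((measurable_kern_comp (by fun_prop) (by fun_prop) (by fun_prop)).sub_const _).sub
      (m2.comp measurable_fst)
  have f3m : Measurable fun p : ℝ × ℝ × ℝ => kern p.2.1 p.2.2 p.1 - kernMean F - proj₃ F p.1 :=
    ((measurable_kern_comp (by fun_prop) (by fun_prop) (by fun_prop)).sub_const _).sub
      (m3.comp measurable_fst)
  have h1 := integral_sum_pairs_sq_le hX hindep hlaw f1m (fun p => bound _ _ _ _ (abs_proj₁_le F _))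
    (fun x => deg (fun q => kern x q.1 q.2) _
      (integrable_kern F measurable_const measurable_fst measurable_snd) rfl) (c := c)
    (pairsBelow_subset n c) (by
      intro q hq
      have := (Finset.mem_filter.1 hq).2
      omega)
  have h2 := integral_sum_pairs_sq_le hX hindep hlaw f2m (fun p => bound _ _ _ _ (abs_proj₂_le F _))
    (fun x => deg (fun q => kern q.1 x q.2) _
      (integrable_kern F measurable_fst measurable_const measurable_snd) rfl) (c := c)
    (pairsAround_subset n c) (by
      intro q hq
      have := (Finset.mem_filter.1 hq).2
      omega)
  have h3 := integral_sum_pairs_sq_le hX hindep hlaw f3m (fun p => bound _ _ _ _ (abs_proj₃_le F _))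
    (fun x => deg (fun q => kern q.1 q.2 x) _
      (integrable_kern F measurable_fst measurable_snd measurable_const) rfl) (c := c)
    (pairsAbove_subset n c) (by
      intro q hq
      have := (Finset.mem_filter.1 hq).2
      omega)
  have sumbound : ∀ (A : Finset (ℕ × ℕ)) (f : ℝ × ℝ × ℝ → ℝ), Measurable f → (∀ p, |f p| ≤ 2) →
      Measurable (fun ω => ∑ q ∈ A, f (X c ω, X q.1 ω, X q.2 ω)) ∧
      Integrable (fun ω => (∑ q ∈ A, f (X c ω, X q.1 ω, X q.2 ω)) ^ 2) P := by
    intro A f hf hf2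
    have hm : Measurable (fun ω => ∑ q ∈ A, f (X c ω, X q.1 ω, X q.2 ω)) :=
      Finset.measurable_fun_sum _ fun q _ => by fun_prop
    refine ⟨hm, integrable_sq_of_abs_le hm (C := ∑ q ∈ A, 2) fun ω => ?_⟩
    exact (Finset.abs_sum_le_sum_abs _ _).trans (Finset.sum_le_sum fun q _ => hf2 _)
  obtain ⟨n1, j1⟩ := sumbound (pairsBelow n c) _ f1m fun p => bound _ _ _ _ (abs_proj₁_le F _)
  obtain ⟨n2, j2⟩ := sumbound (pairsAround n c) _ f2m fun p => bound _ _ _ _ (abs_proj₂_le F _)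
  obtain ⟨n3, j3⟩ := sumbound (pairsAbove n c) _ f3m fun p => bound _ _ _ _ (abs_proj₃_le F _)
  have hle : ∀ ω, throughRem F n c (fun i => X i ω) ^ 2
      ≤ 3 * (∑ q ∈ pairsBelow n c,
          (kern (X c ω) (X q.1 ω) (X q.2 ω) - kernMean F - proj₁ F (X c ω))) ^ 2
        + 3 * (∑ q ∈ pairsAround n c,
          (kern (X q.1 ω) (X c ω) (X q.2 ω) - kernMean F - proj₂ F (X c ω))) ^ 2
        + 3 * (∑ q ∈ pairsAbove n c,
          (kern (X q.1 ω) (X q.2 ω) (X c ω) - kernMean F - proj₃ F (X c ω))) ^ 2 := by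
    intro ω
    simp only [throughRem, kernArray]
    generalize (∑ q ∈ pairsBelow n c,
      (kern (X c ω) (X q.1 ω) (X q.2 ω) - kernMean F - proj₁ F (X c ω))) = a
    generalize (∑ q ∈ pairsAround n c,
      (kern (X q.1 ω) (X c ω) (X q.2 ω) - kernMean F - proj₂ F (X c ω))) = b
    generalize (∑ q ∈ pairsAbove n c,
      (kern (X q.1 ω) (X q.2 ω) (X c ω) - kernMean F - proj₃ F (X c ω))) = d
    nlinarith [sq_nonneg (a - b), sq_nonneg (a - d), sq_nonneg (b - d)]
  obtain ⟨j123, e⟩ := integral_lin_comb j1 j2 j3 3 3 3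
  have hmeas : Measurable fun ω => throughRem F n c (fun i => X i ω) := (n1.add n2).add n3
  have hint : Integrable (fun ω => throughRem F n c (fun i => X i ω) ^ 2) P :=
    j123.mono' (hmeas.pow_const 2).aestronglyMeasurable (ae_of_all _ fun ω => by
      rw [Real.norm_eq_abs, abs_of_nonneg (sq_nonneg _)]
      exact hle ω)
  refine ⟨hint, (integral_mono hint j123 hle).trans ?_⟩
  rw [e]
  linarith

lemma integral_pseudoErr_sq_le (hX : ∀ i, Measurable (X i)) (hindep : iIndepFun X P)
    (hlaw : ∀ i, P.map (X i) = F) {n c : ℕ} (hn : 6 ≤ n) (hc : c < n) :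
    ∫ ω, pseudoErr F n c (fun i => X i ω) ^ 2 ∂P ≤ 2000000 / n := by
  have hn' : (6 : ℝ) ≤ n := by exact_mod_cast hn
  have hn0 : (0 : ℝ) < n := by linarith
  obtain ⟨i1, h1⟩ := integral_throughRem_sq_le hX hindep hlaw n c
  have i2 := integrable_sq_of_abs_le (P := P) (measurable_centredStat (F := F) hX n)
    fun ω => abs_centredStat_le (F := F) (by omega) _
  have h2 := integral_centredStat_sq_le hX hindep hlaw hn
  have hle : ∀ ω, pseudoErr F n c (fun i => X i ω) ^ 2
      ≤ 1728 / (n : ℝ) ^ 4 * throughRem F n c (fun i => X i ω) ^ 2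
        + 48 * centredStat F n (fun i => X i ω) ^ 2 + 432 / (n : ℝ) ^ 2 := by
    intro ω
    rw [pseudoErr_eq F (by omega) hc]
    have hV := abs_projThrough_le F (n := n) (by omega) hc (X c ω)
    set d := throughRem F n c (fun i => X i ω)
    set w := projThrough F n c (X c ω)
    set m := centredStat F n (fun i => X i ω)
    have q3 : (0 : ℝ) < n - 3 := by linarith
    have q2 : (0 : ℝ) < n - 2 := by linarith
    have b1 : (6 / (((n : ℝ) - 2) * (n - 3)) * d) ^ 2 ≤ 576 / (n : ℝ) ^ 4 * d ^ 2 := by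
      rw [mul_pow]
      gcongr
      have : 6 / (((n : ℝ) - 2) * (n - 3)) ≤ 24 / (n : ℝ) ^ 2 := by
        rw [div_le_div_iff₀ (by positivity) (by positivity)]
        nlinarith
      calc (6 / (((n : ℝ) - 2) * (n - 3))) ^ 2 ≤ (24 / (n : ℝ) ^ 2) ^ 2 := by gcongr
        _ = 576 / (n : ℝ) ^ 4 := by field_simp; norm_num
    have b2 : (6 / ((n : ℝ) - 3) * w) ^ 2 ≤ 144 / (n : ℝ) ^ 2 := by
      rw [mul_pow]
      have : 6 / ((n : ℝ) - 3) ≤ 12 / n := by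
        rw [div_le_div_iff₀ (by positivity) (by positivity)]
        nlinarith
      have hw : w ^ 2 ≤ 1 := by rw [← sq_abs]; exact pow_le_one₀ (abs_nonneg _) hV
      calc (6 / ((n : ℝ) - 3)) ^ 2 * w ^ 2 ≤ (12 / (n : ℝ)) ^ 2 * 1 := by gcongr
        _ = 144 / (n : ℝ) ^ 2 := by field_simp; norm_num
    have b3 : (2 * (n : ℝ) / (n - 3) * m) ^ 2 ≤ 16 * m ^ 2 := by
      rw [mul_pow]
      gcongr
      have : 2 * (n : ℝ) / (n - 3) ≤ 4 := by
        rw [div_le_iff₀ q3]; linarith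
      calc (2 * (n : ℝ) / (n - 3)) ^ 2 ≤ 4 ^ 2 := by gcongr
        _ = 16 := by norm_num
    have e1 : 1728 / (n : ℝ) ^ 4 * d ^ 2 = 3 * (576 / (n : ℝ) ^ 4 * d ^ 2) := by ring
    have e2 : 432 / (n : ℝ) ^ 2 = 3 * (144 / (n : ℝ) ^ 2) := by ring
    rw [e1, e2]
    generalize 6 / (((n : ℝ) - 2) * (n - 3)) * d = x at *
    generalize 6 / ((n : ℝ) - 3) * w = y at *
    generalize 2 * (n : ℝ) / (n - 3) * m = z at *
    nlinarith [sq_nonneg (x - y), sq_nonneg (x + z), sq_nonneg (y + z)]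
  obtain ⟨j2, e⟩ := integral_lin_comb i1 i2 (integrable_const (μ := P) (1 : ℝ))
    (1728 / (n : ℝ) ^ 4) 48 (432 / (n : ℝ) ^ 2)
  simp only [integral_const, probReal_univ, one_smul, mul_one] at j2 e
  calc _ ≤ _ := integral_mono_of_nonneg (ae_of_all _ fun ω => sq_nonneg _) j2 (ae_of_all _ hle)
    _ = 1728 / (n : ℝ) ^ 4 * ∫ ω, throughRem F n c (fun i => X i ω) ^ 2 ∂P
        + 48 * ∫ ω, centredStat F n (fun i => X i ω) ^ 2 ∂P + 432 / (n : ℝ) ^ 2 :=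
        e
    _ ≤ 1728 / (n : ℝ) ^ 4 * (144 * (n : ℝ) ^ 3) + 48 * (30000 / n) + 432 / (n : ℝ) ^ 2 := by
        gcongr
    _ = (1728 * 144 + 48 * 30000 + 432 / n) / n := by field_simp
    _ ≤ 2000000 / n := by
        gcongr
        have : 432 / (n : ℝ) ≤ 432 / 6 := by gcongr
        linarith

/-- The fluctuation of the mean of the squared projections. -/
def varFluct (F : Measure ℝ) (n : ℕ) (x : ℕ → ℝ) : ℝ :=
  9 / n * ∑ c ∈ Finset.range n,
    (projThrough F n c (x c) ^ 2 - ∫ y, projThrough F n c y ^ 2 ∂F)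

lemma integral_varFluct_sq_le (hX : ∀ i, Measurable (X i)) (hindep : iIndepFun X P)
    (hlaw : ∀ i, P.map (X i) = F) {n : ℕ} (hn : 3 ≤ n) :
    ∫ ω, varFluct F n (fun i => X i ω) ^ 2 ∂P ≤ 81 / n := by
  have hn0 : (0 : ℝ) < n := by exact_mod_cast (by omega : 0 < n)
  have hm : ∀ c, Measurable fun x => projThrough F n c x ^ 2 - ∫ y, projThrough F n c y ^ 2 ∂F :=
    fun c => ((measurable_projThrough F n c).pow_const 2).sub_const _
  have hb : ∀ c < n, ∀ x, projThrough F n c x ^ 2 ≤ 1 := fun c hc x => by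
    rw [← sq_abs]; exact pow_le_one₀ (abs_nonneg _) (abs_projThrough_le F hn hc x)
  have hb' : ∀ c < n, ∫ y, projThrough F n c y ^ 2 ∂F ≤ 1 := fun c hc =>
    (integral_mem_Icc (fun _ => sq_nonneg _) (hb c hc)).2
  have hb0 : ∀ c, 0 ≤ ∫ y, projThrough F n c y ^ 2 ∂F := fun c => integral_nonneg fun _ => sq_nonneg _
  -- The summands are set to zero from `n` on, because centring is required at every index whereas
  -- the bound on `projThrough` is available only for `c < n`.
  have key := integral_sum_centred_sq_le (P := P) hX hindep
    (f := fun c x => if c < n then projThrough F n c x ^ 2 - ∫ y, projThrough F n c y ^ 2 ∂F else 0)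
    (fun c => by split_ifs; exacts [hm c, measurable_const]) (C := 1) (n := n)
    (fun c hc x => by
      rw [if_pos hc, abs_le]
      have := hb c hc x
      have := hb' c hc
      have := hb0 c
      have := sq_nonneg (projThrough F n c x)
      constructor <;> linarith)
    (fun c => by
      split_ifs with hc
      · rw [integral_comp_eq hX hlaw (hm c), integral_sub
          (integrable_of_abs_le ((measurable_projThrough F n c).pow_const 2) (C := 1) fun x => by
            rw [abs_of_nonneg (sq_nonneg _)]; exact hb c hc x) (integrable_const _)]
        simp
      · simp)
  have e : ∀ ω, varFluct F n (fun i => X i ω) ^ 2 = 81 / (n : ℝ) ^ 2 *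
      (∑ c ∈ Finset.range n, if c < n then
        projThrough F n c (X c ω) ^ 2 - ∫ y, projThrough F n c y ^ 2 ∂F else 0) ^ 2 := by
    intro ω
    have : ∑ c ∈ Finset.range n, (projThrough F n c (X c ω) ^ 2
        - ∫ y, projThrough F n c y ^ 2 ∂F) = ∑ c ∈ Finset.range n, if c < n then
        projThrough F n c (X c ω) ^ 2 - ∫ y, projThrough F n c y ^ 2 ∂F else 0 :=
      Finset.sum_congr rfl fun c hc => by rw [if_pos (Finset.mem_range.1 hc)]
    rw [varFluct, this, mul_pow, div_pow]
    norm_num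
  simp_rw [e]
  rw [integral_const_mul]
  calc _ ≤ 81 / (n : ℝ) ^ 2 * (1 ^ 2 * n) := by gcongr
    _ = 81 / n := by field_simp

/-- Expanding the square of `3 * projThrough + pseudoErr` and applying Cauchy-Schwarz to the cross
term, where the mean of `projThrough ^ 2` is at most one. -/
lemma abs_pseudoSecond_sub_le {n : ℕ} (hn : 3 ≤ n) (x : ℕ → ℝ) :
    |pseudoSecond F n x - varProj F n|
      ≤ |varFluct F n x| + 6 * √(meanSqErr F n x) + meanSqErr F n x := by
  have hn0 : (0 : ℝ) < n := by exact_mod_cast (by omega : 0 < n)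
  have e : pseudoSecond F n x - varProj F n = varFluct F n x
      + 6 * ((∑ c ∈ Finset.range n, projThrough F n c (x c) * pseudoErr F n c x) / n)
      + meanSqErr F n x := by
    have h1 : ∀ c, (pseudoValue x n c - (kernMean F - 1 / 2)) ^ 2
        = 9 * projThrough F n c (x c) ^ 2
          + 6 * (projThrough F n c (x c) * pseudoErr F n c x) + pseudoErr F n c x ^ 2 := by
      intro c
      rw [pseudoErr]
      ring
    simp only [pseudoSecond, varProj, varFluct, meanSqErr, h1, Finset.sum_add_distrib,
      Finset.sum_sub_distrib, ← Finset.mul_sum]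
    field_simp
    ring
  have hcs : |(∑ c ∈ Finset.range n, projThrough F n c (x c) * pseudoErr F n c x) / n|
      ≤ √(meanSqErr F n x) := by
    refine Real.abs_le_sqrt ?_
    have h2 := Finset.sum_mul_sq_le_sq_mul_sq (Finset.range n)
      (fun c => projThrough F n c (x c)) (fun c => pseudoErr F n c x)
    have h3 : ∑ c ∈ Finset.range n, projThrough F n c (x c) ^ 2 ≤ n := by
      calc _ ≤ ∑ c ∈ Finset.range n, (1 : ℝ) := Finset.sum_le_sum fun c hc => by
            rw [← sq_abs]
            exact pow_le_one₀ (abs_nonneg _)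
              (abs_projThrough_le F hn (Finset.mem_range.1 hc) (x c))
        _ = n := by simp
    have h4 : 0 ≤ ∑ c ∈ Finset.range n, pseudoErr F n c x ^ 2 :=
      Finset.sum_nonneg fun _ _ => sq_nonneg _
    rw [div_pow, meanSqErr, div_le_div_iff₀ (by positivity) hn0]
    have h5 := h2.trans (mul_le_mul_of_nonneg_right h3 h4)
    nlinarith
  rw [e]
  refine (abs_add_three _ _ _).trans ?_
  rw [abs_mul, abs_of_nonneg (meanSqErr_nonneg F n x), abs_of_pos (by norm_num : (0 : ℝ) < 6)]
  gcongr

lemma abs_pseudoErr_le {n c : ℕ} (hn : 6 ≤ n) (hc : c < n) (x : ℕ → ℝ) :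
    |pseudoErr F n c x| ≤ 13 := by
  have h1 := abs_pseudoValue_sub_le (kernMean_mem F).1 (kernMean_mem F).2 x hn hc
  have h2 := abs_projThrough_le F (by omega : 3 ≤ n) hc (x c)
  rw [pseudoErr]
  refine (abs_sub _ _).trans ?_
  rw [abs_mul, abs_of_pos (by norm_num : (0 : ℝ) < 3)]
  linarith

lemma integral_meanSqErr_le (hX : ∀ i, Measurable (X i)) (hindep : iIndepFun X P)
    (hlaw : ∀ i, P.map (X i) = F) {n : ℕ} (hn : 6 ≤ n) :
    Integrable (fun ω => meanSqErr F n (fun i => X i ω)) P ∧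
    ∫ ω, meanSqErr F n (fun i => X i ω) ∂P ≤ 2000000 / n := by
  have hn0 : (0 : ℝ) < n := by exact_mod_cast (by omega : 0 < n)
  have hi : ∀ c ∈ Finset.range n, Integrable (fun ω => pseudoErr F n c (fun i => X i ω) ^ 2) P :=
    fun c hc => integrable_sq_of_abs_le (measurable_pseudoErr hX n c)
      fun ω => abs_pseudoErr_le hn (Finset.mem_range.1 hc) _
  refine ⟨(integrable_finsetSum _ hi).div_const _, ?_⟩
  unfold meanSqErr
  rw [integral_div, integral_finsetSum _ hi, div_le_iff₀ hn0]
  calc _ ≤ ∑ c ∈ Finset.range n, 2000000 / (n : ℝ) := Finset.sum_le_sum fun c hc =>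
        integral_pseudoErr_sq_le hX hindep hlaw hn (Finset.mem_range.1 hc)
    _ = _ := by rw [Finset.sum_const, Finset.card_range, nsmul_eq_mul]; ring

end Moments

/-! ### Measurability of the likelihood ratio statistic -/

section Measurability

variable {Ω : Type*} [MeasurableSpace Ω] {X : ℕ → Ω → ℝ}

lemma measurable_comp_of_countable_range {β γ : Type*} [MeasurableSpace β]
    [MeasurableSingletonClass β] [MeasurableSpace γ] {φ : Ω → β} (hφ : Measurable φ) {C : Set β}
    (hC : C.Countable) (h : ∀ ω, φ ω ∈ C) (ψ : β → γ) : Measurable fun ω => ψ (φ ω) := by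
  intro s _
  have : (fun ω => ψ (φ ω)) ⁻¹' s = φ ⁻¹' (C ∩ ψ ⁻¹' s) := by
    ext ω
    simp [h ω]
  rw [this]
  exact hφ (hC.mono Set.inter_subset_left).measurableSet

lemma exists_deltaHat_eq (x : ℕ → ℝ) (S : Finset ℕ) :
    ∃ N : ℕ, deltaHat x S = ((S.card.choose 3 : ℕ) : ℝ)⁻¹ * N - 1 / 2 := by
  refine ⟨∑ i ∈ S, ∑ j ∈ S with j < i, ∑ k ∈ S with k < j,
    if (x i * x j - 1) / (2 * x j) ≤ x k then 1 else 0, ?_⟩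
  push_cast
  rfl

lemma elRatio_congr {z z' : ℕ → ℝ} {n : ℕ} (hz : ∀ i < n, z i = z' i) (θ : ℝ) :
    elRatio z n θ = elRatio z' n θ := by
  unfold elRatio
  have : ∀ p : ℕ → ℝ, ∑ i ∈ Finset.range n, p i * z i = ∑ i ∈ Finset.range n, p i * z' i :=
    fun p => Finset.sum_congr rfl fun i hi => by rw [hz i (Finset.mem_range.1 hi)]
  simp_rw [this]

/-- The supremum over the weights needs no analysis: kernel sums are integers, so the vector of
pseudo-values lies in a countable set, and any function of it is measurable. -/
lemma measurable_negTwoLogJEL (hX : ∀ i, Measurable (X i)) (n : ℕ) (θ : ℝ) :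
    Measurable fun ω => negTwoLogJEL (fun i => X i ω) n θ := by
  have hφ : Measurable fun ω (c : Fin n) => pseudoValue (fun i => X i ω) n c :=
    measurable_pi_lambda _ fun c => measurable_pseudoValue hX n c
  let C : Fin n → Set ℝ := fun c => Set.range fun p : ℕ × ℕ =>
    n * ((((Finset.range n).card.choose 3 : ℕ) : ℝ)⁻¹ * p.1 - 1 / 2)
      - ((n : ℝ) - 1) * (((((Finset.range n).erase c).card.choose 3 : ℕ) : ℝ)⁻¹ * p.2 - 1 / 2)
  have hC : (Set.univ.pi C).Countable := Set.countable_univ_pi fun c => Set.countable_range _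
  have key := measurable_comp_of_countable_range hφ hC (fun ω c _ => by
      obtain ⟨N, hN⟩ := exists_deltaHat_eq (fun i => X i ω) (Finset.range n)
      obtain ⟨N', hN'⟩ := exists_deltaHat_eq (fun i => X i ω) ((Finset.range n).erase c)
      exact ⟨(N, N'), by
        change _ = pseudoValue (fun i => X i ω) n c
        rw [pseudoValue, hN, hN']⟩)
    (fun v => ((-2 : ℝ) : EReal) * ENNReal.log (ENNReal.ofReal
      (elRatio (fun i => if hi : i < n then v ⟨i, hi⟩ else 0) n θ)))
  convert key using 2 with ω
  rw [negTwoLogJEL, jelRatio_eq_elRatio]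
  congr 3
  exact elRatio_congr (fun i hi => by simp [hi]) θ

end Measurability

/-! ### Slutsky-type lemmas, including the extended reals -/

section Distribution

lemma tendsto_measureReal_of_integral_le {Ω : Type*} [MeasurableSpace Ω] {P : Measure Ω}
    {U : ℕ → Ω → ℝ} {C : ℝ}
    (hU0 : ∀ n ω, 0 ≤ U n ω) (hU : ∀ᶠ n in atTop, Integrable (U n) P)
    (hC : ∀ᶠ n : ℕ in atTop, ∫ ω, U n ω ∂P ≤ C / n) {ε : ℝ} (hε : 0 < ε) :
    Tendsto (fun n => P.real {ω | ε ≤ U n ω}) atTop (nhds 0) := by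
  have hlim : Tendsto (fun n : ℕ => C / n / ε) atTop (nhds 0) := by
    simpa using (tendsto_const_div_atTop_nhds_zero_nat C).div_const ε
  refine squeeze_zero' (Eventually.of_forall fun n => measureReal_nonneg) ?_ hlim
  filter_upwards [hU, hC] with n h1 h2
  rw [le_div_iff₀ hε, mul_comm]
  exact (mul_meas_ge_le_integral_of_nonneg (ae_of_all _ (hU0 n)) h1 ε).trans h2

variable {Ω Γ : Type*} [MeasurableSpace Ω] [MeasurableSpace Γ] {P : Measure Ω}
  [IsProbabilityMeasure P] {Q : Measure Γ} [IsProbabilityMeasure Q]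

/-- Convergence in distribution is unaffected by changes on sets of vanishing probability. -/
lemma tendstoInDistribution_of_measureReal_ne {E : Type*} [TopologicalSpace E]
    [MeasurableSpace E] [OpensMeasurableSpace E] {X Y : ℕ → Ω → E} {Z : Γ → E}
    (hX : TendstoInDistribution X atTop Z (fun _ => P) Q) (hY : ∀ n, AEMeasurable (Y n) P)
    (h : Tendsto (fun n => P.real {ω | Y n ω ≠ X n ω}) atTop (nhds 0)) :
    TendstoInDistribution Y atTop Z (fun _ => P) Q where
  forall_aemeasurable := hY
  aemeasurable_limit := hX.aemeasurable_limit
  tendsto := by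
    have hXm := hX.forall_aemeasurable
    have hXt := hX.tendsto
    refine ProbabilityMeasure.tendsto_iff_forall_integral_tendsto.2 fun f => ?_
    have h1 := ProbabilityMeasure.tendsto_iff_forall_integral_tendsto.1 hXt f
    simp only [ProbabilityMeasure.coe_mk] at h1 ⊢
    have hf : Measurable f := f.continuous.measurable
    have hdiff : Tendsto (fun n => ∫ y, f y ∂(P.map (Y n)) - ∫ y, f y ∂(P.map (X n))) atTop
        (nhds 0) := by
      refine squeeze_zero_norm (a := fun n => 2 * ‖f‖ * P.real {ω | Y n ω ≠ X n ω}) (fun n => ?_)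
        (by simpa using h.const_mul (2 * ‖f‖))
      have iY : Integrable (fun ω => f (Y n ω)) P := Integrable.of_bound
        (hf.comp_aemeasurable (hY n)).aestronglyMeasurable ‖f‖
        (ae_of_all _ fun ω => f.norm_coe_le_norm _)
      have iX : Integrable (fun ω => f (X n ω)) P := Integrable.of_bound
        (hf.comp_aemeasurable (hXm n)).aestronglyMeasurable ‖f‖
        (ae_of_all _ fun ω => f.norm_coe_le_norm _)
      rw [integral_map (hY n) hf.aestronglyMeasurable, integral_map (hXm n) hf.aestronglyMeasurable,
        ← integral_sub iY iX]
      set S := toMeasurable P {ω | Y n ω ≠ X n ω} with hS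
      have hSm : MeasurableSet S := measurableSet_toMeasurable _ _
      calc ‖∫ ω, (f (Y n ω) - f (X n ω)) ∂P‖ ≤ ∫ ω, ‖f (Y n ω) - f (X n ω)‖ ∂P :=
            norm_integral_le_integral_norm _
        _ ≤ ∫ ω, S.indicator (fun _ => 2 * ‖f‖) ω ∂P := by
            refine integral_mono (iY.sub iX).norm ((integrable_const _).indicator hSm) fun ω => ?_
            by_cases hω : Y n ω = X n ω
            · simp only [hω, sub_self, norm_zero]
              exact Set.indicator_nonneg (fun _ _ => by positivity) _
            · rw [Set.indicator_of_mem (subset_toMeasurable _ _ hω)]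
              refine (norm_sub_le _ _).trans ?_
              linarith [f.norm_coe_le_norm (Y n ω), f.norm_coe_le_norm (X n ω)]
        _ = 2 * ‖f‖ * P.real {ω | Y n ω ≠ X n ω} := by
            rw [integral_indicator_const _ hSm, smul_eq_mul, mul_comm, measureReal_def,
              measureReal_def, hS, measure_toMeasurable]
    simpa using hdiff.add h1

/-- Convergence in distribution of extended real variables close to real ones. -/
lemma tendstoInDistribution_ereal_of_close {W : ℕ → Ω → EReal} {U : ℕ → Ω → ℝ} {Z : Γ → ℝ}
    (hU : TendstoInDistribution U atTop Z (fun _ => P) Q) (hW : ∀ n, Measurable (W n))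
    (h : ∀ ε > 0, Tendsto (fun n => P.real {ω | ¬ ∃ w : ℝ, W n ω = w ∧ |w - U n ω| ≤ ε}) atTop
      (nhds 0)) :
    TendstoInDistribution W atTop (fun ω => (Z ω : EReal)) (fun _ => P) Q := by
  have hWr : ∀ n, Measurable fun ω => (W n ω).toReal := fun n =>
    measurable_ereal_toReal.comp (hW n)
  -- Slutsky's theorem is applied to the real part. The statistic differs from its coerced real part
  -- only where it is infinite, an event of vanishing probability.
  have h1 : TendstoInDistribution (fun n ω => (W n ω).toReal) atTop Z (fun _ => P) Q := by
    refine tendstoInDistribution_of_tendstoInMeasure_sub _ Z hU ?_ fun n => (hWr n).aemeasurable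
    rw [tendstoInMeasure_iff_measureReal_norm]
    intro ε hε
    refine squeeze_zero (fun n => measureReal_nonneg) (fun n => measureReal_mono ?_)
      (h (ε / 2) (by positivity))
    rintro ω hω ⟨w, hw, hwU⟩
    simp only [Pi.sub_apply, Pi.zero_apply, sub_zero, Real.norm_eq_abs, Set.mem_ofPred_eq, hw,
      EReal.toReal_coe] at hω
    linarith
  refine tendstoInDistribution_of_measureReal_ne (h1.continuous_comp
    (g := fun x : ℝ => (x : EReal)) continuous_coe_real_ereal)
    (fun n => (hW n).aemeasurable) ?_
  refine squeeze_zero (fun n => measureReal_nonneg) (fun n => measureReal_mono ?_)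
    (h 1 one_pos)
  rintro ω hω ⟨w, hw, -⟩
  simp [hw] at hω

end Distribution

/-! ### The limit law -/

section Main

variable {Ω : Type*} [MeasurableSpace Ω] {P : Measure Ω} [IsProbabilityMeasure P]
  {F : Measure ℝ} [IsProbabilityMeasure F] {X : ℕ → Ω → ℝ}

lemma tendsto_measureReal_centredStat (hX : ∀ i, Measurable (X i)) (hindep : iIndepFun X P)
    (hlaw : ∀ i, P.map (X i) = F) {η : ℝ} (hη : 0 < η) :
    Tendsto (fun n => P.real {ω | η ≤ |centredStat F n (fun i => X i ω)|}) atTop (nhds 0) := by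
  refine squeeze_zero (fun n => measureReal_nonneg) (fun n => measureReal_mono ?_)
    (tendsto_measureReal_of_integral_le (P := P) (ε := η ^ 2) (C := 30000)
      (U := fun n ω => centredStat F n (fun i => X i ω) ^ 2) (fun n ω => sq_nonneg _) ?_ ?_
      (by positivity))
  · intro ω hω
    simp only [Set.mem_ofPred_eq] at hω ⊢
    rw [← sq_abs (centredStat F n _)]
    exact pow_le_pow_left₀ hη.le hω 2
  · filter_upwards [eventually_ge_atTop 6] with n hn
    exact integrable_sq_of_abs_le (measurable_centredStat hX n)
      fun ω => abs_centredStat_le (F := F) (by omega) _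
  · filter_upwards [eventually_ge_atTop 6] with n hn
    exact integral_centredStat_sq_le hX hindep hlaw hn

lemma abs_varFluct_le {n : ℕ} (hn : 3 ≤ n) (x : ℕ → ℝ) : |varFluct F n x| ≤ 9 := by
  have hn0 : (0 : ℝ) < n := by exact_mod_cast (by omega : 0 < n)
  have hb : ∀ c < n, ∀ x, projThrough F n c x ^ 2 ≤ 1 := fun c hc x => by
    rw [← sq_abs]; exact pow_le_one₀ (abs_nonneg _) (abs_projThrough_le F hn hc x)
  have h1 := abs_sum_le_card (A := Finset.range n)
    (f := fun c => projThrough F n c (x c) ^ 2 - ∫ y, projThrough F n c y ^ 2 ∂F) (fun c hc => by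
      rw [Finset.mem_range] at hc
      have h1 := integral_mem_Icc (μ := F) (fun _ => sq_nonneg _) (hb c hc)
      have h2 := hb c hc (x c)
      have h3 := sq_nonneg (projThrough F n c (x c))
      rw [abs_le]
      constructor <;> linarith)
  rw [Finset.card_range] at h1
  rw [varFluct, abs_mul, abs_of_pos (by positivity : (0 : ℝ) < 9 / n)]
  calc _ ≤ 9 / (n : ℝ) * n := by gcongr
    _ = 9 := by field_simp

lemma measurable_varFluct (hX : ∀ i, Measurable (X i)) (n : ℕ) :
    Measurable fun ω => varFluct F n (fun i => X i ω) := by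
  unfold varFluct
  exact (Finset.measurable_fun_sum _ fun c _ =>
    (((measurable_projThrough F n c).comp (hX c)).pow_const 2).sub_const _).const_mul _

lemma tendsto_measureReal_pseudoSecond (hX : ∀ i, Measurable (X i)) (hindep : iIndepFun X P)
    (hlaw : ∀ i, P.map (X i) = F) {η : ℝ} (hη : 0 < η) :
    Tendsto (fun n => P.real {ω | η < |pseudoSecond F n (fun i => X i ω) - varProj F n|}) atTop
      (nhds 0) := by
  -- Off the two exceptional events the error is below `η / 2 + 6ρ + ρ²`, hence below `η / 2 + 7ρ ≤
  -- η`.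
  set ρ := min 1 (η / 14) with hρ
  have hρ0 : 0 < ρ := by positivity
  have hA : Tendsto (fun n => P.real {ω | (η / 2) ^ 2 ≤ varFluct F n (fun i => X i ω) ^ 2}) atTop
      (nhds 0) := by
    refine tendsto_measureReal_of_integral_le (C := 81) (fun n ω => sq_nonneg _) ?_ ?_
      (by positivity)
    · filter_upwards [eventually_ge_atTop 3] with n hn
      exact integrable_sq_of_abs_le (measurable_varFluct hX n) fun ω => abs_varFluct_le hn _
    · filter_upwards [eventually_ge_atTop 3] with n hn
      exact integral_varFluct_sq_le hX hindep hlaw hn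
  have hE : Tendsto (fun n => P.real {ω | ρ ^ 2 ≤ meanSqErr F n (fun i => X i ω)}) atTop
      (nhds 0) := by
    refine tendsto_measureReal_of_integral_le (C := 2000000)
      (fun n ω => meanSqErr_nonneg F n _) ?_ ?_ (by positivity)
    · filter_upwards [eventually_ge_atTop 6] with n hn
      exact (integral_meanSqErr_le hX hindep hlaw hn).1
    · filter_upwards [eventually_ge_atTop 6] with n hn
      exact (integral_meanSqErr_le hX hindep hlaw hn).2
  have hsum := hA.add hE
  rw [add_zero] at hsum
  refine squeeze_zero' (Eventually.of_forall fun n => measureReal_nonneg) ?_ hsum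
  filter_upwards [eventually_ge_atTop 3] with n hn
  refine (measureReal_mono ?_).trans (measureReal_union_le _ _)
  intro ω hω
  by_contra hcon
  simp only [Set.mem_union, Set.mem_ofPred_eq, not_or, not_le] at hcon hω
  have h1 : |varFluct F n (fun i => X i ω)| < η / 2 := abs_lt_of_sq_lt_sq hcon.1 (by positivity)
  have h2 : √(meanSqErr F n (fun i => X i ω)) ≤ ρ := by
    rw [Real.sqrt_le_left hρ0.le]; exact hcon.2.le
  have h3 : ρ ^ 2 ≤ ρ := by
    have : ρ ≤ 1 := min_le_left _ _
    nlinarith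
  have h4 : ρ ≤ η / 14 := min_le_right _ _
  linarith [abs_pseudoSecond_sub_le (F := F) hn fun i => X i ω, hcon.2]

lemma negTwoLogJEL_of_pos {x : ℕ → ℝ} {n : ℕ} {θ : ℝ} (h : 0 < jelRatio x n θ) :
    negTwoLogJEL x n θ = ((-2 * Real.log (jelRatio x n θ) : ℝ) : EReal) := by
  rw [negTwoLogJEL, ENNReal.log_ofReal_of_pos h, EReal.coe_mul]

/-- With probability tending to one, the likelihood ratio statistic is close to the squared
standardized statistic. -/
lemma tendsto_measureReal_negTwoLogJEL (hX : ∀ i, Measurable (X i)) (hindep : iIndepFun X P)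
    (hlaw : ∀ i, P.map (X i) = F) {v₀ : ℝ} (hv₀ : 0 < v₀)
    (hv : ∀ᶠ n in atTop, v₀ ≤ varProj F n) {ε : ℝ} (hε : 0 < ε) :
    Tendsto (fun n => P.real {ω | ¬ ∃ w : ℝ,
      negTwoLogJEL (fun i => X i ω) n (kernMean F - 1 / 2) = w ∧
        |w - (√n * centredStat F n (fun i => X i ω) / √(varProj F n)) ^ 2| ≤ ε}) atTop
      (nhds 0) := by
  rw [Metric.tendsto_atTop']
  suffices ∀ δ > 0, ∀ᶠ n : ℕ in atTop, P.real {ω | ¬ ∃ w : ℝ,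
      negTwoLogJEL (fun i => X i ω) n (kernMean F - 1 / 2) = w ∧
        |w - (√n * centredStat F n (fun i => X i ω) / √(varProj F n)) ^ 2| ≤ ε} < δ by
    intro δ hδ
    obtain ⟨N, hN⟩ := eventually_atTop.1 (this δ hδ)
    refine ⟨N, fun n hn => ?_⟩
    rw [Real.dist_eq, sub_zero, abs_of_nonneg measureReal_nonneg]
    exact hN n hn.le
  intro δ hδ
  -- Since `n * centredStat ^ 2` has mean at most `30000`, Markov's inequality at level `90000 / δ`
  -- leaves probability at most `δ / 3`. The level has to be fixed before `η`.
  obtain ⟨η, hη, hEL⟩ := exists_negTwoLog_elRatio_close hv₀ (by norm_num : (0 : ℝ) < 10)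
    (by positivity : 0 < 90000 / δ) hε
  filter_upwards [eventually_ge_atTop 6, hv,
    (tendsto_measureReal_centredStat hX hindep hlaw hη).eventually_lt_const
      (by positivity : 0 < δ / 3),
    (tendsto_measureReal_pseudoSecond hX hindep hlaw hη).eventually_lt_const
      (by positivity : 0 < δ / 3)] with n hn hvn hm hs
  have hn0 : (0 : ℝ) < n := by exact_mod_cast (by omega : 0 < n)
  have hM : P.real {ω | 90000 / δ ≤ n * centredStat F n (fun i => X i ω) ^ 2} ≤ δ / 3 := by
    have h1 := mul_meas_ge_le_integral_of_nonneg (μ := P)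
      (f := fun ω => n * centredStat F n (fun i => X i ω) ^ 2)
      (ae_of_all _ fun ω => by positivity)
      ((integrable_sq_of_abs_le (measurable_centredStat hX n)
        fun ω => abs_centredStat_le (F := F) (by omega) _).const_mul _) (90000 / δ)
    rw [integral_const_mul] at h1
    have h2 : n * ∫ ω, centredStat F n (fun i => X i ω) ^ 2 ∂P ≤ n * (30000 / n) := by
      gcongr
      exact integral_centredStat_sq_le hX hindep hlaw hn
    rw [mul_div_cancel₀ _ hn0.ne'] at h2
    have h3 := h1.trans h2
    rw [← le_div_iff₀' (by positivity)] at h3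
    refine h3.trans (le_of_eq ?_)
    field_simp
    norm_num
  have hsub : {ω | ¬ ∃ w : ℝ, negTwoLogJEL (fun i => X i ω) n (kernMean F - 1 / 2) = w ∧
        |w - (√n * centredStat F n (fun i => X i ω) / √(varProj F n)) ^ 2| ≤ ε}
      ⊆ {ω | 90000 / δ ≤ n * centredStat F n (fun i => X i ω) ^ 2}
        ∪ ({ω | η ≤ |centredStat F n (fun i => X i ω)|}
          ∪ {ω | η < |pseudoSecond F n (fun i => X i ω) - varProj F n|}) := by
    intro ω hω
    by_contra hcon
    simp only [Set.mem_union, Set.mem_ofPred_eq, not_or, not_le, not_lt] at hcon hω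
    obtain ⟨c1, c2, c3⟩ := hcon
    obtain ⟨hpos, hclose⟩ := hEL n (pseudoValue (fun i => X i ω) n) (kernMean F - 1 / 2)
      (centredStat F n fun i => X i ω) (pseudoSecond F n fun i => X i ω) (varProj F n) (by omega)
      (sum_pseudoValue_sub _ _ (by omega))
      (by rw [pseudoSecond, mul_div_cancel₀ _ hn0.ne'])
      (fun c hc => abs_pseudoValue_sub_le (kernMean_mem F).1 (kernMean_mem F).2 _ hn
        (Finset.mem_range.1 hc)) hvn c1.le c2.le c3
    refine hω ⟨_, negTwoLogJEL_of_pos hpos, ?_⟩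
    rwa [div_pow, mul_pow, Real.sq_sqrt hn0.le, Real.sq_sqrt (hv₀.le.trans hvn)]
  calc _ ≤ _ := measureReal_mono hsub
    _ ≤ _ := measureReal_union_le _ _
    _ ≤ δ / 3 + (P.real {ω | η ≤ |centredStat F n (fun i => X i ω)|}
          + P.real {ω | η < |pseudoSecond F n (fun i => X i ω) - varProj F n|}) :=
        add_le_add hM (measureReal_union_le _ _)
    _ < δ := by linarith

/-- Asymptotic normality of the self-normalized statistic. -/
lemma tendstoInDistribution_centredStat (hX : ∀ i, Measurable (X i)) (hindep : iIndepFun X P)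
    (hlaw : ∀ i, P.map (X i) = F) {v₀ : ℝ} (hv₀ : 0 < v₀)
    (hv : ∀ᶠ n in atTop, v₀ ≤ varProj F n) :
    TendstoInDistribution
      (fun (n : ℕ) ω => √n * centredStat F n (fun i => X i ω) / √(varProj F n)) atTop
      (id : ℝ → ℝ) (fun _ => P) (gaussianReal 0 1) := by
  have hm : ∀ n c : ℕ, Measurable fun ω => 3 / (√n * √(varProj F n)) * projThrough F n c (X c ω) :=
    fun n c => ((measurable_projThrough F n c).comp (hX c)).const_mul _
  -- The normalization by `varProj F n` makes the total variance exactly one once this variance is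
  -- positive, and `v₀` makes the summands uniformly `O(1/√n)`.
  have hclt := tendstoInDistribution_sum_of_bounded (P := P)
    (Y := fun n c ω => 3 / (√n * √(varProj F n)) * projThrough F n c (X c ω))
    (c := fun n => 3 / √v₀ * (√n)⁻¹) hm
    (fun n => hindep.comp (fun c x => 3 / (√n * √(varProj F n)) * projThrough F n c x)
      fun c => (measurable_projThrough F n c).const_mul _)
    (fun n c => by
      rw [integral_const_mul, integral_comp_eq hX hlaw (measurable_projThrough F n c),
        integral_projThrough, mul_zero])
    (by
      filter_upwards [eventually_ge_atTop 3, hv] with n hn hvn c hc ω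
      have hn0 : (0 : ℝ) < n := by exact_mod_cast (by omega : 0 < n)
      have hvn0 : 0 < varProj F n := hv₀.trans_le hvn
      rw [abs_mul, abs_of_pos (by positivity : 0 < 3 / (√n * √(varProj F n)))]
      calc _ ≤ 3 / (√n * √v₀) * 1 := by
            gcongr
            exact abs_projThrough_le F hn hc _
        _ = 3 / √v₀ * (√n)⁻¹ := by field_simp)
    (by
      have : Tendsto (fun n : ℕ => (√(n : ℝ))⁻¹) atTop (nhds 0) :=
        tendsto_inv_atTop_zero.comp (Real.tendsto_sqrt_atTop.comp tendsto_natCast_atTop_atTop)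
      simpa using this.const_mul (3 / √v₀))
    (by
      filter_upwards [eventually_ge_atTop 3, hv] with n hn hvn
      have hn0 : (0 : ℝ) < n := by exact_mod_cast (by omega : 0 < n)
      have hvn0 : 0 < varProj F n := hv₀.trans_le hvn
      have e : ∀ c, ∫ ω, (3 / (√n * √(varProj F n)) * projThrough F n c (X c ω)) ^ 2 ∂P
          = 9 / n / varProj F n * ∫ x, projThrough F n c x ^ 2 ∂F := by
        intro c
        simp_rw [mul_pow]
        rw [integral_const_mul, integral_comp_eq hX hlaw (f := fun x => projThrough F n c x ^ 2)
          ((measurable_projThrough F n c).pow_const 2), div_pow, mul_pow, Real.sq_sqrt hn0.le,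
          Real.sq_sqrt hvn0.le, div_div]
        norm_num
      simp_rw [e]
      rw [← Finset.mul_sum, div_mul_eq_mul_div]
      exact div_self hvn0.ne')
  refine tendstoInDistribution_of_tendstoInMeasure_sub _ _ hclt ?_ fun n =>
    (((measurable_centredStat hX n).const_mul _).div_const _).aemeasurable
  rw [tendstoInMeasure_iff_measureReal_norm]
  intro ε hε
  -- The scaled remainder still has mean square `O(1/n)`, and dividing by `varProj F n ≥ v₀` is
  -- harmless.
  have hrem := tendsto_measureReal_of_integral_le (P := P) (ε := ε ^ 2 * v₀) (C := 62208)
    (U := fun n ω => n * remStat F n (fun i => X i ω) ^ 2) (fun n ω => by positivity)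
    (by
      filter_upwards [eventually_ge_atTop 3] with n hn
      exact (integrable_sq_of_abs_le (measurable_remStat hX n)
        fun ω => abs_remStat_le hn _).const_mul _)
    (by
      filter_upwards [eventually_ge_atTop 6] with n hn
      have hn0 : (0 : ℝ) < n := by exact_mod_cast (by omega : 0 < n)
      rw [integral_const_mul]
      calc _ ≤ (n : ℝ) * (62208 / n ^ 2) := by
            gcongr
            exact integral_remStat_sq_le hX hindep hlaw hn
        _ = 62208 / n := by field_simp) (by positivity)
  refine squeeze_zero' (Eventually.of_forall fun n => measureReal_nonneg) ?_ hrem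
  filter_upwards [eventually_ge_atTop 3, hv] with n hn hvn
  refine measureReal_mono ?_
  intro ω hω
  have hn0 : (0 : ℝ) < n := by exact_mod_cast (by omega : 0 < n)
  have hvn0 : 0 < varProj F n := hv₀.trans_le hvn
  have e : √n * centredStat F n (fun i => X i ω) / √(varProj F n)
      - ∑ c ∈ Finset.range n, 3 / (√n * √(varProj F n)) * projThrough F n c (X c ω)
      = √n * remStat F n (fun i => X i ω) / √(varProj F n) := by
    rw [← Finset.mul_sum, centredStat_eq F hn]
    have h1 : √(n : ℝ) * (3 / n) = 3 / √n := by
      rw [mul_div_assoc', eq_div_iff (by positivity), div_mul_eq_mul_div, div_eq_iff hn0.ne']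
      nlinarith [Real.mul_self_sqrt hn0.le]
    rw [mul_add, ← mul_assoc, h1]
    field_simp
    ring
  simp only [Set.mem_ofPred_eq, Pi.sub_apply, Pi.zero_apply, sub_zero, Real.norm_eq_abs, e] at hω ⊢
  have h2 : ε ^ 2 ≤ n * remStat F n (fun i => X i ω) ^ 2 / varProj F n := by
    calc ε ^ 2 ≤ |√n * remStat F n (fun i => X i ω) / √(varProj F n)| ^ 2 :=
          pow_le_pow_left₀ hε.le hω 2
      _ = _ := by
          rw [sq_abs, div_pow, mul_pow, Real.sq_sqrt hn0.le, Real.sq_sqrt hvn0.le]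
  rw [le_div_iff₀ hvn0] at h2
  refine le_trans ?_ h2
  gcongr

theorem tendstoInDistribution_negTwoLogJEL [NullSingletonClass F] (hX : ∀ i, Measurable (X i))
    (hindep : iIndepFun X P) (hlaw : ∀ i, P.map (X i) = F)
    (hσ : 0 < variance
      (P[fun ω => h (X 0 ω) (X 1 ω) (X 2 ω) | MeasurableSpace.comap (X 0) inferInstance]) P) :
    TendstoInDistribution
      (fun (n : ℕ) ω => negTwoLogJEL (fun i => X i ω) n (departure F))
      atTop (fun z : ℝ => (z : EReal)) (fun _ => P) chiSquaredOne := by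
  obtain ⟨v₀, hv₀, hv⟩ : ∃ v₀ > 0, ∀ᶠ n : ℕ in atTop, v₀ ≤ varProj F n := by
    rcases integral_proj_sq_pos hX hindep hlaw hσ with h1 | h3
    · exact exists_le_varProj_of_proj₁ h1
    · exact exists_le_varProj_of_proj₃ h3
  have hsq := (tendstoInDistribution_centredStat hX hindep hlaw hv₀ hv).continuous_comp
    (g := fun z : ℝ => z ^ 2) (by fun_prop)
  have key := tendstoInDistribution_ereal_of_close
    (W := fun n ω => negTwoLogJEL (fun i => X i ω) n (departure F)) hsq
    (fun n => measurable_negTwoLogJEL hX n _) (fun ε hε => by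
      rw [departure_eq]
      exact tendsto_measureReal_negTwoLogJEL hX hindep hlaw hv₀ hv hε)
  refine ⟨key.forall_aemeasurable, measurable_coe_real_ereal.aemeasurable, ?_⟩
  have hmap : (gaussianReal 0 1).map (fun z : ℝ => (((fun z : ℝ => z ^ 2) ∘ id) z : EReal))
      = chiSquaredOne.map (fun z : ℝ => (z : EReal)) := by
    rw [chiSquaredOne, Measure.map_map measurable_coe_real_ereal (by fun_prop)]
    rfl
  have ht := key.tendsto
  convert ht using 2
  exact congrArg nhds (Subtype.ext hmap.symm)

end Main

end CauchyJEL

end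

theorem theorem3 {Ω : Type*} [mΩ : MeasurableSpace Ω] (P : Measure Ω) [IsProbabilityMeasure P]
    (F : Measure ℝ) [NullSingletonClass F]
    (X : ℕ → Ω → ℝ) (hX : ∀ i, Measurable (X i))
    (hindep : iIndepFun X P) (hlaw : ∀ i, P.map (X i) = F)
    (hh : MemLp (fun ω => CauchyJEL.h (X 0 ω) (X 1 ω) (X 2 ω)) 2 P)
    (hσ : 0 < variance
      (P[fun ω => CauchyJEL.h (X 0 ω) (X 1 ω) (X 2 ω) |
        MeasurableSpace.comap (X 0) inferInstance]) P) :
    TendstoInDistribution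
      (fun (n : ℕ) ω =>
        CauchyJEL.negTwoLogJEL (fun i => X i ω) n (CauchyJEL.departure F))
      atTop (fun z : ℝ => (z : EReal)) (fun _ => P) CauchyJEL.chiSquaredOne ∧
    (F = cauchyMeasure 0 1 →
      CauchyJEL.departure F = 0 ∧
      TendstoInDistribution
        (fun (n : ℕ) ω => CauchyJEL.negTwoLogJEL (fun i => X i ω) n 0)
        atTop (fun z : ℝ => (z : EReal)) (fun _ => P) CauchyJEL.chiSquaredOne) := by
  have hF : IsProbabilityMeasure F := by
    rw [← hlaw 0]; exact Measure.isProbabilityMeasure_map (hX 0).aemeasurable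
  have hmain := CauchyJEL.tendstoInDistribution_negTwoLogJEL hX hindep hlaw hσ
  refine ⟨hmain, fun hC => ?_⟩
  -- The Cauchy law is used only through its symmetry; absence of atoms is already assumed.
  have h0 : CauchyJEL.departure F = 0 := by
    rw [CauchyJEL.departure_eq, CauchyJEL.kernMean_eq_half F (by
      rw [hC]; exact CauchyJEL.cauchyMeasure_map_neg), sub_self]
  rw [h0] at hmain
  exact ⟨h0, hmain⟩
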